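/- **Setting.** Let $x,y,h$ be the basis of $\mathfrak{sl}_2$ with $[x,y]=h$, $[h,x]=2x$, $[h,y]=-2y$, and let $x',y',h'$ be the dual basis. Let $\mathcal W$ be the semi-infinite Weil algebra of $\mathfrak{sl}_2$ over $\mathbb C$, i.e. the $bc\beta\gamma$ system with even generators $\beta^\xi,\gamma^{\xi'}$ and odd generators $b^\xi,c^{\xi'}$ ($\xi\in\{x,y,h\}$) and with nontrivial OPEs $\beta^\xi(z)\gamma^{\eta'}(w)\sim\delta_{\xi\eta}(z-w)^{-1}$ and $b^\xi(z)c^{\eta'}(w)\sim\delta_{\xi\eta}(z-w)^{-1}$. Vertex operators $a(z)=\sum_k a(k)z^{-k-1}$ are identified with the vectors $a(-1)1$ of the Fock space; $:\ :$ is the Wick product, and $:a_1\cdots a_r:\,=\,:a_1(:a_2\cdots a_r:):$. The conformal weights of $\beta,\gamma,b,c$ are $1,0,1,0$ ($\partial$ adds $1$), their cohomological degrees are $-2,2,-1,1$ ($\partial$ adds $0$). $\mathcal W_{(k)}$ is the span of the iterated Wick products of length at most $k$ of generators and their derivatives; elements of $\mathcal W_{(k)}\setminus\mathcal W_{(k-1)}$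 have polynomial degree $k$. Put $$\Theta^\xi=\sum_{\eta}\big(:b^{[\xi,\eta]}c^{\eta'}:-:\beta^{[\xi,\eta]}\gamma^{\eta'}:\big),\qquad K=\sum_\xi:\gamma^{\xi'}b^\xi:,\qquad F=-\sum_\xi:b^\xi c^{\xi'}:,$$ where $\xi,\eta$ run over $x,y,h$. Let $\mathcal W_{bas}=\{\omega\in\mathcal W:\ b^\xi(k)\omega=\Theta^\xi(k)\omega=0\ \text{for all }\xi\text{ and all }k\ge0\}$, a complex under $K(0)$, which raises the cohomological degree by $1$. Let $\mathcal W_{bas}^{(2)}$ be the subspace of $\mathcal W_{bas}$ on which $-F(0)$ acts as $2$ ($b$-number $2$), and let $H^p(\mathcal W_{bas},K(0))$ be the cohomology in cohomological degree $p$. Put $$v^h=:\beta^h\gamma^{h'}:+:\beta^x\gamma^{x'}:+:\beta^y\gamma^{y'}:,\quad v^x=\tfrac12\big(:\gamma^{h'}\gamma^{h'}:+:\gamma^{x'}\gamma^{y'}:\big),\quad v^y=-\tfrac12\big(:\beta^h\beta^h:+4:\beta^x\beta^y:\big),$$ $$C^{\gamma bb}=-:\gamma^{h'}b^xb^y:+\tfrac12:\gamma^{x'}b^xb^h:-\tfrac12:\gamma^{y'}b^yb^h:,\qquad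 C^{\beta bb}=:\beta^hb^xb^y:+:\beta^xb^yb^h:-:\beta^yb^xb^h:.$$ **Statement.** For all integers $n\ge1$ and $0\le d\le n$, with $\mu=:(v^y)^{n-d}(v^h)^d:$, there is an element $$\omega=\,:\mu\,C^{\gamma bb}:+:f\,C^{\beta bb}:+\,\rho\ \in\ \mathcal W_{bas}^{(2)}\cap\ker K(0)$$ of polynomial degree $2n+3$, where $f$ is a linear combination of the normally ordered monomials $:(v^x)^r(v^y)^s(v^h)^t:$ with $r+s+t=n$, $f$ has polynomial degree $2n$, and $\rho\in\mathcal W_{(2n+1)}$; it is homogeneous of weight $2n-d+2$ and of cohomological degree $-4(n-d)$, and its class in $H^{-4(n-d)}(\mathcal W_{bas},K(0))$ is nonzero. For $d=0$ one can take $\omega=h_{2n+2}$, where $$h_{2n+2}=:(v^y)^nC^{\gamma bb}:-\tfrac{n}{2n+2}:(v^y)^{n-1}v^hC^{\beta bb}:-\tfrac{n^2-n}{2n^2+3n+1}:\partial v^y\,(v^y)^{n-2}C^{\beta bb}:-\tfrac{2n^2+3n}{4n^2+6n+2}:(v^y)^{n-1}\partial C^{\beta bb}:$$ (for $n=1$ the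 third term is absent). -/

import Mathlib

open scoped TensorProduct

noncomputable section

namespace ChiralSL2

/-! ## The Fock space of the `bcβγ` system attached to `𝔰𝔩₂` -/

/-- The standard basis `x, y, h` of `𝔰𝔩₂`. -/
inductive Root
  | x
  | y
  | h
  deriving DecidableEq

instance : Fintype Root := ⟨{.x, .y, .h}, fun i => by cases i <;> decide⟩

/-- Structure constants: `bracket i j k` is the coefficient of `k` in `[i, j]`, where
`[x,y] = h`, `[h,x] = 2x`, `[h,y] = -2y`. -/
def bracket : Root → Root → Root → ℂ
  | .x, .y, .h => 1
  | .y, .x, .h => -1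
  | .h, .x, .x => 2
  | .x, .h, .x => -2
  | .h, .y, .y => -2
  | .y, .h, .y => 2
  | _, _, _ => 0

/-- Indices of creation operators. `(Sum.inl i, k)` belongs to the basis vector `i` of `𝔰𝔩₂`,
`(Sum.inr i, k)` to the dual basis vector `i'` of `𝔰𝔩₂*`; `k` counts derivatives. -/
abbrev Var : Type := (Root ⊕ Root) × ℕ

/-- The Fock space `𝒮(𝔰𝔩₂)` of the `βγ` system. The variable `(inl i, k)` is
`β^i(-k-1)1 = ∂^k β^i / k!`, the variable `(inr i, k)` is `γ^{i'}(-k-1)1 = ∂^k γ^{i'} / k!`. -/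
abbrev Bos : Type := MvPolynomial Var ℂ

/-- The Fock space `ℰ(𝔰𝔩₂)` of the `bc` system. The variable `(inl i, k)` is
`b^i(-k-1)1 = ∂^k b^i / k!`, the variable `(inr i, k)` is `c^{i'}(-k-1)1 = ∂^k c^{i'} / k!`. -/
abbrev Fer : Type := ExteriorAlgebra ℂ (Var →₀ ℂ)

/-- The semi-infinite Weil algebra `𝒲 = 𝒮(𝔰𝔩₂) ⊗ ℰ(𝔰𝔩₂)`. A vertex operator `a(z)` of the vertex
algebra is identified with the vector `a(-1)1` of this space; the vacuum is `1 ⊗ 1`. -/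
def Weil : Type := Bos ⊗[ℂ] Fer

/-- The product of polynomials in the even and odd variables. (It is only used to write down
monomials.) -/
instance : Ring Weil := inferInstanceAs (Ring (Bos ⊗[ℂ] Fer))

instance : Algebra ℂ Weil := inferInstanceAs (Algebra ℂ (Bos ⊗[ℂ] Fer))

/-- The identity map. -/
def toWeil : Bos ⊗[ℂ] Fer ≃ₗ[ℂ] Weil := LinearEquiv.refl ℂ (Bos ⊗[ℂ] Fer)

/-- The even variables. -/
def bosVar (v : Var) : Weil := toWeil (MvPolynomial.X v ⊗ₜ[ℂ] 1)

/-- The odd variables. -/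
def ferVar (v : Var) : Weil := toWeil (1 ⊗ₜ[ℂ] ExteriorAlgebra.ι ℂ (Finsupp.single v (1 : ℂ)))

/-- The parity operator: `1` on even vectors and `-1` on odd vectors. -/
def parity : Module.End ℂ Weil :=
  toWeil.conj (TensorProduct.map LinearMap.id
    (CliffordAlgebra.involute (Q := (0 : QuadraticForm ℂ (Var →₀ ℂ)))).toLinearMap)

/-- Partial derivative with respect to an even variable. -/
def bosAnnih (v : Var) : Module.End ℂ Weil :=
  toWeil.conj (TensorProduct.map
    (MvPolynomial.pderiv v : Derivation ℂ Bos Bos).toLinearMap LinearMap.id)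

/-- (Left) partial derivative with respect to an odd variable. -/
def ferAnnih (v : Var) : Module.End ℂ Weil :=
  toWeil.conj (TensorProduct.map LinearMap.id
    (CliffordAlgebra.contractLeft (Q := (0 : QuadraticForm ℂ (Var →₀ ℂ)))
      (Finsupp.lapply v : (Var →₀ ℂ) →ₗ[ℂ] ℂ)))

/-! ## Fields on the Fock space -/

/-- `QO(𝒲)`: sequences `a(n)`, `n ∈ ℤ`, of operators (the Fourier modes of
`a(z) = ∑ a(n) z^{-n-1}`) such that each vector is killed by `a(n)` for `n ≫ 0`. -/
def QO : Submodule ℂ (ℤ → Module.End ℂ Weil) where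
  carrier := {a | ∀ v, ∃ N : ℤ, ∀ n, N ≤ n → a n v = 0}
  zero_mem' := fun _ => ⟨0, fun _ _ => rfl⟩
  add_mem' := by
    intro a b ha hb v
    obtain ⟨M, hM⟩ := ha v
    obtain ⟨N, hN⟩ := hb v
    refine ⟨max M N, fun n hn => ?_⟩
    simp [hM n (le_trans (le_max_left _ _) hn), hN n (le_trans (le_max_right _ _) hn)]
  smul_mem' := by
    intro c a ha v
    obtain ⟨M, hM⟩ := ha v
    exact ⟨M, fun n hn => by simp [hM n hn]⟩

/-- The vector `a(-1)1` that corresponds to the field `a(z)`. -/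
def st : QO →ₗ[ℂ] Weil where
  toFun a := a.1 (-1) 1
  map_add' _ _ := rfl
  map_smul' _ _ := rfl

/-- The identity field `1`. -/
def oneQO : QO :=
  ⟨fun n => if n = -1 then 1 else 0, fun _ => ⟨0, fun n hn => by
    have : n ≠ -1 := by omega
    simp [this]⟩⟩

/-- The derivative of a field: `(∂a)(n) = -n a(n-1)`. -/
def der (a : QO) : QO :=
  ⟨fun n => (-(n : ℂ)) • a.1 (n - 1), fun v => by
    obtain ⟨N, hN⟩ := a.2 v
    exact ⟨N + 1, fun n hn => by simp [hN (n - 1) (by omega)]⟩⟩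

/-- The even part of an operator. -/
def evenPart (f : Module.End ℂ Weil) : Module.End ℂ Weil :=
  (1 / 2 : ℂ) • (f + parity * f * parity)

/-- The odd part of an operator. -/
def oddPart (f : Module.End ℂ Weil) : Module.End ℂ Weil :=
  (1 / 2 : ℂ) • (f - parity * f * parity)

/-- The bilinear extension of `(-1)^{|f||g|} g f` from homogeneous operators `f`, `g`. -/
def superSwap (f g : Module.End ℂ Weil) : Module.End ℂ Weil :=
  g * evenPart f + parity * g * parity * oddPart f

/-- The `j`-th term of the `m`-th mode of the Wick product
`:a(z)b(z): = a(z)₋ b(z) + (-1)^{|a||b|} b(z) a(z)₊`. -/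
def wickTerm (a b : QO) (m : ℤ) (j : ℕ) : Module.End ℂ Weil :=
  a.1 (-1 - j) * b.1 (m + j) + superSwap (a.1 j) (b.1 (m - 1 - j))

lemma superSwap_apply_eq_zero (f g : Module.End ℂ Weil) (v : Weil)
    (h₁ : g (f v) = 0) (h₂ : g (parity (f (parity v))) = 0)
    (h₃ : g (parity (f v)) = 0) (h₄ : g (parity (parity (f (parity v)))) = 0) :
    superSwap f g v = 0 := by
  simp [superSwap, evenPart, oddPart, Module.End.mul_apply, h₁, h₂, h₃, h₄]

lemma exists_wickTerm_bound (a b : QO) (v : Weil) :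
    ∃ J : ℕ, ∃ N : ℤ, (∀ (m : ℤ) (j : ℕ), N ≤ m → wickTerm a b m j v = 0) ∧
      (∀ (m : ℤ) (j : ℕ), J ≤ j → N ≤ m + j → wickTerm a b m j v = 0) := by
  obtain ⟨Nb, hNb⟩ := b.2 v
  obtain ⟨N₁, hN₁⟩ := a.2 v
  obtain ⟨N₂, hN₂⟩ := a.2 (parity v)
  choose B hB using b.2
  set J : ℕ := (max N₁ N₂).toNat with hJ
  let T : ℕ → ℤ := fun j =>
    max (max (B (a.1 j v)) (B (parity (a.1 j (parity v)))))
      (max (B (parity (a.1 j v))) (B (parity (parity (a.1 j (parity v)))))) + 1 + j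
  have key : ∀ j : ℕ, J ≤ j → ∀ m : ℤ, superSwap (a.1 j) (b.1 m) v = 0 := by
    intro j hj m
    have e₁ : a.1 j v = 0 := hN₁ _ (by omega)
    have e₂ : a.1 j (parity v) = 0 := hN₂ _ (by omega)
    apply superSwap_apply_eq_zero <;> simp [e₁, e₂]
  obtain ⟨M, hM⟩ : ∃ M : ℤ, ∀ j < J, T j ≤ M := by
    obtain ⟨M, hM⟩ := ((Finset.range J).image T).bddAbove
    exact ⟨M, fun j hj => hM (by simpa using ⟨j, hj, rfl⟩)⟩
  refine ⟨J, max Nb M, fun m j hm => ?_, fun m j hj hm => ?_⟩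
  · have e₀ : b.1 (m + j) v = 0 := hNb _ (by omega)
    have e₁ : superSwap (a.1 j) (b.1 (m - 1 - j)) v = 0 := by
      rcases le_or_gt J j with h | h
      · exact key j h _
      · have hT := hM j h
        simp only [T] at hT
        apply superSwap_apply_eq_zero <;> exact hB _ _ (by omega)
    simp [wickTerm, Module.End.mul_apply, e₀, e₁]
  · have e₀ : b.1 (m + j) v = 0 := hNb _ (by omega)
    simp [wickTerm, Module.End.mul_apply, e₀, key j hj]

lemma wickTerm_support_finite (a b : QO) (m : ℤ) (v : Weil) :
    (Function.support fun j : ℕ => wickTerm a b m j v).Finite := by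
  obtain ⟨J, N, -, h⟩ := exists_wickTerm_bound a b v
  refine (Set.finite_lt_nat (max J (N - m).toNat)).subset fun j hj => ?_
  by_contra hlt
  simp only [Set.mem_ofPred_eq, not_lt] at hlt
  exact hj (h m j (by omega) (by omega))

/-- The Wick product `:ab:` of two fields. All sums are finite on each vector. -/
def wick (a b : QO) : QO :=
  ⟨fun m =>
    { toFun := fun v => ∑ᶠ j : ℕ, wickTerm a b m j v
      map_add' := fun v w => by
        simp only [map_add]
        exact finsum_add_distrib (wickTerm_support_finite a b m v)
          (wickTerm_support_finite a b m w)
      map_smul' := fun c v => by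
        simp only [map_smul, RingHom.id_apply]
        exact (smul_finsum' c (wickTerm_support_finite a b m v)).symm },
    fun v => by
      obtain ⟨J, N, h, -⟩ := exists_wickTerm_bound a b v
      refine ⟨N, fun m hm => ?_⟩
      change ∑ᶠ j : ℕ, wickTerm a b m j v = 0
      simp [h m _ hm]⟩

/-- Iterated Wick product `:a₁ a₂ ⋯ a_r u: = :a₁(:a₂(⋯ :a_r u:):):`. -/
def nop (l : List QO) (u : QO) : QO := l.foldr wick u

/-! ## The generators -/

lemma bosAnnih_eventually (s : Root ⊕ Root) (v : Weil) :
    ∃ N : ℕ, ∀ k, N ≤ k → bosAnnih (s, k) v = 0 := by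
  obtain ⟨t, rfl⟩ := toWeil.surjective v
  induction t using TensorProduct.induction_on with
  | zero => exact ⟨0, fun _ _ => by simp⟩
  | tmul p q =>
    obtain ⟨N, hN⟩ := (p.vars.image Prod.snd).bddAbove
    refine ⟨N + 1, fun k hk => ?_⟩
    have : (s, k) ∉ p.vars := fun hmem => by
      have : k ≤ N := hN (by
        rw [Finset.coe_image]
        exact ⟨(s, k), hmem, rfl⟩)
      omega
    simp [bosAnnih, LinearEquiv.conj_apply, MvPolynomial.pderiv_eq_zero_of_notMem_vars this]
  | add p q hp hq =>
    obtain ⟨M, hM⟩ := hp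
    obtain ⟨N, hN⟩ := hq
    exact ⟨max M N, fun k hk => by
      rw [map_add, map_add, hM k (by omega), hN k (by omega), add_zero]⟩

lemma contract_eventually (s : Root ⊕ Root) (q : Fer) :
    ∃ N : ℕ, ∀ k, N ≤ k →
      CliffordAlgebra.contractLeft (Q := (0 : QuadraticForm ℂ (Var →₀ ℂ)))
        (Finsupp.lapply (s, k) : (Var →₀ ℂ) →ₗ[ℂ] ℂ) q = 0 := by
  induction q using CliffordAlgebra.left_induction with
  | algebraMap r => exact ⟨0, fun k _ => CliffordAlgebra.contractLeft_algebraMap _ _ _⟩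
  | add p q hp hq =>
    obtain ⟨M, hM⟩ := hp
    obtain ⟨N, hN⟩ := hq
    exact ⟨max M N, fun k hk => by
      rw [map_add, hM k (by omega), hN k (by omega), add_zero]⟩
  | ι_mul q m hq =>
    obtain ⟨M, hM⟩ := hq
    obtain ⟨N, hN⟩ := (m.support.image Prod.snd).bddAbove
    refine ⟨max M (N + 1), fun k hk => ?_⟩
    have : m (s, k) = 0 := by
      by_contra hne
      have : k ≤ N := hN (by
        rw [Finset.coe_image]
        exact ⟨(s, k), by simpa using hne, rfl⟩)
      omega
    rw [CliffordAlgebra.contractLeft_ι_mul, hM k (by omega)]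
    simp [this]

lemma ferAnnih_eventually (s : Root ⊕ Root) (v : Weil) :
    ∃ N : ℕ, ∀ k, N ≤ k → ferAnnih (s, k) v = 0 := by
  obtain ⟨t, rfl⟩ := toWeil.surjective v
  induction t using TensorProduct.induction_on with
  | zero => exact ⟨0, fun _ _ => by simp⟩
  | tmul p q =>
    obtain ⟨N, hN⟩ := contract_eventually s q
    exact ⟨N, fun k hk => by simp [ferAnnih, LinearEquiv.conj_apply, hN k hk]⟩
  | add p q hp hq =>
    obtain ⟨M, hM⟩ := hp
    obtain ⟨N, hN⟩ := hq
    exact ⟨max M N, fun k hk => by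
      rw [map_add, map_add, hM k (by omega), hN k (by omega), add_zero]⟩

/-- The field with modes `a(-k-1) = cr k` and `a(k) = an k` for `k ≥ 0`. -/
def freeField (cr an : ℕ → Module.End ℂ Weil)
    (h : ∀ v, ∃ N : ℕ, ∀ k, N ≤ k → an k v = 0) : QO :=
  ⟨fun n => match n with
    | Int.ofNat k => an k
    | Int.negSucc k => cr k,
   fun v => by
    obtain ⟨N, hN⟩ := h v
    refine ⟨N, fun n hn => ?_⟩
    cases n with
    | ofNat k => exact hN k (by simpa using hn)
    | negSucc k => exact absurd hn (by have := Int.negSucc_lt_zero k; omega)⟩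

/-- `β^i(z)`; the modes satisfy `[β^i(m), γ^{j'}(n)] = δ_{ij} δ_{m+n,-1}`. -/
def β (i : Root) : QO :=
  freeField (fun k => LinearMap.mulLeft ℂ (bosVar (.inl i, k))) (fun k => bosAnnih (.inr i, k))
    (bosAnnih_eventually _)

/-- `γ^{i'}(z)`. -/
def γ (i : Root) : QO :=
  freeField (fun k => LinearMap.mulLeft ℂ (bosVar (.inr i, k)))
   (fun k => -bosAnnih (.inl i, k)) (fun v => by
    obtain ⟨N, hN⟩ := bosAnnih_eventually (.inl i) v
    exact ⟨N, fun k hk => by rw [LinearMap.neg_apply, hN k hk, neg_zero]⟩)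

/-- `b^i(z)`; the modes satisfy `b^i(m) c^{j'}(n) + c^{j'}(n) b^i(m) = δ_{ij} δ_{m+n,-1}`. -/
def b (i : Root) : QO :=
  freeField (fun k => LinearMap.mulLeft ℂ (ferVar (.inl i, k))) (fun k => ferAnnih (.inr i, k))
    (ferAnnih_eventually _)

/-- `c^{i'}(z)`. -/
def c (i : Root) : QO :=
  freeField (fun k => LinearMap.mulLeft ℂ (ferVar (.inr i, k))) (fun k => ferAnnih (.inl i, k))
    (ferAnnih_eventually _)

/-! ## The distinguished vertex operators -/

/-- `Θ^i_𝒲 = ∑_j :b^{[i,j]} c^{j'}: - ∑_j :β^{[i,j]} γ^{j'}:`. -/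
def Θ (i : Root) : QO :=
  ∑ j : Root, ∑ k : Root, bracket i j k • (wick (b k) (c j) - wick (β k) (γ j))

/-- `K = ∑_i :γ^{i'} b^i:`. -/
def K : QO := ∑ i : Root, wick (γ i) (b i)

/-- `F = -∑_i :b^i c^{i'}:`; the `b`-number is the eigenvalue of `-F(0)`. -/
def F : QO := -∑ i : Root, wick (b i) (c i)

/-- `v^h = :β^h γ^{h'}: + :β^x γ^{x'}: + :β^y γ^{y'}:`. -/
def vh : QO := wick (β .h) (γ .h) + wick (β .x) (γ .x) + wick (β .y) (γ .y)

/-- `v^x = (:γ^{h'} γ^{h'}: + :γ^{x'} γ^{y'}:) / 2`. -/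
def vx : QO := (1 / 2 : ℂ) • (wick (γ .h) (γ .h) + wick (γ .x) (γ .y))

/-- `v^y = -(:β^h β^h: + 4 :β^x β^y:) / 2`. -/
def vy : QO := (-1 / 2 : ℂ) • (wick (β .h) (β .h) + (4 : ℂ) • wick (β .x) (β .y))

/-- `C^{γbb} = -:γ^{h'} b^x b^y: + :γ^{x'} b^x b^h: / 2 - :γ^{y'} b^y b^h: / 2`. -/
def Cγbb : QO :=
  -nop [γ .h, b .x] (b .y) + (1 / 2 : ℂ) • nop [γ .x, b .x] (b .h)
    - (1 / 2 : ℂ) • nop [γ .y, b .y] (b .h)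

/-- `C^{βbb} = :β^h b^x b^y: + :β^x b^y b^h: - :β^y b^x b^h:`. -/
def Cβbb : QO :=
  nop [β .h, b .x] (b .y) + nop [β .x, b .y] (b .h) - nop [β .y, b .x] (b .h)

/-- The normally ordered monomial `:(v^x)^r (v^y)^s (v^h)^t:`. -/
def vMono (r s t : ℕ) : QO :=
  nop (List.replicate r vx ++ List.replicate s vy ++ List.replicate t vh) oneQO

/-- Normally ordered polynomials in `v^x, v^y, v^h`, homogeneous of degree `n` in these three
letters. -/
def vPoly (n : ℕ) : Submodule ℂ QO :=
  Submodule.span ℂ {a | ∃ r s t : ℕ, r + s + t = n ∧ a = vMono r s t}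

/-- The explicit vertex operator `h_{2n+2}`, for `n ≥ 1`. (For `n = 1` the third term has
coefficient `0`.) -/
def hField (n : ℕ) : QO :=
  nop (List.replicate n vy) Cγbb
    - ((n : ℂ) / (2 * n + 2)) • nop (List.replicate (n - 1) vy ++ [vh]) Cβbb
    - (((n : ℂ) ^ 2 - n) / (2 * n ^ 2 + 3 * n + 1)) •
        nop (der vy :: List.replicate (n - 2) vy) Cβbb
    - ((2 * (n : ℂ) ^ 2 + 3 * n) / (4 * n ^ 2 + 6 * n + 2)) •
        nop (List.replicate (n - 1) vy) (der Cβbb)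

/-! ## Gradings and filtration -/

/-- A letter: an even variable (`Sum.inl`) or an odd variable (`Sum.inr`). -/
abbrev Letter : Type := Var ⊕ Var

/-- The vector given by a letter. -/
def letterVec : Letter → Weil
  | .inl v => bosVar v
  | .inr v => ferVar v

/-- The monomial given by a word. It is, up to a nonzero scalar, the vector of the iterated Wick
product of the corresponding derivatives of the generators. -/
def mono (l : List Letter) : Weil := (l.map letterVec).prod

/-- Cohomological degree: `-2, 2, -1, 1` for `β, γ, b, c` and their derivatives. -/
def letterDeg : Letter → ℤ
  | .inl (.inl _, _) => -2
  | .inl (.inr _, _) => 2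
  | .inr (.inl _, _) => -1
  | .inr (.inr _, _) => 1

/-- Conformal weight: `1, 0, 1, 0` for `β, γ, b, c`; each derivative adds `1`. -/
def letterWt : Letter → ℕ
  | .inl (.inl _, k) => k + 1
  | .inl (.inr _, k) => k
  | .inr (.inl _, k) => k + 1
  | .inr (.inr _, k) => k

/-- The subspace `𝒲^p` of cohomological degree `p`. -/
def degSub (p : ℤ) : Submodule ℂ Weil :=
  Submodule.span ℂ {w | ∃ l : List Letter, (l.map letterDeg).sum = p ∧ w = mono l}

/-- The subspace `𝒲[m]` of conformal weight `m`. -/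
def wtSub (m : ℕ) : Submodule ℂ Weil :=
  Submodule.span ℂ {w | ∃ l : List Letter, (l.map letterWt).sum = m ∧ w = mono l}

/-- The subspace `𝒲_(k)`, spanned by the monomials of length at most `k`. -/
def filt (k : ℕ) : Submodule ℂ Weil :=
  Submodule.span ℂ {w | ∃ l : List Letter, l.length ≤ k ∧ w = mono l}

/-- `w` has polynomial degree `k`: it lies in `𝒲_(k)` but in no earlier step. -/
def HasPolyDegree (w : Weil) (k : ℕ) : Prop := w ∈ filt k ∧ ∀ j < k, w ∉ filt j

/-! ## The basic complex -/

/-- The basic subspace: vectors killed by all `b^i(k)` (horizontal) and all `Θ^i(k)`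
(`𝔰𝔩₂[t]`-invariant), `k ≥ 0`. -/
def Wbas : Submodule ℂ Weil :=
  ⨅ (i : Root) (k : ℕ), LinearMap.ker ((b i).1 k) ⊓ LinearMap.ker ((Θ i).1 k)

/-- The subspace of `Wbas` of `b`-number `k`. -/
def WbasNum (k : ℕ) : Submodule ℂ Weil := Wbas ⊓ Module.End.eigenspace (-(F.1 0)) (k : ℂ)

/-- The subspace of `Wbas` of cohomological degree `p`. -/
def WbasDeg (p : ℤ) : Submodule ℂ Weil := Wbas ⊓ degSub p

/-- The chiral Koszul differential `K(0)`, of degree `1`. -/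
def K0 : Module.End ℂ Weil := K.1 0

/-- The `K(0)`-closed elements of degree `p` of `Wbas`. -/
def cocycles (p : ℤ) : Submodule ℂ Weil := WbasDeg p ⊓ LinearMap.ker K0

/-- The image of `K(0)` in degree `p`. -/
def coboundaries (p : ℤ) : Submodule ℂ Weil := (WbasDeg (p - 1)).map K0

/-- The cohomology `H^p(Wbas, K(0))`. -/
abbrev Hcoh (p : ℤ) : Type := cocycles p ⧸ (coboundaries p).submoduleOf (cocycles p)

/-- The class of a cocycle in `H^p(Wbas, K(0))`. -/
def cohClass (p : ℤ) : cocycles p →ₗ[ℂ] Hcoh p :=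
  ((coboundaries p).submoduleOf (cocycles p)).mkQ

end ChiralSL2

end

open scoped TensorProduct

noncomputable section

namespace ChiralSL2

open MvPolynomial (pderiv)

/-! The argument works with leading terms for the length filtration. To top order `v^x, v^y, v^h`
act by multiplication with quadratic polynomials `Vx, Vy, Vh`, and a polynomial `p` times `C^{γbb}`
or `C^{βbb}` is `mulCγ p` or `mulCβ p`. The zero mode of `v^x` acts on polynomials without
derivatives of `β` as the derivation `D = lowerDer`, which replaces `β` by `γ`; it sends `Vy` to
`Vh`, `Vh` to `-2 Vx`, `Vx` to `0`, and `C^{βbb}` to `C^{γbb}`, which it kills. On such vectors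
`K(0)` is a divergence in the variables `β`: up to the same sign, `mulCγ p` goes to `D p` and `mulCβ
p` to `(3 + E) p` times `b^x b^y b^h`, where `E` is the Euler operator in `β`. For `p = Vy^m Vh^d`
the polynomial `D p` has `β`-degree `2m + d - 1`; this explains the coefficient `1/(2m+d+2)` in
`leadTerm m d`.

Existence. For `d = 0` the vector is explicit. It is basic because the modes of `v^x` and `v^y`
commute with all `b^i(k)` and `Θ^i(k)`, because `v^h(-1)` is the commutator of `v^x(0)` and
`v^y(-1)`, and because `C^{γbb}`, `C^{βbb}` and `∂C^{βbb}` are basic. It is closed because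
`st_hField_eq` writes it as a classical leading term plus a multiple of one correction, and
`K0_classical` and `K0_quantum` show that both are closed. For larger `d` one applies `v^x(0)`,
which commutes with `K(0)` and preserves the basic subspace. Up to nonzero factors it takes
`leadTerm (m+1) (d+1)` to `leadTerm m (d+2)` minus `Vx` times `leadTerm (m+1) d`, and the second
piece is removed by adding a multiple of `v^x(-1)` of an earlier cocycle (`LiftsLead.vx_zero_add`,
`exists_liftsLead`).

Nontriviality. The functional `detect` extracts two coefficients of `b`-number two with annihilation
modes and restricts their difference to the Cartan locus, where only `β^h` and `γ^{h'}` survive.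
Moving `K(0)` to the left and using `Θ^h(1)`, `Θ^x(0)`, `Θ^y(0)` and `b^i(0)` on a basic vector
shows that it kills all coboundaries (`detect_K0`). On `leadTerm m d` its value is `Vy^m Vh^d` on
the locus, a nonzero multiple of `s^{2m+d} t^d`, where `s` and `t` are the two coordinates. Since
`detect` lowers length by three, the lower terms cannot reach this monomial. So the class is
nonzero, and the same monomial gives the exact polynomial degree. -/

/-! ## Elementary operators on the Fock space -/

/-- The product of an even polynomial and an odd polynomial. -/
def tm (p : Bos) (q : Fer) : Weil := toWeil (p ⊗ₜ[ℂ] q)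

lemma weil_induction {P : Weil → Prop} (h₀ : P 0) (h₁ : ∀ p q, P (tm p q))
    (h₂ : ∀ v w, P v → P w → P (v + w)) (v : Weil) : P v := by
  obtain ⟨t, rfl⟩ := toWeil.surjective v
  induction t using TensorProduct.induction_on with
  | zero => simpa using h₀
  | tmul p q => exact h₁ p q
  | add p q hp hq => rw [map_add]; exact h₂ _ _ hp hq

lemma one_eq_tm : (1 : Weil) = tm 1 1 := rfl

lemma tm_mul_tm (p p' : Bos) (q q' : Fer) : tm p q * tm p' q' = tm (p * p') (q * q') :=
  Algebra.TensorProduct.tmul_mul_tmul p p' q q'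

lemma tm_add_left (p p' : Bos) (q : Fer) : tm (p + p') q = tm p q + tm p' q :=
  TensorProduct.add_tmul p p' q

lemma tm_add_right (p : Bos) (q q' : Fer) : tm p (q + q') = tm p q + tm p q' :=
  TensorProduct.tmul_add p q q'

lemma tm_smul_left (r : ℂ) (p : Bos) (q : Fer) : tm (r • p) q = r • tm p q := rfl

lemma tm_smul_right (r : ℂ) (p : Bos) (q : Fer) : tm p (r • q) = r • tm p q :=
  TensorProduct.tmul_smul r p q

lemma tm_neg_left (p : Bos) (q : Fer) : tm (-p) q = -tm p q :=
  TensorProduct.neg_tmul p q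

lemma tm_neg_right (p : Bos) (q : Fer) : tm p (-q) = -tm p q :=
  TensorProduct.tmul_neg p q

lemma tm_sub_left (p p' : Bos) (q : Fer) : tm (p - p') q = tm p q - tm p' q :=
  TensorProduct.sub_tmul p p' q

lemma tm_sub_right (p : Bos) (q q' : Fer) : tm p (q - q') = tm p q - tm p q' :=
  TensorProduct.tmul_sub p q q'

@[simp] lemma tm_zero_left (q : Fer) : tm 0 q = 0 := TensorProduct.zero_tmul _ q

@[simp] lemma tm_zero_right (p : Bos) : tm p 0 = 0 := TensorProduct.tmul_zero _ p

/-- The contraction of an odd polynomial with a variable. -/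
abbrev contr (v : Var) : Fer →ₗ[ℂ] Fer :=
  CliffordAlgebra.contractLeft (Q := (0 : QuadraticForm ℂ (Var →₀ ℂ)))
    (Finsupp.lapply v : (Var →₀ ℂ) →ₗ[ℂ] ℂ)

/-- An odd variable as an element of the exterior algebra. -/
abbrev fgen (v : Var) : Fer := ExteriorAlgebra.ι ℂ (Finsupp.single v (1 : ℂ))

/-- The parity involution of the exterior algebra. -/
abbrev invol : Fer →ₐ[ℂ] Fer := CliffordAlgebra.involute (Q := (0 : QuadraticForm ℂ (Var →₀ ℂ)))

lemma bosVar_eq (v : Var) : bosVar v = tm (MvPolynomial.X v) 1 := rfl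

lemma ferVar_eq (v : Var) : ferVar v = tm 1 (fgen v) := rfl

lemma bosVar_mul_tm (v : Var) (p : Bos) (q : Fer) :
    bosVar v * tm p q = tm (MvPolynomial.X v * p) q := by
  rw [bosVar_eq, tm_mul_tm, one_mul]

lemma ferVar_mul_tm (v : Var) (p : Bos) (q : Fer) : ferVar v * tm p q = tm p (fgen v * q) := by
  rw [ferVar_eq, tm_mul_tm, one_mul]

lemma bosAnnih_tm (v : Var) (p : Bos) (q : Fer) :
    bosAnnih v (tm p q) = tm (MvPolynomial.pderiv v p) q := rfl

lemma ferAnnih_tm (v : Var) (p : Bos) (q : Fer) : ferAnnih v (tm p q) = tm p (contr v q) := rfl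

lemma parity_tm (p : Bos) (q : Fer) : parity (tm p q) = tm p (invol q) := rfl

lemma contr_fgen_mul (u v : Var) (q : Fer) :
    contr u (fgen v * q) = (if u = v then (1 : ℂ) else 0) • q - fgen v * contr u q := by
  have := CliffordAlgebra.contractLeft_ι_mul (Q := (0 : QuadraticForm ℂ (Var →₀ ℂ)))
    (d := (Finsupp.lapply u : (Var →₀ ℂ) →ₗ[ℂ] ℂ)) (Finsupp.single v (1 : ℂ)) q
  rw [show fgen v = CliffordAlgebra.ι (0 : QuadraticForm ℂ (Var →₀ ℂ))
    (Finsupp.single v (1 : ℂ)) from rfl, this]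
  simp [Finsupp.single_apply, eq_comm]

lemma contr_one (u : Var) : contr u 1 = 0 :=
  CliffordAlgebra.contractLeft_one (Q := (0 : QuadraticForm ℂ (Var →₀ ℂ))) _

lemma fgen_mul_fgen (u v : Var) : fgen u * fgen v = -(fgen v * fgen u) :=
  eq_neg_of_add_eq_zero_left (ExteriorAlgebra.ι_add_mul_swap _ _)

lemma fgen_mul_fgen_mul (u v : Var) (q : Fer) :
    fgen u * (fgen v * q) = -(fgen v * (fgen u * q)) := by
  rw [← mul_assoc, fgen_mul_fgen, neg_mul, mul_assoc]

lemma fgen_mul_self (u : Var) : fgen u * fgen u = 0 := ExteriorAlgebra.ι_sq_zero _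

lemma fgen_mul_self_mul (u : Var) (q : Fer) : fgen u * (fgen u * q) = 0 := by
  rw [← mul_assoc, fgen_mul_self, zero_mul]

lemma contr_contr (u v : Var) (q : Fer) : contr u (contr v q) = -contr v (contr u q) :=
  CliffordAlgebra.contractLeft_comm _ _ q

lemma invol_fgen_mul (u : Var) (q : Fer) : invol (fgen u * q) = -(fgen u * invol q) := by
  rw [map_mul, show invol (fgen u) = -fgen u from CliffordAlgebra.involute_ι _, neg_mul]

lemma invol_contr (u : Var) (q : Fer) : invol (contr u q) = -contr u (invol q) := by
  induction q using CliffordAlgebra.left_induction with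
  | algebraMap r => simp [CliffordAlgebra.contractLeft_algebraMap]
  | add p q hp hq => rw [map_add, map_add, hp, hq, map_add, map_add, neg_add]
  | ι_mul q m hq =>
    rw [CliffordAlgebra.contractLeft_ι_mul, map_sub, map_smul, map_mul, map_mul, hq,
      CliffordAlgebra.involute_ι, neg_mul, neg_mul, (contr u).map_neg,
      CliffordAlgebra.contractLeft_ι_mul]
    simp

lemma parity_parity (w : Weil) : parity (parity w) = w := by
  induction w using weil_induction with
  | h₀ => simp
  | h₁ p q => simp [parity_tm]
  | h₂ v w hv hw => rw [map_add, map_add, hv, hw]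

lemma parity_one : parity 1 = 1 := by
  rw [one_eq_tm, parity_tm, map_one]

/-! ## Modes of the generators -/

/-- The even generators, `β^i` for `inl i` and `γ^{i'}` for `inr i`. -/
def bosGen : Root ⊕ Root → QO
  | .inl i => β i
  | .inr i => γ i

/-- The odd generators, `b^i` for `inl i` and `c^{i'}` for `inr i`. -/
def ferGen : Root ⊕ Root → QO
  | .inl i => b i
  | .inr i => c i

/-- The coefficient of the pole in the OPE of two even generators. -/
def bosPair : Root ⊕ Root → Root ⊕ Root → ℂ
  | .inl i, .inr j => if i = j then 1 else 0
  | .inr i, .inl j => if i = j then -1 else 0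
  | _, _ => 0

/-- The coefficient of the pole in the OPE of two odd generators. -/
def ferPair : Root ⊕ Root → Root ⊕ Root → ℂ
  | .inl i, .inr j => if i = j then 1 else 0
  | .inr i, .inl j => if i = j then 1 else 0
  | _, _ => 0

/-- The sign in the annihilation modes of the even generators. -/
def bosSign : Root ⊕ Root → ℂ
  | .inl _ => 1
  | .inr _ => -1

lemma bosGen_negSucc (s : Root ⊕ Root) (k : ℕ) :
    (bosGen s).1 (Int.negSucc k) = LinearMap.mulLeft ℂ (bosVar (s, k)) := by
  cases s <;> rfl

lemma bosGen_ofNat (s : Root ⊕ Root) (k : ℕ) :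
    (bosGen s).1 (k : ℤ) = bosSign s • bosAnnih (s.swap, k) := by
  cases s
  · exact (one_smul ℂ _).symm
  · exact (neg_one_smul ℂ (bosAnnih (_, k))).symm

lemma ferGen_negSucc (s : Root ⊕ Root) (k : ℕ) :
    (ferGen s).1 (Int.negSucc k) = LinearMap.mulLeft ℂ (ferVar (s, k)) := by
  cases s <;> rfl

lemma ferGen_ofNat (s : Root ⊕ Root) (k : ℕ) :
    (ferGen s).1 (k : ℤ) = ferAnnih (s.swap, k) := by
  cases s <;> rfl

lemma bosAnnih_bosVar_mul (u v : Var) (w : Weil) :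
    bosAnnih u (bosVar v * w) = bosVar v * bosAnnih u w + (if u = v then (1 : ℂ) else 0) • w := by
  induction w using weil_induction with
  | h₀ => simp
  | h₁ p q =>
    rw [bosVar_mul_tm, bosAnnih_tm, bosAnnih_tm, bosVar_mul_tm, Derivation.leibniz,
      MvPolynomial.pderiv_X, tm_add_left, smul_eq_mul, smul_eq_mul]
    congr 1
    by_cases h : u = v
    · subst h; simp
    · simp [h]
  | h₂ v w hv hw => simp only [mul_add, map_add, hv, hw, smul_add]; abel

lemma bosAnnih_ferVar_mul (u v : Var) (w : Weil) :
    bosAnnih u (ferVar v * w) = ferVar v * bosAnnih u w := by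
  induction w using weil_induction with
  | h₀ => simp
  | h₁ p q => simp only [ferVar_mul_tm, bosAnnih_tm]
  | h₂ v w hv hw => simp only [mul_add, map_add, hv, hw]

lemma ferAnnih_bosVar_mul (u v : Var) (w : Weil) :
    ferAnnih u (bosVar v * w) = bosVar v * ferAnnih u w := by
  induction w using weil_induction with
  | h₀ => simp
  | h₁ p q => simp only [bosVar_mul_tm, ferAnnih_tm]
  | h₂ v w hv hw => simp only [mul_add, map_add, hv, hw]

lemma ferAnnih_ferVar_mul (u v : Var) (w : Weil) :
    ferAnnih u (ferVar v * w) = -(ferVar v * ferAnnih u w) + (if u = v then (1 : ℂ) else 0) • w := by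
  induction w using weil_induction with
  | h₀ => simp
  | h₁ p q =>
    simp only [ferVar_mul_tm, ferAnnih_tm]
    rw [contr_fgen_mul, tm_sub_right, tm_smul_right, neg_add_eq_sub]
  | h₂ v w hv hw => simp only [mul_add, map_add, hv, hw, smul_add]; abel

/-- The commutator of two derivations is a derivation, and this one kills every variable. -/
lemma pderiv_pderiv_comm (u v : Var) (p : Bos) :
    MvPolynomial.pderiv u (MvPolynomial.pderiv v p)
      = MvPolynomial.pderiv v (MvPolynomial.pderiv u p) := by
  have h : ⁅(MvPolynomial.pderiv u : Derivation ℂ Bos Bos),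
      (MvPolynomial.pderiv v : Derivation ℂ Bos Bos)⁆ = 0 := by
    refine MvPolynomial.derivation_ext fun i => ?_
    simp [Derivation.commutator_apply, MvPolynomial.pderiv_X, Pi.single_apply, apply_ite]
  have := congrArg (fun d => d p) h
  simpa [Derivation.commutator_apply, sub_eq_zero] using this

lemma bosAnnih_comm (u v : Var) (w : Weil) :
    bosAnnih u (bosAnnih v w) = bosAnnih v (bosAnnih u w) := by
  induction w using weil_induction with
  | h₀ => simp
  | h₁ p q => simp only [bosAnnih_tm, pderiv_pderiv_comm u v]
  | h₂ v w hv hw => simp only [map_add, hv, hw]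

lemma bosAnnih_ferAnnih (u v : Var) (w : Weil) :
    bosAnnih u (ferAnnih v w) = ferAnnih v (bosAnnih u w) := by
  induction w using weil_induction with
  | h₀ => simp
  | h₁ p q => simp only [bosAnnih_tm, ferAnnih_tm]
  | h₂ v w hv hw => simp only [map_add, hv, hw]

lemma ferAnnih_anticomm (u v : Var) (w : Weil) :
    ferAnnih u (ferAnnih v w) = -ferAnnih v (ferAnnih u w) := by
  induction w using weil_induction with
  | h₀ => simp
  | h₁ p q => simp only [ferAnnih_tm, contr_contr u v, tm_neg_right]
  | h₂ v w hv hw => simp only [map_add, hv, hw]; abel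

lemma bosVar_mul_comm (v : Var) (w : Weil) : bosVar v * w = w * bosVar v := by
  induction w using weil_induction with
  | h₀ => simp
  | h₁ p q => rw [bosVar_eq, tm_mul_tm, tm_mul_tm, mul_comm, one_mul, mul_one]
  | h₂ v w hv hw => simp only [mul_add, add_mul, hv, hw]

lemma bosVar_left_comm (v : Var) (u w : Weil) : bosVar v * (u * w) = u * (bosVar v * w) := by
  rw [← mul_assoc, bosVar_mul_comm, mul_assoc]

lemma ferVar_mul_ferVar_mul (u v : Var) (w : Weil) :
    ferVar u * (ferVar v * w) = -(ferVar v * (ferVar u * w)) := by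
  induction w using weil_induction with
  | h₀ => simp
  | h₁ p q => simp only [ferVar_mul_tm, fgen_mul_fgen_mul u v, tm_neg_right]
  | h₂ v w hv hw => simp only [mul_add, hv, hw]; abel

lemma parity_bosVar_mul (v : Var) (w : Weil) : parity (bosVar v * w) = bosVar v * parity w := by
  induction w using weil_induction with
  | h₀ => simp
  | h₁ p q => simp only [bosVar_mul_tm, parity_tm]
  | h₂ v w hv hw => simp only [mul_add, map_add, hv, hw]

lemma parity_ferVar_mul (v : Var) (w : Weil) :
    parity (ferVar v * w) = -(ferVar v * parity w) := by
  induction w using weil_induction with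
  | h₀ => simp
  | h₁ p q => simp only [ferVar_mul_tm, parity_tm, invol_fgen_mul, tm_neg_right]
  | h₂ v w hv hw => simp only [mul_add, map_add, hv, hw]; abel

lemma parity_bosAnnih (v : Var) (w : Weil) : parity (bosAnnih v w) = bosAnnih v (parity w) := by
  induction w using weil_induction with
  | h₀ => simp
  | h₁ p q => simp only [bosAnnih_tm, parity_tm]
  | h₂ v w hv hw => simp only [map_add, hv, hw]

lemma parity_ferAnnih (v : Var) (w : Weil) : parity (ferAnnih v w) = -ferAnnih v (parity w) := by
  induction w using weil_induction with
  | h₀ => simp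
  | h₁ p q => simp only [ferAnnih_tm, parity_tm, invol_contr, tm_neg_right]
  | h₂ v w hv hw => simp only [map_add, hv, hw]; abel

lemma parity_bosGen (s : Root ⊕ Root) (m : ℤ) (w : Weil) :
    parity ((bosGen s).1 m w) = (bosGen s).1 m (parity w) := by
  cases m with
  | ofNat k => simp [bosGen_ofNat, parity_bosAnnih]
  | negSucc k => simp [bosGen_negSucc, parity_bosVar_mul]

lemma parity_ferGen (s : Root ⊕ Root) (m : ℤ) (w : Weil) :
    parity ((ferGen s).1 m w) = -(ferGen s).1 m (parity w) := by
  cases m with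
  | ofNat k => simp [ferGen_ofNat, parity_ferAnnih]
  | negSucc k => simp [ferGen_negSucc, parity_ferVar_mul]

/-- The canonical commutation relations: the scalar comes from the Leibniz rule for an annihilation
mode hitting its own variable. Together with `ferGen_anticomm` and `bosGen_ferGen` this is all that
is used about the generators when operator product expansions are computed. -/
lemma bosGen_comm (s t : Root ⊕ Root) (m n : ℤ) (w : Weil) :
    (bosGen s).1 m ((bosGen t).1 n w) = (bosGen t).1 n ((bosGen s).1 m w)
      + (if m + n = -1 then bosPair s t else 0) • w := by
  cases m with
  | ofNat k =>
    cases n with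
    | ofNat l =>
      have : ¬ ((k : ℤ) + l = -1) := by omega
      simp [bosGen_ofNat, this, bosAnnih_comm (s.swap, k), smul_smul, mul_comm]
    | negSucc l =>
      have : (k : ℤ) + Int.negSucc l = -1 ↔ k = l := by omega
      simp only [Int.ofNat_eq_natCast, bosGen_ofNat, bosGen_negSucc, LinearMap.smul_apply,
        LinearMap.mulLeft_apply, bosAnnih_bosVar_mul, smul_add, this, mul_smul_comm, smul_smul]
      congr 2
      rcases s with i | i <;> rcases t with j | j <;> by_cases h : k = l <;>
        simp [bosSign, bosPair, h]
  | negSucc k =>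
    cases n with
    | ofNat l =>
      have : Int.negSucc k + (l : ℤ) = -1 ↔ k = l := by omega
      simp only [Int.ofNat_eq_natCast, bosGen_ofNat, bosGen_negSucc, LinearMap.smul_apply,
        LinearMap.mulLeft_apply, bosAnnih_bosVar_mul, smul_add, this, mul_smul_comm, smul_smul,
        add_assoc, ← add_smul]
      rw [left_eq_add]
      convert zero_smul ℂ w
      rcases s with i | i <;> rcases t with j | j <;> by_cases h : k = l <;>
        simp [bosSign, bosPair, h, eq_comm] <;> split_ifs <;> simp
    | negSucc l =>
      have : ¬ (Int.negSucc k + Int.negSucc l = -1) := by omega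
      simp [bosGen_negSucc, this, bosVar_left_comm (s, k)]

lemma ferGen_anticomm (s t : Root ⊕ Root) (m n : ℤ) (w : Weil) :
    (ferGen s).1 m ((ferGen t).1 n w) = -(ferGen t).1 n ((ferGen s).1 m w)
      + (if m + n = -1 then ferPair s t else 0) • w := by
  cases m with
  | ofNat k =>
    cases n with
    | ofNat l =>
      have : ¬ ((k : ℤ) + l = -1) := by omega
      simp [ferGen_ofNat, this, ferAnnih_anticomm (s.swap, k)]
    | negSucc l =>
      have : (k : ℤ) + Int.negSucc l = -1 ↔ k = l := by omega
      simp only [Int.ofNat_eq_natCast, ferGen_ofNat, ferGen_negSucc,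
        LinearMap.mulLeft_apply, ferAnnih_ferVar_mul, this]
      congr 2
      rcases s with i | i <;> rcases t with j | j <;> by_cases h : k = l <;>
        simp [ferPair, h]
  | negSucc k =>
    cases n with
    | ofNat l =>
      have : Int.negSucc k + (l : ℤ) = -1 ↔ k = l := by omega
      simp only [Int.ofNat_eq_natCast, ferGen_ofNat, ferGen_negSucc,
        LinearMap.mulLeft_apply, ferAnnih_ferVar_mul, this, neg_add, neg_neg, add_assoc]
      rw [left_eq_add, ← neg_smul, ← add_smul]
      convert zero_smul ℂ w
      rcases s with i | i <;> rcases t with j | j <;> by_cases h : k = l <;>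
        simp [ferPair, h, eq_comm]
    | negSucc l =>
      have : ¬ (Int.negSucc k + Int.negSucc l = -1) := by omega
      simp [ferGen_negSucc, this, ferVar_mul_ferVar_mul (s, k)]

lemma bosGen_ferGen (s t : Root ⊕ Root) (m n : ℤ) (w : Weil) :
    (bosGen s).1 m ((ferGen t).1 n w) = (ferGen t).1 n ((bosGen s).1 m w) := by
  cases m <;> cases n <;>
    simp [bosGen_ofNat, bosGen_negSucc, ferGen_ofNat, ferGen_negSucc, bosAnnih_ferAnnih,
      bosAnnih_ferVar_mul, ferAnnih_bosVar_mul, bosVar_left_comm]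

lemma bosAnnih_one (v : Var) : bosAnnih v 1 = 0 := by
  rw [one_eq_tm, bosAnnih_tm, Derivation.map_one_eq_zero, tm_zero_left]

lemma ferAnnih_one (v : Var) : ferAnnih v 1 = 0 := by
  rw [one_eq_tm, ferAnnih_tm, contr_one, tm_zero_right]

/-! ## Wick products -/

/-- A field whose modes commute with the parity operator. -/
def IsEven (a : QO) : Prop := ∀ m w, a.1 m (parity w) = parity (a.1 m w)

/-- A field whose modes anticommute with the parity operator. -/
def IsOdd (a : QO) : Prop := ∀ m w, a.1 m (parity w) = -parity (a.1 m w)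

/-- In the Wick product of `a` and `b`, the exchanged terms carry the sign `σ`. -/
def Swaps (a b : QO) (σ : ℂ) : Prop :=
  ∀ m n w, superSwap (a.1 m) (b.1 n) w = σ • b.1 n (a.1 m w)

lemma IsEven.swaps {a : QO} (ha : IsEven a) (b : QO) : Swaps a b 1 := by
  intro m n w
  simp only [superSwap, evenPart, oddPart, LinearMap.add_apply, Module.End.mul_apply,
    LinearMap.smul_apply, LinearMap.sub_apply, ha m, parity_parity, sub_self, smul_zero, map_zero,
    add_zero, map_smul, map_add]
  module

lemma IsOdd.swaps {a b : QO} (ha : IsOdd a) (hb : IsOdd b) : Swaps a b (-1) := by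
  intro m n w
  simp only [superSwap, evenPart, oddPart, LinearMap.add_apply, Module.End.mul_apply,
    LinearMap.smul_apply, LinearMap.sub_apply, ha m, hb n, parity_parity, map_smul, map_add,
    map_sub, map_neg]
  module

lemma isEven_bosGen (s : Root ⊕ Root) : IsEven (bosGen s) := fun m w =>
  (parity_bosGen s m w).symm

lemma isOdd_ferGen (s : Root ⊕ Root) : IsOdd (ferGen s) := fun m w => by
  rw [parity_ferGen, neg_neg]

lemma coe_add_apply (a b : QO) (m : ℤ) (w : Weil) : (a + b).1 m w = a.1 m w + b.1 m w := rfl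

lemma coe_sub_apply (a b : QO) (m : ℤ) (w : Weil) : (a - b).1 m w = a.1 m w - b.1 m w := rfl

lemma coe_neg_apply (a : QO) (m : ℤ) (w : Weil) : (-a).1 m w = -a.1 m w := rfl

lemma coe_smul_apply (r : ℂ) (a : QO) (m : ℤ) (w : Weil) : (r • a).1 m w = r • a.1 m w := rfl

lemma coe_sum_apply {ι : Type*} (s : Finset ι) (f : ι → QO) (m : ℤ) (w : Weil) :
    (∑ i ∈ s, f i).1 m w = ∑ i ∈ s, (f i).1 m w := by
  classical
  induction s using Finset.induction_on with
  | empty => rfl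
  | insert i s hi ih => rw [Finset.sum_insert hi, Finset.sum_insert hi, coe_add_apply, ih]

lemma IsEven.add {a b : QO} (ha : IsEven a) (hb : IsEven b) : IsEven (a + b) := fun m w => by
  rw [coe_add_apply, coe_add_apply, ha, hb, map_add]

lemma IsEven.smul {a : QO} (ha : IsEven a) (r : ℂ) : IsEven (r • a) := fun m w => by
  rw [coe_smul_apply, coe_smul_apply, ha, map_smul]

lemma wick_apply (a b : QO) (m : ℤ) (w : Weil) :
    (wick a b).1 m w = ∑ᶠ j : ℕ, wickTerm a b m j w := rfl

lemma Swaps.wickTerm_apply {a b : QO} {σ : ℂ} (h : Swaps a b σ) (m : ℤ) (j : ℕ) (w : Weil) :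
    wickTerm a b m j w = a.1 (-1 - j) (b.1 (m + j) w) + σ • b.1 (m - 1 - j) (a.1 j w) := by
  rw [wickTerm, LinearMap.add_apply, h]
  rfl

lemma wick_apply_eq_sum {a b : QO} {σ : ℂ} (h : Swaps a b σ) (m : ℤ) (w : Weil) (N : ℕ)
    (h₁ : ∀ j : ℕ, N ≤ j → a.1 (-1 - j) (b.1 (m + j) w) = 0)
    (h₂ : ∀ j : ℕ, N ≤ j → b.1 (m - 1 - j) (a.1 j w) = 0) :
    (wick a b).1 m w = ∑ j ∈ Finset.range N,
      (a.1 (-1 - j) (b.1 (m + j) w) + σ • b.1 (m - 1 - j) (a.1 j w)) := by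
  rw [wick_apply]
  simp only [h.wickTerm_apply]
  refine finsum_eq_sum_of_support_subset _ fun j hj => ?_
  by_contra hlt
  rw [Finset.mem_coe, Finset.mem_range, not_lt] at hlt
  exact hj (by simp [h₁ j hlt, h₂ j hlt])

/-- Exactly one of `u` and `-1 - u` is a natural number. This is how the two halves of a Wick
product combine to give each contraction exactly once. -/
lemma finsum_ite_int {V : Type*} [AddCommMonoid V] (u : ℤ) (x : V) :
    ∑ᶠ j : ℕ, ((if (j : ℤ) = u then x else 0) + (if (j : ℤ) = -1 - u then x else 0)) = x := by
  rcases le_or_gt 0 u with h | h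
  · rw [finsum_eq_single _ u.toNat]
    · have h₁ : ((u.toNat : ℕ) : ℤ) = u := by omega
      have h₂ : ¬ ((u.toNat : ℕ) : ℤ) = -1 - u := by omega
      rw [if_pos h₁, if_neg h₂, add_zero]
    · intro j hj
      have h₁ : ¬ (j : ℤ) = u := by omega
      have h₂ : ¬ (j : ℤ) = -1 - u := by omega
      rw [if_neg h₁, if_neg h₂, add_zero]
  · rw [finsum_eq_single _ (-1 - u).toNat]
    · have h₁ : ¬ (((-1 - u).toNat : ℕ) : ℤ) = u := by omega
      have h₂ : (((-1 - u).toNat : ℕ) : ℤ) = -1 - u := by omega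
      rw [if_neg h₁, if_pos h₂, zero_add]
    · intro j hj
      have h₁ : ¬ (j : ℤ) = u := by omega
      have h₂ : ¬ (j : ℤ) = -1 - u := by omega
      rw [if_neg h₁, if_neg h₂, add_zero]

lemma finite_support_ite_int {V : Type*} [AddCommMonoid V] (u : ℤ) (x : V) :
    (Function.support fun j : ℕ =>
      ((if (j : ℤ) = u then x else 0) + (if (j : ℤ) = -1 - u then x else 0))).Finite := by
  refine Set.Finite.subset (Set.toFinite {u.toNat, (-1 - u).toNat}) fun j hj => ?_
  by_contra h
  simp only [Set.mem_insert_iff, Set.mem_singleton_iff, not_or] at h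
  have h₁ : ¬ (j : ℤ) = u := by omega
  have h₂ : ¬ (j : ℤ) = -1 - u := by omega
  exact hj (by simp only [if_neg h₁, if_neg h₂, add_zero])

/-- Wick's theorem for the commutator of `:ab:` with an operator `T` whose (super)commutators with
the modes of `a` and `b` are scalars. -/
lemma wick_comm {a b : QO} {σ : ℂ} (h : Swaps a b σ) (T : Module.End ℂ Weil) (p : ℤ)
    {εa εb α α' : ℂ}
    (ha : ∀ n w, a.1 n (T w) = εa • T (a.1 n w) + (if n = p then α else 0) • w)
    (hb : ∀ n w, b.1 n (T w) = εb • T (b.1 n w) + (if n = p then α' else 0) • w)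
    (h₁ : σ * εa * α' = α') (h₂ : εb * α = σ * α) (k : ℤ) (w : Weil) :
    (wick a b).1 k (T w) = (εa * εb) • T ((wick a b).1 k w) + α' • a.1 (k - 1 - p) w
      + (σ * α) • b.1 (k - 1 - p) w := by
  -- Moving `T` through the two halves of the `j`-th term gives four delta contributions. A
  -- contraction with `b` sits at `j = p - k` in the first half and at `j = -1 - (p - k)` in the
  -- second; a contraction with `a` sits at `j = p` or `j = -1 - p`. The hypotheses `h₁` and `h₂`
  -- say that both places carry the same coefficient.
  have key : ∀ j : ℕ, wickTerm a b k j (T w) = (εa * εb) • T (wickTerm a b k j w)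
      + (((if (j : ℤ) = p - k then α' • a.1 (k - 1 - p) w else 0)
          + (if (j : ℤ) = -1 - (p - k) then α' • a.1 (k - 1 - p) w else 0))
        + ((if (j : ℤ) = p then (σ * α) • b.1 (k - 1 - p) w else 0)
          + (if (j : ℤ) = -1 - p then (σ * α) • b.1 (k - 1 - p) w else 0))) := by
    intro j
    have e₁ : (if k + (j : ℤ) = p then α' else 0) • a.1 (-1 - (j : ℤ)) w
        = if (j : ℤ) = p - k then α' • a.1 (k - 1 - p) w else 0 := by
      by_cases hj : (j : ℤ) = p - k
      · rw [if_pos hj, if_pos (by omega), show -1 - (j : ℤ) = k - 1 - p by omega]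
      · rw [if_neg hj, if_neg (by omega), zero_smul]
    have e₂ : (σ * εa * if k - 1 - (j : ℤ) = p then α' else 0) • a.1 (j : ℤ) w
        = if (j : ℤ) = -1 - (p - k) then α' • a.1 (k - 1 - p) w else 0 := by
      by_cases hj : (j : ℤ) = -1 - (p - k)
      · rw [if_pos hj, if_pos (by omega), show (j : ℤ) = k - 1 - p by omega, h₁]
      · rw [if_neg hj, if_neg (by omega), mul_zero, zero_smul]
    have e₃ : (σ * if (j : ℤ) = p then α else 0) • b.1 (k - 1 - (j : ℤ)) w
        = if (j : ℤ) = p then (σ * α) • b.1 (k - 1 - p) w else 0 := by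
      by_cases hj : (j : ℤ) = p
      · rw [if_pos hj, if_pos hj, hj]
      · rw [if_neg hj, if_neg hj, mul_zero, zero_smul]
    have e₄ : (εb * if -1 - (j : ℤ) = p then α else 0) • b.1 (k + (j : ℤ)) w
        = if (j : ℤ) = -1 - p then (σ * α) • b.1 (k - 1 - p) w else 0 := by
      by_cases hj : (j : ℤ) = -1 - p
      · rw [if_pos hj, if_pos (by omega), show k + (j : ℤ) = k - 1 - p by omega, h₂]
      · rw [if_neg hj, if_neg (by omega), mul_zero, zero_smul]
    rw [← e₁, ← e₂, ← e₃, ← e₄, h.wickTerm_apply, h.wickTerm_apply]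
    simp only [ha, hb, map_add, map_smul, smul_add, smul_smul]
    module
  rw [wick_apply, wick_apply]
  simp only [key]
  rw [finsum_add_distrib, finsum_add_distrib (finite_support_ite_int _ _)
    (finite_support_ite_int _ _), finsum_ite_int, finsum_ite_int, add_assoc]
  · congr 1
    have := ((εa * εb) • T : Module.End ℂ Weil).toAddMonoidHom.map_finsum
      (wickTerm_support_finite a b k w)
    exact this.symm
  · refine (wickTerm_support_finite a b k w).subset fun j hj h0 => hj ?_
    simp only [h0, map_zero, smul_zero]
  · refine ((finite_support_ite_int (p - k) (α' • a.1 (k - 1 - p) w)).union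
      (finite_support_ite_int p ((σ * α) • b.1 (k - 1 - p) w))).subset ?_
    exact Function.support_add _ _

/-- An operator that commutes up to signs with the modes of `a` and `b` does so with those of
`:ab:`. -/
lemma wick_comm_of_comm {a b : QO} {σ : ℂ} (h : Swaps a b σ) (T : Module.End ℂ Weil)
    (εa εb : ℂ) (ha : ∀ n w, a.1 n (T w) = εa • T (a.1 n w))
    (hb : ∀ n w, b.1 n (T w) = εb • T (b.1 n w)) (k : ℤ) (w : Weil) :
    (wick a b).1 k (T w) = (εa * εb) • T ((wick a b).1 k w) := by
  have := wick_comm h T 0 (εa := εa) (εb := εb) (α := 0) (α' := 0)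
    (fun n w => by simp [ha]) (fun n w => by simp [hb]) (by simp) (by simp) k w
  simpa using this

lemma IsEven.wick {a b : QO} (ha : IsEven a) (hb : IsEven b) : IsEven (wick a b) := fun m w => by
  have := wick_comm_of_comm (ha.swaps b) parity 1 1 (fun n w => by simp [ha n w])
    (fun n w => by simp [hb n w]) m w
  simpa using this

/-! ## Creative fields -/

/-- A field whose nonnegative modes kill the vacuum. -/
def Creative (a : QO) : Prop := ∀ n : ℤ, 0 ≤ n → a.1 n 1 = 0

lemma creative_bosGen (s : Root ⊕ Root) : Creative (bosGen s) := fun n hn => by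
  lift n to ℕ using hn
  rw [bosGen_ofNat, LinearMap.smul_apply, bosAnnih_one, smul_zero]

lemma creative_ferGen (s : Root ⊕ Root) : Creative (ferGen s) := fun n hn => by
  lift n to ℕ using hn
  rw [ferGen_ofNat, ferAnnih_one]

lemma creative_oneQO : Creative oneQO := fun n hn => by
  have : n ≠ -1 := by omega
  simp [oneQO, this]

lemma Creative.add {a b : QO} (ha : Creative a) (hb : Creative b) : Creative (a + b) :=
  fun n hn => by rw [coe_add_apply, ha n hn, hb n hn, add_zero]

lemma Creative.smul {a : QO} (ha : Creative a) (r : ℂ) : Creative (r • a) :=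
  fun n hn => by rw [coe_smul_apply, ha n hn, smul_zero]

lemma Creative.neg {a : QO} (ha : Creative a) : Creative (-a) :=
  fun n hn => by rw [coe_neg_apply, ha n hn, neg_zero]

lemma Creative.sub {a b : QO} (ha : Creative a) (hb : Creative b) : Creative (a - b) :=
  fun n hn => by rw [coe_sub_apply, ha n hn, hb n hn, sub_zero]

lemma Creative.sum {ι : Type*} {s : Finset ι} {f : ι → QO} (h : ∀ i ∈ s, Creative (f i)) :
    Creative (∑ i ∈ s, f i) := fun n hn => by
  rw [coe_sum_apply]
  exact Finset.sum_eq_zero fun i hi => h i hi n hn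

lemma Creative.wickTerm_one {a b : QO} (ha : Creative a) (m : ℤ) (j : ℕ) :
    wickTerm a b m j 1 = a.1 (-1 - j) (b.1 (m + j) 1) := by
  have := ha j (by omega)
  rw [wickTerm, LinearMap.add_apply, superSwap_apply_eq_zero, add_zero]
  · rfl
  all_goals simp [this, parity_one]

lemma Creative.wick_one {a b : QO} (ha : Creative a) (hb : Creative b) {m : ℤ} {N : ℕ}
    (h : 0 ≤ m + N) :
    (wick a b).1 m 1 = ∑ j ∈ Finset.range N, a.1 (-1 - j) (b.1 (m + j) 1) := by
  rw [wick_apply]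
  simp only [ha.wickTerm_one]
  refine finsum_eq_sum_of_support_subset _ fun j hj => ?_
  by_contra hlt
  rw [Finset.mem_coe, Finset.mem_range, not_lt] at hlt
  exact hj (by simp only; rw [hb _ (by omega), map_zero])

lemma Creative.wick {a b : QO} (ha : Creative a) (hb : Creative b) : Creative (wick a b) :=
  fun n hn => by rw [ha.wick_one hb (N := 0) (by simpa using hn), Finset.sum_range_zero]

lemma Creative.der {a : QO} (ha : Creative a) : Creative (der a) := fun n hn => by
  change (-(n : ℂ)) • a.1 (n - 1) 1 = 0
  rcases eq_or_lt_of_le hn with rfl | h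
  · simp
  · rw [ha _ (by omega), smul_zero]

lemma Creative.nop {l : List QO} {u : QO} (hl : ∀ a ∈ l, Creative a) (hu : Creative u) :
    Creative (nop l u) := by
  induction l with
  | nil => exact hu
  | cons a l ih =>
    exact (hl a (by simp)).wick (ih fun a' h => hl a' (by simp [h]))

lemma st_apply (a : QO) : st a = a.1 (-1) 1 := rfl

lemma st_der (a : QO) : st (der a) = a.1 (-2) 1 := by
  change (-((-1 : ℤ) : ℂ)) • a.1 (-1 - 1) 1 = _
  simp

lemma der_neg_one (a : QO) (w : Weil) : (der a).1 (-1) w = a.1 (-2) w := by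
  change (-((-1 : ℤ) : ℂ)) • a.1 (-1 - 1) w = _
  simp

/-- On the vacuum only the term `j = 0` of the first half survives. Iterated Wick products thus
become compositions of `(-1)`-modes applied to `1`. -/
lemma Creative.st_wick {a b : QO} (ha : Creative a) (hb : Creative b) :
    st (ChiralSL2.wick a b) = a.1 (-1) (st b) := by
  rw [st_apply, ha.wick_one hb (N := 1) (by simp)]
  simp [st_apply]

lemma Creative.wick_neg_two {a b : QO} (ha : Creative a) (hb : Creative b) :
    (ChiralSL2.wick a b).1 (-2) 1 = a.1 (-1) (b.1 (-2) 1) + a.1 (-2) (b.1 (-1) 1) := by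
  rw [ha.wick_one hb (N := 2) (by simp)]
  simp [Finset.sum_range_succ]

lemma Creative.st_nop_cons {a : QO} {l : List QO} {u : QO} (ha : Creative a)
    (hl : ∀ a ∈ l, Creative a) (hu : Creative u) :
    st (ChiralSL2.nop (a :: l) u) = a.1 (-1) (st (ChiralSL2.nop l u)) :=
  ha.st_wick (Creative.nop hl hu)

lemma st_nop_replicate_append {a : QO} {l : List QO} {u : QO} (ha : Creative a)
    (hl : ∀ a ∈ l, Creative a) (hu : Creative u) (n : ℕ) :
    st (nop (List.replicate n a ++ l) u) = ((a.1 (-1)) ^ n) (st (nop l u)) := by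
  induction n with
  | zero => rfl
  | succ n ih =>
    rw [List.replicate_succ, List.cons_append, ha.st_nop_cons _ hu, ih, pow_succ',
      Module.End.mul_apply]
    intro a' h'
    rcases List.mem_append.mp h' with h | h
    · rwa [(List.mem_replicate.mp h).2]
    · exact hl a' h

/-! ## Wick products of commuting fields -/

/-- The integers are the disjoint union of the `-1 - j` and the `j` with `j ≥ 0`, which is how the
two halves of a Wick product are indexed. -/
lemma finsum_int {V : Type*} [AddCommMonoid V] {f : ℤ → V} {N : ℕ}
    (h : ∀ r : ℤ, r < -N ∨ (N : ℤ) ≤ r → f r = 0) :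
    ∑ᶠ r : ℤ, f r = ∑ᶠ j : ℕ, (f (-1 - j) + f j) := by
  have hr : ∑ᶠ r : ℤ, f r = ∑ r ∈ Finset.Ico (-N : ℤ) N, f r := by
    refine finsum_eq_sum_of_support_subset _ fun r hr => ?_
    rw [Finset.coe_Ico, Set.mem_Ico]
    by_contra hc
    exact hr (h r (by omega))
  have hl : ∑ᶠ j : ℕ, (f (-1 - j) + f j) = ∑ j ∈ Finset.range N, (f (-1 - j) + f j) := by
    refine finsum_eq_sum_of_support_subset _ fun j hj => ?_
    rw [Finset.coe_range, Set.mem_Iio]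
    by_contra hc
    refine hj ?_
    simp only [h (-1 - (j : ℤ)) (by omega), h (j : ℤ) (by omega), add_zero]
  rw [hr, hl]
  clear hr hl h
  induction N with
  | zero => simp
  | succ N ih =>
    rw [Finset.sum_range_succ, ← ih, show Finset.Ico (-((N + 1 : ℕ) : ℤ)) ((N + 1 : ℕ) : ℤ)
      = insert (-1 - (N : ℤ)) (insert (N : ℤ) (Finset.Ico (-N : ℤ) N)) by ext; simp; omega,
      Finset.sum_insert (by simp), Finset.sum_insert (by simp), ← add_assoc, add_comm]

lemma exists_bound_of_comm {a b : QO} {m : ℤ} {w : Weil}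
    (h : ∀ r s, r + s = m - 1 → a.1 r (b.1 s w) = b.1 s (a.1 r w)) :
    ∃ N : ℕ, ∀ r : ℤ, r < -N ∨ (N : ℤ) ≤ r → a.1 r (b.1 (m - 1 - r) w) = 0 := by
  obtain ⟨A, hA⟩ := a.2 w
  obtain ⟨B, hB⟩ := b.2 w
  refine ⟨(max A (max (m - 1 - B) (B - m + 1))).toNat, fun r hr => ?_⟩
  rcases hr with hr | hr
  · rw [hB _ (by omega), map_zero]
  · rw [h _ _ (by omega), hA _ (by omega), map_zero]

lemma finite_support_of_comm {a b : QO} {m : ℤ} {w : Weil}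
    (h : ∀ r s, r + s = m - 1 → a.1 r (b.1 s w) = b.1 s (a.1 r w)) :
    (Function.support fun r : ℤ => a.1 r (b.1 (m - 1 - r) w)).Finite := by
  obtain ⟨N, hN⟩ := exists_bound_of_comm h
  refine (Set.finite_Ico (-N : ℤ) N).subset fun r hr => ?_
  by_contra hc
  rw [Set.mem_Ico] at hc
  exact hr (hN r (by omega))

/-- If the modes that meet commute, normal ordering is irrelevant and the product is the full
convolution of modes; symmetry and the Leibniz rule can then be read off. Only index pairs with sum
`m - 1` matter, so `β` and `γ` count as commuting in mode `-1`, where the sum is `-2`. -/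
lemma wick_eq_finsum_int {a b : QO} (ha : IsEven a) {m : ℤ} {w : Weil}
    (h : ∀ r s, r + s = m - 1 → a.1 r (b.1 s w) = b.1 s (a.1 r w)) :
    (wick a b).1 m w = ∑ᶠ r : ℤ, a.1 r (b.1 (m - 1 - r) w) := by
  obtain ⟨N, hN⟩ := exists_bound_of_comm h
  rw [finsum_int hN, wick_apply]
  refine finsum_congr fun j => ?_
  rw [(ha.swaps b).wickTerm_apply, one_smul, h (j : ℤ) (m - 1 - j) (by omega),
    show m - 1 - (-1 - (j : ℤ)) = m + j by ring]

lemma wick_swap {a b : QO} (ha : IsEven a) (hb : IsEven b) {m : ℤ} {w : Weil}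
    (h : ∀ r s, r + s = m - 1 → a.1 r (b.1 s w) = b.1 s (a.1 r w)) :
    (wick a b).1 m w = (wick b a).1 m w := by
  rw [wick_eq_finsum_int ha h, wick_eq_finsum_int hb fun r s hrs => (h s r (by omega)).symm,
    ← finsum_comp_equiv (Equiv.subLeft (m - 1))]
  refine finsum_congr fun r => ?_
  rw [Equiv.subLeft_apply, h _ _ (by omega)]
  simp

/-- An operator that acts on the modes of two even commuting fields by derivations acts so on
their Wick product. -/
lemma wick_derivation {a b a' b' : QO} (ha : IsEven a) (ha' : IsEven a')
    (T : Module.End ℂ Weil) (k m : ℤ)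
    (hTa : ∀ n w, T (a.1 n w) = a.1 n (T w) + a'.1 (n + k) w)
    (hTb : ∀ n w, T (b.1 n w) = b.1 n (T w) + b'.1 (n + k) w)
    (h : ∀ r s w, r + s = m - 1 → a.1 r (b.1 s w) = b.1 s (a.1 r w))
    (h₁ : ∀ r s w, r + s = m + k - 1 → a'.1 r (b.1 s w) = b.1 s (a'.1 r w))
    (h₂ : ∀ r s w, r + s = m + k - 1 → a.1 r (b'.1 s w) = b'.1 s (a.1 r w)) (w : Weil) :
    T ((wick a b).1 m w) = (wick a b).1 m (T w)
      + ((wick a' b).1 (m + k) w + (wick a b').1 (m + k) w) := by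
  have hf := finite_support_of_comm fun r s => h r s w
  have hf' := finite_support_of_comm fun r s => h r s (T w)
  have hf₁ := finite_support_of_comm fun r s => h₁ r s w
  have hf₂ := finite_support_of_comm fun r s => h₂ r s w
  rw [wick_eq_finsum_int ha fun r s => h r s w, wick_eq_finsum_int ha fun r s => h r s (T w),
    wick_eq_finsum_int ha' fun r s => h₁ r s w, wick_eq_finsum_int ha fun r s => h₂ r s w,
    -- The operator shifts the mode of `a` by `k`, so the convolution of `a'` and `b` is reindexed
    -- by `r ↦ r + k` before the sums are compared termwise.
    ← finsum_comp_equiv (Equiv.addRight k) (f := fun r => a'.1 r (b.1 (m + k - 1 - r) w)),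
    ← finsum_add_distrib _ hf₂, ← finsum_add_distrib hf']
  · refine (T.toAddMonoidHom.map_finsum hf).trans (finsum_congr fun r => ?_)
    simp only [LinearMap.toAddMonoidHom_coe, hTa, hTb, map_add, Equiv.coe_addRight]
    rw [show m - 1 - r + k = m + k - 1 - r by ring, show m + k - 1 - (r + k) = m - 1 - r by ring]
    abel
  · refine Set.Finite.subset ((Set.Finite.preimage (Equiv.addRight k).injective.injOn hf₁).union
      hf₂) ?_
    exact Function.support_add _ _
  · exact Set.Finite.preimage (Equiv.addRight k).injective.injOn hf₁

/-! ## Bilinearity of the Wick product -/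

lemma evenPart_add (f g : Module.End ℂ Weil) : evenPart (f + g) = evenPart f + evenPart g := by
  simp only [evenPart, mul_add, add_mul]; module

lemma oddPart_add (f g : Module.End ℂ Weil) : oddPart (f + g) = oddPart f + oddPart g := by
  simp only [oddPart, mul_add, add_mul]; module

lemma evenPart_smul (r : ℂ) (f : Module.End ℂ Weil) : evenPart (r • f) = r • evenPart f := by
  simp only [evenPart, mul_smul_comm, smul_mul_assoc]; module

lemma oddPart_smul (r : ℂ) (f : Module.End ℂ Weil) : oddPart (r • f) = r • oddPart f := by
  simp only [oddPart, mul_smul_comm, smul_mul_assoc]; module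

lemma wick_add_left (a a' b : QO) (m : ℤ) (w : Weil) :
    (wick (a + a') b).1 m w = (wick a b).1 m w + (wick a' b).1 m w := by
  rw [wick_apply, wick_apply, wick_apply, ← finsum_add_distrib (wickTerm_support_finite a b m w)
    (wickTerm_support_finite a' b m w)]
  refine finsum_congr fun j => ?_
  rw [← LinearMap.add_apply]
  congr 1
  change (a.1 _ + a'.1 _) * _ + superSwap (a.1 _ + a'.1 _) _ = _
  simp only [wickTerm, superSwap, evenPart_add, oddPart_add, mul_add, add_mul]
  abel

lemma wick_add_right (a b b' : QO) (m : ℤ) (w : Weil) :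
    (wick a (b + b')).1 m w = (wick a b).1 m w + (wick a b').1 m w := by
  rw [wick_apply, wick_apply, wick_apply, ← finsum_add_distrib (wickTerm_support_finite a b m w)
    (wickTerm_support_finite a b' m w)]
  refine finsum_congr fun j => ?_
  rw [← LinearMap.add_apply]
  congr 1
  change _ * (b.1 _ + b'.1 _) + superSwap _ (b.1 _ + b'.1 _) = _
  simp only [wickTerm, superSwap, mul_add, add_mul]
  abel

lemma wick_smul_left (r : ℂ) (a b : QO) (m : ℤ) (w : Weil) :
    (wick (r • a) b).1 m w = r • (wick a b).1 m w := by
  rw [wick_apply, wick_apply, smul_finsum' r (wickTerm_support_finite a b m w)]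
  refine finsum_congr fun j => ?_
  rw [← LinearMap.smul_apply]
  congr 1
  change (r • a.1 _) * _ + superSwap (r • a.1 _) _ = _
  simp only [wickTerm, superSwap, evenPart_smul, oddPart_smul, smul_mul_assoc, mul_smul_comm,
    smul_add]

lemma wick_smul_right (r : ℂ) (a b : QO) (m : ℤ) (w : Weil) :
    (wick a (r • b)).1 m w = r • (wick a b).1 m w := by
  rw [wick_apply, wick_apply, smul_finsum' r (wickTerm_support_finite a b m w)]
  refine finsum_congr fun j => ?_
  rw [← LinearMap.smul_apply]
  congr 1
  change _ * (r • b.1 _) + superSwap _ (r • b.1 _) = _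
  simp only [wickTerm, superSwap, smul_mul_assoc, mul_smul_comm, smul_add]

/-! ## Quadratic fields -/

lemma sum_root {V : Type*} [AddCommMonoid V] (f : Root → V) :
    ∑ i : Root, f i = f .x + f .y + f .h := by
  change Finset.sum {Root.x, Root.y, Root.h} f = _
  rw [Finset.sum_insert (by decide), Finset.sum_insert (by decide), Finset.sum_singleton,
    add_assoc]

/-- An instance of `wick_comm` with `p = -1 - n`, the only mode index at which a generator can fail
to commute with `u(n)`. The lemmas that follow treat the other parities in the same way. -/
lemma wick_bos_bos_bos (s t u : Root ⊕ Root) (k n : ℤ) (w : Weil) :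
    (wick (bosGen s) (bosGen t)).1 k ((bosGen u).1 n w)
      = (bosGen u).1 n ((wick (bosGen s) (bosGen t)).1 k w)
        + bosPair t u • (bosGen s).1 (n + k) w + bosPair s u • (bosGen t).1 (n + k) w := by
  have := wick_comm ((isEven_bosGen s).swaps (bosGen t)) ((bosGen u).1 n) (-1 - n)
    (εa := 1) (εb := 1) (α := bosPair s u) (α' := bosPair t u)
    (fun m w => by
      rw [bosGen_comm s u, one_smul]
      congr 3
      exact propext (by omega))
    (fun m w => by
      rw [bosGen_comm t u, one_smul]
      congr 3
      exact propext (by omega)) (by simp) (by simp) k w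
  rw [this, show k - 1 - (-1 - n) = n + k by ring]
  simp

lemma wick_fer_fer_fer (s t u : Root ⊕ Root) (k n : ℤ) (w : Weil) :
    (wick (ferGen s) (ferGen t)).1 k ((ferGen u).1 n w)
      = (ferGen u).1 n ((wick (ferGen s) (ferGen t)).1 k w)
        + ferPair t u • (ferGen s).1 (n + k) w - ferPair s u • (ferGen t).1 (n + k) w := by
  have := wick_comm ((isOdd_ferGen s).swaps (isOdd_ferGen t)) ((ferGen u).1 n) (-1 - n)
    (εa := -1) (εb := -1) (α := ferPair s u) (α' := ferPair t u)
    (fun m w => by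
      rw [ferGen_anticomm s u, neg_one_smul]
      congr 3
      exact propext (by omega))
    (fun m w => by
      rw [ferGen_anticomm t u, neg_one_smul]
      congr 3
      exact propext (by omega)) (by simp) (by simp) k w
  rw [this, show k - 1 - (-1 - n) = n + k by ring]
  simp [sub_eq_add_neg]

lemma wick_bos_bos_fer (s t u : Root ⊕ Root) (k n : ℤ) (w : Weil) :
    (wick (bosGen s) (bosGen t)).1 k ((ferGen u).1 n w)
      = (ferGen u).1 n ((wick (bosGen s) (bosGen t)).1 k w) := by
  have := wick_comm_of_comm ((isEven_bosGen s).swaps (bosGen t)) ((ferGen u).1 n) 1 1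
    (fun m w => by rw [bosGen_ferGen, one_smul]) (fun m w => by rw [bosGen_ferGen, one_smul]) k w
  simpa using this

lemma wick_fer_fer_bos (s t u : Root ⊕ Root) (k n : ℤ) (w : Weil) :
    (wick (ferGen s) (ferGen t)).1 k ((bosGen u).1 n w)
      = (bosGen u).1 n ((wick (ferGen s) (ferGen t)).1 k w) := by
  have := wick_comm_of_comm ((isOdd_ferGen s).swaps (isOdd_ferGen t)) ((bosGen u).1 n) 1 1
    (fun m w => by rw [bosGen_ferGen, one_smul]) (fun m w => by rw [bosGen_ferGen, one_smul]) k w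
  simpa using this

lemma wick_bos_fer_bos (s t u : Root ⊕ Root) (k n : ℤ) (w : Weil) :
    (wick (bosGen s) (ferGen t)).1 k ((bosGen u).1 n w)
      = (bosGen u).1 n ((wick (bosGen s) (ferGen t)).1 k w)
        + bosPair s u • (ferGen t).1 (n + k) w := by
  have := wick_comm ((isEven_bosGen s).swaps (ferGen t)) ((bosGen u).1 n) (-1 - n)
    (εa := 1) (εb := 1) (α := bosPair s u) (α' := 0)
    (fun m w => by
      rw [bosGen_comm s u, one_smul]
      congr 3
      exact propext (by omega))
    (fun m w => by
      rw [bosGen_ferGen u t, one_smul]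
      simp) (by simp) (by simp) k w
  rw [this, show k - 1 - (-1 - n) = n + k by ring]
  simp

/-- The coadjoint action on the index of `γ` and the adjoint action on that of `β`. -/
def adBos (i : Root) : Root ⊕ Root → QO
  | .inl l => ∑ t : Root, bracket i l t • β t
  | .inr l => ∑ t : Root, (-bracket i t l) • γ t

/-- The adjoint action on the index of `b`. -/
def adFer (i l : Root) : QO := ∑ t : Root, bracket i l t • b t

lemma Θ_apply (i : Root) (k : ℤ) (w : Weil) :
    (Θ i).1 k w = ∑ j : Root, ∑ t : Root, bracket i j t •
      ((wick (ferGen (.inl t)) (ferGen (.inr j))).1 k w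
        - (wick (bosGen (.inl t)) (bosGen (.inr j))).1 k w) := by
  rw [Θ, coe_sum_apply]
  refine Finset.sum_congr rfl fun j _ => ?_
  rw [coe_sum_apply]
  rfl

/-- With the generators `Θ^i` has only a simple pole, so `Θ^i(k)` acts on their modes like `i ⊗ t^k`
in the loop algebra: by the adjoint action on `β`, by the coadjoint action on `γ`. -/
lemma Θ_bosGen (i : Root) (u : Root ⊕ Root) (k n : ℤ) (w : Weil) :
    (Θ i).1 k ((bosGen u).1 n w) = (bosGen u).1 n ((Θ i).1 k w) + (adBos i u).1 (n + k) w := by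
  simp only [Θ_apply, wick_fer_fer_bos, wick_bos_bos_bos]
  rcases u with l | l
  · simp only [adBos, coe_sum_apply, coe_smul_apply, map_sum, map_smul, map_sub,
      ← Finset.sum_add_distrib, bosPair, zero_smul, add_zero]
    cases l <;> simp only [sum_root, reduceCtorEq, if_true, if_false] <;>
      simp only [bosGen] <;> module
  · simp only [adBos, coe_sum_apply, coe_smul_apply, map_sum, map_smul, map_sub,
      ← Finset.sum_add_distrib, bosPair, zero_smul, add_zero]
    cases l <;> simp only [sum_root, reduceCtorEq, if_true, if_false] <;>
      simp only [bosGen] <;> module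

lemma Θ_b (i l : Root) (k n : ℤ) (w : Weil) :
    (Θ i).1 k ((b l).1 n w) = (b l).1 n ((Θ i).1 k w) + (adFer i l).1 (n + k) w := by
  have h : ∀ s t : Root ⊕ Root, (wick (bosGen s) (bosGen t)).1 k ((b l).1 n w) = _ :=
    fun s t => wick_bos_bos_fer s t (.inl l) k n w
  have h' : ∀ s t : Root ⊕ Root, (wick (ferGen s) (ferGen t)).1 k ((b l).1 n w) = _ :=
    fun s t => wick_fer_fer_fer s t (.inl l) k n w
  simp only [Θ_apply, h, h']
  simp only [adFer, coe_sum_apply, coe_smul_apply, map_sum, map_smul, map_sub,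
    ← Finset.sum_add_distrib, ferPair, zero_smul, sub_zero]
  cases l <;> simp only [sum_root, reduceCtorEq, if_true, if_false] <;>
    simp only [ferGen] <;> module

lemma creative_Θ (i : Root) : Creative (Θ i) := by
  refine Creative.sum fun j _ => Creative.sum fun t _ => Creative.smul (Creative.sub ?_ ?_) _
  · exact (creative_ferGen (.inl t)).wick (creative_ferGen (.inr j))
  · exact (creative_bosGen (.inl t)).wick (creative_bosGen (.inr j))

lemma isEven_adBos (i : Root) (u : Root ⊕ Root) : IsEven (adBos i u) := by
  intro m w
  have h := fun t => isEven_bosGen t m w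
  rcases u with l | l <;>
    simp only [adBos, coe_sum_apply, coe_smul_apply, map_sum, map_smul]
  · exact Finset.sum_congr rfl fun t _ => congrArg _ (h (.inl t))
  · exact Finset.sum_congr rfl fun t _ => congrArg _ (h (.inr t))

lemma bosGen_comm_inl (i j : Root) (m n : ℤ) (w : Weil) :
    (β i).1 m ((β j).1 n w) = (β j).1 n ((β i).1 m w) := by
  have := bosGen_comm (.inl i) (.inl j) m n w
  simpa [bosPair, bosGen] using this

lemma bosGen_comm_inr (i j : Root) (m n : ℤ) (w : Weil) :
    (γ i).1 m ((γ j).1 n w) = (γ j).1 n ((γ i).1 m w) := by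
  have := bosGen_comm (.inr i) (.inr j) m n w
  simpa [bosPair, bosGen] using this

lemma isEven_β (i : Root) : IsEven (β i) := isEven_bosGen (.inl i)

lemma isEven_γ (i : Root) : IsEven (γ i) := isEven_bosGen (.inr i)

lemma Θ_wick_β_β (i p q : Root) (k m : ℤ) (w : Weil) :
    (Θ i).1 k ((wick (β p) (β q)).1 m w) = (wick (β p) (β q)).1 m ((Θ i).1 k w)
      + (∑ t : Root, bracket i p t • (wick (β t) (β q)).1 (m + k) w
        + ∑ t : Root, bracket i q t • (wick (β p) (β t)).1 (m + k) w) := by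
  rw [wick_derivation (a := β p) (b := β q) (a' := adBos i (.inl p)) (b' := adBos i (.inl q)) (isEven_β p)
    (isEven_adBos i _) ((Θ i).1 k) k m (fun n w => Θ_bosGen i (.inl p) k n w)
    (fun n w => Θ_bosGen i (.inl q) k n w)]
  · simp only [adBos, sum_root, wick_add_left, wick_add_right, wick_smul_left, wick_smul_right]
  · intro r s w _; rw [bosGen_comm_inl]
  · intro r s w _
    simp only [adBos, coe_sum_apply, coe_smul_apply, map_sum, map_smul, bosGen_comm_inl q]
  · intro r s w _
    simp only [adBos, coe_sum_apply, coe_smul_apply, map_sum, map_smul, bosGen_comm_inl p]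

lemma Θ_wick_γ_γ (i p q : Root) (k m : ℤ) (w : Weil) :
    (Θ i).1 k ((wick (γ p) (γ q)).1 m w) = (wick (γ p) (γ q)).1 m ((Θ i).1 k w)
      + (∑ t : Root, (-bracket i t p) • (wick (γ t) (γ q)).1 (m + k) w
        + ∑ t : Root, (-bracket i t q) • (wick (γ p) (γ t)).1 (m + k) w) := by
  rw [wick_derivation (a := γ p) (b := γ q) (a' := adBos i (.inr p)) (b' := adBos i (.inr q)) (isEven_γ p)
    (isEven_adBos i _) ((Θ i).1 k) k m (fun n w => Θ_bosGen i (.inr p) k n w)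
    (fun n w => Θ_bosGen i (.inr q) k n w)]
  · simp only [adBos, sum_root, wick_add_left, wick_add_right, wick_smul_left, wick_smul_right]
  · intro r s w _; rw [bosGen_comm_inr]
  · intro r s w _
    simp only [adBos, coe_sum_apply, coe_smul_apply, map_sum, map_smul, bosGen_comm_inr q]
  · intro r s w _
    simp only [adBos, coe_sum_apply, coe_smul_apply, map_sum, map_smul, bosGen_comm_inr p]

lemma wick_β_comm (p q : Root) (m : ℤ) (w : Weil) :
    (wick (β p) (β q)).1 m w = (wick (β q) (β p)).1 m w :=
  wick_swap (isEven_β p) (isEven_β q) fun r s _ => bosGen_comm_inl p q r s w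

lemma wick_γ_comm (p q : Root) (m : ℤ) (w : Weil) :
    (wick (γ p) (γ q)).1 m w = (wick (γ q) (γ p)).1 m w :=
  wick_swap (isEven_γ p) (isEven_γ q) fun r s _ => bosGen_comm_inr p q r s w

lemma vx_apply (m : ℤ) (w : Weil) :
    vx.1 m w = (1 / 2 : ℂ) • ((wick (γ .h) (γ .h)).1 m w + (wick (γ .x) (γ .y)).1 m w) := rfl

lemma vy_apply (m : ℤ) (w : Weil) :
    vy.1 m w = (-1 / 2 : ℂ) •
      ((wick (β .h) (β .h)).1 m w + (4 : ℂ) • (wick (β .x) (β .y)).1 m w) := rfl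

lemma vh_apply (m : ℤ) (w : Weil) :
    vh.1 m w = (wick (β .h) (γ .h)).1 m w + (wick (β .x) (γ .x)).1 m w
      + (wick (β .y) (γ .y)).1 m w := rfl

/-- Up to a scalar `v^x` is the invariant quadratic form in the dual variables. Since the `γ`
commute with each other, `Θ^i(k)` acts by derivations and the classical invariance carries over;
`v^y`, the Casimir element in the `β`, is treated likewise. -/
lemma Θ_vx (i : Root) (k m : ℤ) (w : Weil) :
    (Θ i).1 k (vx.1 m w) = vx.1 m ((Θ i).1 k w) := by
  simp only [vx_apply, map_add, map_smul, Θ_wick_γ_γ, sum_root]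
  cases i <;> simp only [bracket, neg_zero, zero_smul, wick_γ_comm .h .x,
    wick_γ_comm .h .y] <;> module

lemma Θ_vy (i : Root) (k m : ℤ) (w : Weil) :
    (Θ i).1 k (vy.1 m w) = vy.1 m ((Θ i).1 k w) := by
  simp only [vy_apply, map_add, map_smul, Θ_wick_β_β, sum_root]
  cases i <;> simp only [bracket, zero_smul, wick_β_comm .h .x,
    wick_β_comm .h .y] <;> module

/-- The derivation `[v^x(0), -]` on the modes of the `β`'s. -/
def lower : Root → QO
  | .x => (-1 / 2 : ℂ) • γ .y
  | .y => (-1 / 2 : ℂ) • γ .x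
  | .h => (-1 : ℂ) • γ .h

lemma vx_zero_β (l : Root) (n : ℤ) (w : Weil) :
    vx.1 0 ((β l).1 n w) = (β l).1 n (vx.1 0 w) + (lower l).1 (n + 0) w := by
  have h : ∀ p q : Root, (wick (γ p) (γ q)).1 0 ((β l).1 n w) = _ :=
    fun p q => wick_bos_bos_bos (.inr p) (.inr q) (.inl l) 0 n w
  rw [vx_apply, h, h, vx_apply]
  cases l <;> simp [lower, bosPair, bosGen] <;> module

lemma wick_β_γ_swap (p q : Root) (w : Weil) :
    (wick (γ p) (β q)).1 (-1) w = (wick (β q) (γ p)).1 (-1) w := by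
  refine wick_swap (isEven_γ p) (isEven_β q) fun r s hrs => ?_
  have := bosGen_comm (.inr p) (.inl q) r s w
  rw [if_neg (by omega), zero_smul, add_zero] at this
  exact this

lemma isEven_lower (i : Root) : IsEven (lower i) := by
  cases i <;> exact (isEven_γ _).smul _

lemma vx_zero_wick_β_β (p q : Root) (w : Weil) :
    vx.1 0 ((wick (β p) (β q)).1 (-1) w) = (wick (β p) (β q)).1 (-1) (vx.1 0 w)
      + ((wick (lower p) (β q)).1 (-1) w + (wick (β p) (lower q)).1 (-1) w) := by
  have hc : ∀ (i j : Root) (r s : ℤ) (w : Weil), r + s = -1 + 0 - 1 →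
      (β i).1 r ((γ j).1 s w) = (γ j).1 s ((β i).1 r w) := by
    intro i j r s w hrs
    have := bosGen_comm (.inl i) (.inr j) r s w
    rw [if_neg (by omega), zero_smul, add_zero] at this
    exact this
  have := wick_derivation (a' := lower p) (b' := lower q) (isEven_β p)
    (isEven_lower p) (vx.1 0) 0 (-1) (fun n w => vx_zero_β p n w)
    (fun n w => vx_zero_β q n w) (fun r s w _ => bosGen_comm_inl p q r s w)
    (fun r s w hrs => by
      cases p <;> simp only [lower, coe_smul_apply, map_smul] <;> rw [hc _ _ _ _ _ (by omega)])
    (fun r s w hrs => by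
      cases q <;> simp only [lower, coe_smul_apply, map_smul] <;> rw [hc _ _ _ _ _ (by omega)]) w
  simpa using this

/-- This exhibits `v^h(-1)` as a commutator of operators that preserve the basic subspace, so that
the invariance of `v^h`, in which `β` and `γ` do contract, needs no separate computation. -/
lemma vx_zero_vy (w : Weil) :
    vx.1 0 (vy.1 (-1) w) = vy.1 (-1) (vx.1 0 w) + vh.1 (-1) w := by
  simp only [vy_apply, vh_apply, map_add, map_smul, vx_zero_wick_β_β, lower, wick_smul_left,
    wick_smul_right, wick_β_γ_swap]
  module

/-! ## The basic subspace -/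

lemma mem_Wbas {w : Weil} :
    w ∈ Wbas ↔ ∀ (i : Root) (k : ℕ), (b i).1 k w = 0 ∧ (Θ i).1 k w = 0 := by
  simp [Wbas, Submodule.mem_iInf]

lemma wick_bos_bos_b (s t : Root ⊕ Root) (i : Root) (k n : ℤ) (w : Weil) :
    (b i).1 n ((wick (bosGen s) (bosGen t)).1 k w)
      = (wick (bosGen s) (bosGen t)).1 k ((b i).1 n w) :=
  (wick_bos_bos_fer s t (.inl i) k n w).symm

lemma b_vx (i : Root) (m n : ℤ) (w : Weil) :
    (b i).1 n (vx.1 m w) = vx.1 m ((b i).1 n w) := by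
  have h : ∀ p q : Root, (b i).1 n ((wick (γ p) (γ q)).1 m w) = _ :=
    fun p q => wick_bos_bos_b (.inr p) (.inr q) i m n w
  rw [vx_apply, vx_apply, map_smul, map_add, h, h]
  rfl

lemma b_vy (i : Root) (m n : ℤ) (w : Weil) :
    (b i).1 n (vy.1 m w) = vy.1 m ((b i).1 n w) := by
  have h : ∀ p q : Root, (b i).1 n ((wick (β p) (β q)).1 m w) = _ :=
    fun p q => wick_bos_bos_b (.inl p) (.inl q) i m n w
  rw [vy_apply, vy_apply, map_smul, map_add, map_smul, h, h]
  rfl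

lemma vx_mem_Wbas {w : Weil} (hw : w ∈ Wbas) (m : ℤ) : vx.1 m w ∈ Wbas := by
  rw [mem_Wbas] at hw ⊢
  intro i k
  rw [b_vx, Θ_vx, (hw i k).1, (hw i k).2, map_zero]
  exact ⟨rfl, rfl⟩

lemma vy_mem_Wbas {w : Weil} (hw : w ∈ Wbas) (m : ℤ) : vy.1 m w ∈ Wbas := by
  rw [mem_Wbas] at hw ⊢
  intro i k
  rw [b_vy, Θ_vy, (hw i k).1, (hw i k).2, map_zero]
  exact ⟨rfl, rfl⟩

lemma vh_mem_Wbas {w : Weil} (hw : w ∈ Wbas) : vh.1 (-1) w ∈ Wbas := by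
  rw [show vh.1 (-1) w = vx.1 0 (vy.1 (-1) w) - vy.1 (-1) (vx.1 0 w) by
    rw [vx_zero_vy, add_sub_cancel_left]]
  exact Wbas.sub_mem (vx_mem_Wbas (vy_mem_Wbas hw _) _) (vy_mem_Wbas (vx_mem_Wbas hw _) _)

/-! ## Basic vectors -/

lemma β_b (i j : Root) (m n : ℤ) (w : Weil) :
    (β i).1 m ((b j).1 n w) = (b j).1 n ((β i).1 m w) :=
  bosGen_ferGen (.inl i) (.inl j) m n w

lemma γ_b (i j : Root) (m n : ℤ) (w : Weil) :
    (γ i).1 m ((b j).1 n w) = (b j).1 n ((γ i).1 m w) :=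
  bosGen_ferGen (.inr i) (.inl j) m n w

lemma b_b (i j : Root) (m n : ℤ) (w : Weil) :
    (b i).1 m ((b j).1 n w) = -(b j).1 n ((b i).1 m w) := by
  have := ferGen_anticomm (.inl i) (.inl j) m n w
  simpa [ferPair, ferGen] using this

lemma b_b_self (i : Root) (m : ℤ) (w : Weil) : (b i).1 m ((b i).1 m w) = 0 := by
  have := b_b i i m m w
  rwa [eq_neg_iff_add_eq_zero, ← two_smul ℂ, smul_eq_zero_iff_right two_ne_zero] at this

lemma creative_β (i : Root) : Creative (β i) := creative_bosGen (.inl i)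

lemma creative_γ (i : Root) : Creative (γ i) := creative_bosGen (.inr i)

lemma creative_b (i : Root) : Creative (b i) := creative_ferGen (.inl i)

lemma Θ_β (i l : Root) (k n : ℤ) (w : Weil) :
    (Θ i).1 k ((β l).1 n w) = (β l).1 n ((Θ i).1 k w)
      + ∑ t : Root, bracket i l t • (β t).1 (n + k) w := by
  rw [show (β l).1 n w = (bosGen (.inl l)).1 n w from rfl, Θ_bosGen, adBos, coe_sum_apply]
  rfl

lemma Θ_γ (i l : Root) (k n : ℤ) (w : Weil) :
    (Θ i).1 k ((γ l).1 n w) = (γ l).1 n ((Θ i).1 k w)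
      + ∑ t : Root, (-bracket i t l) • (γ t).1 (n + k) w := by
  rw [show (γ l).1 n w = (bosGen (.inr l)).1 n w from rfl, Θ_bosGen, adBos, coe_sum_apply]
  rfl

lemma Θ_b' (i l : Root) (k n : ℤ) (w : Weil) :
    (Θ i).1 k ((b l).1 n w) = (b l).1 n ((Θ i).1 k w)
      + ∑ t : Root, bracket i l t • (b t).1 (n + k) w := by
  rw [Θ_b, adFer, coe_sum_apply]
  rfl

lemma b_one {n : ℤ} (hn : 0 ≤ n) (i : Root) : (b i).1 n 1 = 0 := creative_b i n hn

lemma b_b_one {n : ℤ} (hn : 0 ≤ n) (i j : Root) (m : ℤ) : (b i).1 n ((b j).1 m 1) = 0 := by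
  rw [b_b, b_one hn, map_zero, neg_zero]

lemma β_b_b_one {n : ℤ} (hn : 0 ≤ n) (i j k : Root) (m l : ℤ) :
    (β i).1 n ((b j).1 m ((b k).1 l 1)) = 0 := by
  rw [β_b, β_b, creative_β i n hn, map_zero, map_zero]

lemma γ_b_b_one {n : ℤ} (hn : 0 ≤ n) (i j k : Root) (m l : ℤ) :
    (γ i).1 n ((b j).1 m ((b k).1 l 1)) = 0 := by
  rw [γ_b, γ_b, creative_γ i n hn, map_zero, map_zero]

lemma b_β_b_b_one {n : ℤ} (hn : 0 ≤ n) (p i j k : Root) (r m l : ℤ) :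
    (b p).1 n ((β i).1 r ((b j).1 m ((b k).1 l 1))) = 0 := by
  rw [← β_b, b_b, b_b_one hn, map_zero, neg_zero, map_zero]

lemma b_γ_b_b_one {n : ℤ} (hn : 0 ≤ n) (p i j k : Root) (r m l : ℤ) :
    (b p).1 n ((γ i).1 r ((b j).1 m ((b k).1 l 1))) = 0 := by
  rw [← γ_b, b_b, b_b_one hn, map_zero, neg_zero, map_zero]

lemma creative_nop_β (i j k : Root) : Creative (nop [β i, b j] (b k)) :=
  (creative_β i).wick ((creative_b j).wick (creative_b k))

lemma creative_nop_γ (i j k : Root) : Creative (nop [γ i, b j] (b k)) :=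
  (creative_γ i).wick ((creative_b j).wick (creative_b k))

lemma creative_Cγbb : Creative Cγbb :=
  ((creative_nop_γ _ _ _).neg.add ((creative_nop_γ _ _ _).smul _)).sub
    ((creative_nop_γ _ _ _).smul _)

lemma creative_Cβbb : Creative Cβbb :=
  ((creative_nop_β _ _ _).add (creative_nop_β _ _ _)).sub (creative_nop_β _ _ _)

lemma st_add (a b : QO) : st (a + b) = st a + st b := rfl

lemma st_sub (a b : QO) : st (a - b) = st a - st b := rfl

lemma st_neg (a : QO) : st (-a) = -st a := rfl

lemma st_smul (r : ℂ) (a : QO) : st (r • a) = r • st a := rfl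

lemma st_nop_β (i j k : Root) :
    st (nop [β i, b j] (b k)) = (β i).1 (-1) ((b j).1 (-1) ((b k).1 (-1) 1)) := by
  change st (wick (β i) (wick (b j) (b k))) = _
  rw [(creative_β i).st_wick ((creative_b j).wick (creative_b k)),
    (creative_b j).st_wick (creative_b k)]
  rfl

lemma st_nop_γ (i j k : Root) :
    st (nop [γ i, b j] (b k)) = (γ i).1 (-1) ((b j).1 (-1) ((b k).1 (-1) 1)) := by
  change st (wick (γ i) (wick (b j) (b k))) = _
  rw [(creative_γ i).st_wick ((creative_b j).wick (creative_b k)),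
    (creative_b j).st_wick (creative_b k)]
  rfl

lemma nop_β_neg_two (i j k : Root) :
    (nop [β i, b j] (b k)).1 (-2) 1 = (β i).1 (-1) ((b j).1 (-1) ((b k).1 (-2) 1))
      + (β i).1 (-1) ((b j).1 (-2) ((b k).1 (-1) 1))
      + (β i).1 (-2) ((b j).1 (-1) ((b k).1 (-1) 1)) := by
  change (wick (β i) (wick (b j) (b k))).1 (-2) 1 = _
  rw [(creative_β i).wick_neg_two ((creative_b j).wick (creative_b k)),
    (creative_b j).wick_neg_two (creative_b k), ← st_apply (wick _ _),
    (creative_b j).st_wick (creative_b k), map_add]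
  rfl

lemma st_Cγbb : st Cγbb = -(γ .h).1 (-1) ((b .x).1 (-1) ((b .y).1 (-1) 1))
    + (1 / 2 : ℂ) • (γ .x).1 (-1) ((b .x).1 (-1) ((b .h).1 (-1) 1))
    - (1 / 2 : ℂ) • (γ .y).1 (-1) ((b .y).1 (-1) ((b .h).1 (-1) 1)) := by
  rw [Cγbb, st_sub, st_add, st_neg, st_smul, st_smul, st_nop_γ, st_nop_γ, st_nop_γ]

lemma st_Cβbb : st Cβbb = (β .h).1 (-1) ((b .x).1 (-1) ((b .y).1 (-1) 1))
    + (β .x).1 (-1) ((b .y).1 (-1) ((b .h).1 (-1) 1))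
    - (β .y).1 (-1) ((b .x).1 (-1) ((b .h).1 (-1) 1)) := by
  rw [Cβbb, st_sub, st_add, st_nop_β, st_nop_β, st_nop_β]

lemma st_der_Cβbb : st (der Cβbb) = (nop [β .h, b .x] (b .y)).1 (-2) 1
    + (nop [β .x, b .y] (b .h)).1 (-2) 1 - (nop [β .y, b .x] (b .h)).1 (-2) 1 := st_der _

/-- There is no `c`, so the `b^i(k)` kill the vector. For `k = 0` the claim is the `𝔰𝔩₂`-invariance
of the underlying tensor; for `k ≥ 1` every shifted mode has nonnegative index and reaches the
vacuum. -/
lemma Cγbb_mem_Wbas : st Cγbb ∈ Wbas := by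
  rw [mem_Wbas, st_Cγbb]
  intro i k
  constructor
  · simp only [map_add, map_sub, map_neg, map_smul, b_γ_b_b_one (Int.natCast_nonneg k)]
    simp
  · simp only [map_add, map_sub, map_neg, map_smul, Θ_γ, Θ_b',
      creative_Θ i k (Int.natCast_nonneg k), map_zero, zero_add, map_sum]
    rcases k with _ | k
    · have h₁ := b_b .y .x (-1) (-1) 1
      have h₃ := b_b .h .y (-1) (-1) 1
      cases i <;> simp [sum_root, bracket, h₁, h₃, b_b_self]
    · have hk : (0 : ℤ) ≤ -1 + ((k + 1 : ℕ) : ℤ) := by omega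
      simp only [b_one hk, b_b_one hk, γ_b_b_one hk]
      simp

lemma Cβbb_mem_Wbas : st Cβbb ∈ Wbas := by
  rw [mem_Wbas, st_Cβbb]
  intro i k
  constructor
  · simp only [map_add, map_sub, b_β_b_b_one (Int.natCast_nonneg k)]
    simp
  · simp only [map_add, map_sub, map_smul, Θ_β, Θ_b',
      creative_Θ i k (Int.natCast_nonneg k), map_zero, zero_add, map_sum]
    rcases k with _ | k
    · have h₁ := b_b .y .x (-1) (-1) 1
      have h₃ := b_b .h .y (-1) (-1) 1
      cases i <;> simp [sum_root, bracket, h₁, h₃, b_b_self]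
    · have hk : (0 : ℤ) ≤ -1 + ((k + 1 : ℕ) : ℤ) := by omega
      simp only [b_one hk, b_b_one hk, β_b_b_one hk]
      simp

/-- Compared with `Cβbb_mem_Wbas` the case `k = 1` is new: `Θ^i(1)` returns the differentiated
factor to mode `-1` and kills the other terms, so the invariance of `C^{βbb}` itself is what
remains. From `k = 2` on all shifted modes annihilate. -/
lemma der_Cβbb_mem_Wbas : st (der Cβbb) ∈ Wbas := by
  rw [mem_Wbas, st_der_Cβbb]
  simp only [nop_β_neg_two]
  intro i k
  constructor
  · simp only [map_add, map_sub, b_β_b_b_one (Int.natCast_nonneg k)]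
    simp
  · simp only [map_add, map_sub, map_smul, Θ_β, Θ_b',
      creative_Θ i k (Int.natCast_nonneg k), map_zero, zero_add, map_sum]
    have h₁ := b_b .y .x (-1) (-1) 1
    have h₃ := b_b .h .y (-1) (-1) 1
    rcases k with _ | _ | k
    · have h : ∀ j l : Root, (b j).1 (-2) ((b l).1 (-1) 1) = -(b l).1 (-1) ((b j).1 (-2) 1) :=
        fun j l => b_b j l (-2) (-1) 1
      cases i <;> simp [sum_root, bracket, h₁, h₃, b_b_self, h] <;> module
    · cases i <;> simp [sum_root, bracket, h₁, h₃, b_b_self, b_one, b_b_one, β_b_b_one]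
    · have hk : (0 : ℤ) ≤ -1 + ((k + 1 + 1 : ℕ) : ℤ) := by omega
      have hk' : (0 : ℤ) ≤ -2 + ((k + 1 + 1 : ℕ) : ℤ) := by omega
      simp only [b_one hk, b_b_one hk, β_b_b_one hk, b_one hk', b_b_one hk', β_b_b_one hk']
      simp

lemma pow_mem_of_forall {W : Submodule ℂ Weil} {T : Module.End ℂ Weil}
    (h : ∀ w ∈ W, T w ∈ W) {w : Weil} (hw : w ∈ W) (n : ℕ) : (T ^ n) w ∈ W := by
  induction n with
  | zero => exact hw
  | succ n ih => rw [pow_succ', Module.End.mul_apply]; exact h _ ih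

lemma creative_vy : Creative vy :=
  (((creative_β _).wick (creative_β _)).add (((creative_β _).wick (creative_β _)).smul _)).smul _

lemma creative_vx : Creative vx :=
  (((creative_γ _).wick (creative_γ _)).add ((creative_γ _).wick (creative_γ _))).smul _

lemma creative_vh : Creative vh :=
  (((creative_β _).wick (creative_γ _)).add ((creative_β _).wick (creative_γ _))).add
    ((creative_β _).wick (creative_γ _))

/-- All fields involved are creative, so each Wick product becomes a composition of modes on the
vacuum; the factor `∂v^y` contributes `v^y(-2)`. -/
lemma st_hField (n : ℕ) :
    st (hField n) = (vy.1 (-1) ^ n) (st Cγbb)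
      - ((n : ℂ) / (2 * n + 2)) • (vy.1 (-1) ^ (n - 1)) (vh.1 (-1) (st Cβbb))
      - (((n : ℂ) ^ 2 - n) / (2 * n ^ 2 + 3 * n + 1)) •
          vy.1 (-2) ((vy.1 (-1) ^ (n - 2)) (st Cβbb))
      - ((2 * (n : ℂ) ^ 2 + 3 * n) / (4 * n ^ 2 + 6 * n + 2)) •
          (vy.1 (-1) ^ (n - 1)) (st (der Cβbb)) := by
  have h₀ : ∀ (m : ℕ) (u : QO), Creative u →
      st (nop (List.replicate m vy) u) = (vy.1 (-1) ^ m) (st u) := fun m u hu => by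
    have := st_nop_replicate_append creative_vy (l := []) (by simp) hu m
    rwa [List.append_nil] at this
  have hl : ∀ a ∈ [vh], Creative a := by simpa using creative_vh
  have hr : ∀ a ∈ List.replicate (n - 2) vy, Creative a := fun a ha => by
    rw [(List.mem_replicate.mp ha).2]; exact creative_vy
  rw [hField, st_sub, st_sub, st_sub, st_smul, st_smul, st_smul, h₀ _ _ creative_Cγbb,
    st_nop_replicate_append creative_vy hl creative_Cβbb,
    creative_vy.der.st_nop_cons hr creative_Cβbb, h₀ _ _ creative_Cβbb,
    h₀ _ _ creative_Cβbb.der, der_neg_one]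
  rw [show st (nop [vh] Cβbb) = vh.1 (-1) (st Cβbb) from creative_vh.st_wick creative_Cβbb]

lemma hField_mem_Wbas (n : ℕ) : st (hField n) ∈ Wbas := by
  have h : ∀ w ∈ Wbas, vy.1 (-1) w ∈ Wbas := fun w hw => vy_mem_Wbas hw _
  rw [st_hField]
  exact Wbas.sub_mem (Wbas.sub_mem (Wbas.sub_mem (pow_mem_of_forall h Cγbb_mem_Wbas _)
    (Wbas.smul_mem _ (pow_mem_of_forall h (vh_mem_Wbas Cβbb_mem_Wbas) _)))
    (Wbas.smul_mem _ (vy_mem_Wbas (pow_mem_of_forall h Cβbb_mem_Wbas _) _)))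
    (Wbas.smul_mem _ (pow_mem_of_forall h der_Cβbb_mem_Wbas _))

/-! ## Gradings and the filtration -/

/-- The span of the monomials whose total `g`-weight satisfies `P`. -/
def gsub (g : Letter → ℤ) (P : ℤ → Prop) : Submodule ℂ Weil :=
  Submodule.span ℂ {w | ∃ l : List Letter, P (l.map g).sum ∧ w = mono l}

lemma mono_mem_gsub {g : Letter → ℤ} {P : ℤ → Prop} {l : List Letter} (h : P (l.map g).sum) :
    mono l ∈ gsub g P := Submodule.subset_span ⟨l, h, rfl⟩

lemma gsub_mono {g : Letter → ℤ} {P Q : ℤ → Prop} (h : ∀ z, P z → Q z) : gsub g P ≤ gsub g Q := by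
  refine Submodule.span_mono ?_
  rintro _ ⟨l, hl, rfl⟩
  exact ⟨l, h _ hl, rfl⟩

lemma map_mem_of_mono {g : Letter → ℤ} {P : ℤ → Prop} {W : Submodule ℂ Weil}
    {T : Module.End ℂ Weil} (h : ∀ l : List Letter, P (l.map g).sum → T (mono l) ∈ W)
    {w : Weil} (hw : w ∈ gsub g P) : T w ∈ W := by
  have : gsub g P ≤ W.comap T := Submodule.span_le.mpr (by rintro _ ⟨l, hl, rfl⟩; exact h l hl)
  exact this hw

lemma mono_nil : mono [] = 1 := rfl

lemma mono_cons (L : Letter) (l : List Letter) : mono (L :: l) = letterVec L * mono l := by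
  simp [mono]

lemma letterVec_mul_mem {g : Letter → ℤ} {P Q : ℤ → Prop} (L : Letter)
    (h : ∀ z, P z → Q (g L + z)) {w : Weil} (hw : w ∈ gsub g P) : letterVec L * w ∈ gsub g Q := by
  refine map_mem_of_mono (T := LinearMap.mulLeft ℂ (letterVec L)) (fun l hl => ?_) hw
  rw [LinearMap.mulLeft_apply, ← mono_cons]
  exact mono_mem_gsub (by simpa using h _ hl)

lemma bosAnnih_mono_mem (g : Letter → ℤ) (v : Var) (l : List Letter) :
    bosAnnih v (mono l) ∈ gsub g (· = (l.map g).sum - g (.inl v)) := by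
  induction l with
  | nil => rw [mono_nil, bosAnnih_one]; exact Submodule.zero_mem _
  | cons L l ih =>
    have h := letterVec_mul_mem (Q := (· = ((L :: l).map g).sum - g (.inl v))) L
      (fun z hz => by simp only [hz, List.map_cons, List.sum_cons]; ring) ih
    rw [mono_cons]
    rcases L with u | u
    · rw [letterVec, bosAnnih_bosVar_mul]
      refine Submodule.add_mem _ h ?_
      by_cases huv : v = u
      · subst huv
        exact Submodule.smul_mem _ _ (mono_mem_gsub (by simp))
      · rw [if_neg huv, zero_smul]
        exact Submodule.zero_mem _
    · rw [letterVec, bosAnnih_ferVar_mul]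
      exact h

lemma ferAnnih_mono_mem (g : Letter → ℤ) (v : Var) (l : List Letter) :
    ferAnnih v (mono l) ∈ gsub g (· = (l.map g).sum - g (.inr v)) := by
  induction l with
  | nil => rw [mono_nil, ferAnnih_one]; exact Submodule.zero_mem _
  | cons L l ih =>
    have h := letterVec_mul_mem (Q := (· = ((L :: l).map g).sum - g (.inr v))) L
      (fun z hz => by simp only [hz, List.map_cons, List.sum_cons]; ring) ih
    rw [mono_cons]
    rcases L with u | u
    · rw [letterVec, ferAnnih_bosVar_mul]
      exact h
    · rw [letterVec, ferAnnih_ferVar_mul]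
      refine Submodule.add_mem _ (Submodule.neg_mem _ h) ?_
      by_cases huv : v = u
      · subst huv
        exact Submodule.smul_mem _ _ (mono_mem_gsub (by simp))
      · rw [if_neg huv, zero_smul]
        exact Submodule.zero_mem _

lemma bosAnnih_mem {g : Letter → ℤ} {P Q : ℤ → Prop} (v : Var)
    (h : ∀ z, P z → Q (z - g (.inl v))) {w : Weil} (hw : w ∈ gsub g P) :
    bosAnnih v w ∈ gsub g Q :=
  map_mem_of_mono (fun l hl => gsub_mono (by rintro _ rfl; exact h _ hl)
    (bosAnnih_mono_mem g v l)) hw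

lemma ferAnnih_mem {g : Letter → ℤ} {P Q : ℤ → Prop} (v : Var)
    (h : ∀ z, P z → Q (z - g (.inr v))) {w : Weil} (hw : w ∈ gsub g P) :
    ferAnnih v w ∈ gsub g Q :=
  map_mem_of_mono (fun l hl => gsub_mono (by rintro _ rfl; exact h _ hl)
    (ferAnnih_mono_mem g v l)) hw

lemma bosGen_mem {g : Letter → ℤ} {P Q : ℤ → Prop} (s : Root ⊕ Root) (n : ℤ)
    (hc : ∀ k : ℕ, n = -1 - k → ∀ z, P z → Q (g (.inl (s, k)) + z))
    (ha : ∀ k : ℕ, n = k → ∀ z, P z → Q (z - g (.inl (s.swap, k)))) {w : Weil}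
    (hw : w ∈ gsub g P) : (bosGen s).1 n w ∈ gsub g Q := by
  cases n with
  | ofNat k =>
    simp only [Int.ofNat_eq_natCast] at ha ⊢
    rw [bosGen_ofNat]
    exact Submodule.smul_mem _ _ (bosAnnih_mem _ (ha k rfl) hw)
  | negSucc k =>
    rw [bosGen_negSucc]
    exact letterVec_mul_mem (.inl (s, k)) (hc k (by omega)) hw

lemma ferGen_mem {g : Letter → ℤ} {P Q : ℤ → Prop} (s : Root ⊕ Root) (n : ℤ)
    (hc : ∀ k : ℕ, n = -1 - k → ∀ z, P z → Q (g (.inr (s, k)) + z))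
    (ha : ∀ k : ℕ, n = k → ∀ z, P z → Q (z - g (.inr (s.swap, k)))) {w : Weil}
    (hw : w ∈ gsub g P) : (ferGen s).1 n w ∈ gsub g Q := by
  cases n with
  | ofNat k =>
    simp only [Int.ofNat_eq_natCast] at ha ⊢
    rw [ferGen_ofNat]
    exact ferAnnih_mem _ (ha k rfl) hw
  | negSucc k =>
    rw [ferGen_negSucc]
    exact letterVec_mul_mem (.inr (s, k)) (hc k (by omega)) hw

/-- The field `a` is homogeneous of degree `D`, where the `n`-th mode contributes `-e(n+1)`. -/
def Homog (G : ℤ → Submodule ℂ Weil) (e D : ℤ) (a : QO) : Prop :=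
  ∀ n p w, w ∈ G p → a.1 n w ∈ G (p + D - e * (n + 1))

lemma Homog.add {G : ℤ → Submodule ℂ Weil} {e D : ℤ} {a b : QO} (ha : Homog G e D a)
    (hb : Homog G e D b) : Homog G e D (a + b) :=
  fun n p w hw => Submodule.add_mem _ (ha n p w hw) (hb n p w hw)

lemma Homog.smul {G : ℤ → Submodule ℂ Weil} {e D : ℤ} {a : QO} (ha : Homog G e D a) (r : ℂ) :
    Homog G e D (r • a) :=
  fun n p w hw => Submodule.smul_mem _ _ (ha n p w hw)

/-- In every term the two mode indices add up to `n - 1`, so the shifts by `-e(r+1)` and `-e(s+1)`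
add up to `-e(n+1)`. -/
lemma Homog.wick {G : ℤ → Submodule ℂ Weil} {e D D' : ℤ} {a b : QO} {σ : ℂ}
    (hσ : Swaps a b σ) (ha : Homog G e D a) (hb : Homog G e D' b) :
    Homog G e (D + D') (wick a b) := by
  intro n p w hw
  rw [wick_apply]
  refine finsum_induction (· ∈ G (p + (D + D') - e * (n + 1))) (Submodule.zero_mem _)
    (fun _ _ => Submodule.add_mem _) fun j => ?_
  rw [hσ.wickTerm_apply]
  refine Submodule.add_mem _ ?_ (Submodule.smul_mem _ _ ?_)
  · convert ha (-1 - j) _ _ (hb (n + j) p w hw) using 2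
    ring
  · convert hb (n - 1 - j) _ _ (ha j p w hw) using 2
    ring

/-- The grading by cohomological degree. -/
abbrev degGr (p : ℤ) : Submodule ℂ Weil := gsub letterDeg (· = p)

/-- The grading by conformal weight. -/
abbrev wtGr (p : ℤ) : Submodule ℂ Weil := gsub (fun L => (letterWt L : ℤ)) (· = p)

/-- The filtration by length. -/
abbrev lenFil (p : ℤ) : Submodule ℂ Weil := gsub (fun _ => 1) (· ≤ p)

lemma degSub_eq (p : ℤ) : degSub p = degGr p := rfl

lemma wtSub_eq (m : ℕ) : wtSub m = wtGr m := by
  have h : ∀ l : List Letter, (l.map fun L => (letterWt L : ℤ)).sum = ((l.map letterWt).sum : ℕ) :=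
    fun l => by induction l with
      | nil => rfl
      | cons L l ih => simp [ih]
  simp only [wtSub, gsub, h, Nat.cast_inj]

lemma filt_eq (k : ℕ) : filt k = lenFil k := by
  simp [filt, gsub]

lemma lenFil_mono {p q : ℤ} (h : p ≤ q) : lenFil p ≤ lenFil q :=
  gsub_mono fun _ hz => hz.trans h

/-- The cohomological degree of the even generators. -/
def bosDeg : Root ⊕ Root → ℤ
  | .inl _ => -2
  | .inr _ => 2

/-- The conformal weight of the generators. -/
def genWt : Root ⊕ Root → ℤ
  | .inl _ => 1
  | .inr _ => 0

/-- The cohomological degree of the odd generators. -/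
def ferDeg : Root ⊕ Root → ℤ
  | .inl _ => -1
  | .inr _ => 1

lemma homog_degGr_bosGen (s : Root ⊕ Root) : Homog degGr 0 (bosDeg s) (bosGen s) := by
  intro n p w hw
  refine bosGen_mem s n ?_ ?_ hw
  · rintro k - z rfl
    rcases s with i | i <;> simp [letterDeg, bosDeg, add_comm]
  · rintro k - z rfl
    rcases s with i | i <;> simp [letterDeg, bosDeg, sub_eq_add_neg]

lemma homog_degGr_ferGen (s : Root ⊕ Root) : Homog degGr 0 (ferDeg s) (ferGen s) := by
  intro n p w hw
  refine ferGen_mem s n ?_ ?_ hw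
  · rintro k - z rfl
    rcases s with i | i <;> simp [letterDeg, ferDeg, add_comm]
  · rintro k - z rfl
    rcases s with i | i <;> simp [letterDeg, ferDeg, sub_eq_add_neg]

lemma homog_wtGr_bosGen (s : Root ⊕ Root) : Homog wtGr 1 (genWt s) (bosGen s) := by
  intro n p w hw
  refine bosGen_mem s n ?_ ?_ hw
  · rintro k rfl z rfl
    rcases s with i | i <;> simp [letterWt, genWt] <;> ring
  · rintro k rfl z rfl
    rcases s with i | i <;> simp [letterWt, genWt]

lemma homog_wtGr_ferGen (s : Root ⊕ Root) : Homog wtGr 1 (genWt s) (ferGen s) := by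
  intro n p w hw
  refine ferGen_mem s n ?_ ?_ hw
  · rintro k rfl z rfl
    rcases s with i | i <;> simp [letterWt, genWt] <;> ring
  · rintro k rfl z rfl
    rcases s with i | i <;> simp [letterWt, genWt]

lemma homog_lenFil_bosGen (s : Root ⊕ Root) : Homog lenFil 0 1 (bosGen s) := by
  intro n p w hw
  refine bosGen_mem s n ?_ ?_ hw <;> intros <;> omega

/-! ## Symbols -/

/-- Modulo lower terms of the filtration, the field `a` of length `k` is the multiplication
by `A`. -/
structure HasSymbol (a : QO) (A : Weil) (k : ℤ) : Prop where
  even : IsEven a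
  homog : ∀ n p w, w ∈ lenFil p → a.1 n w ∈ lenFil (p + k)
  lower : ∀ n p w, 0 ≤ n → w ∈ lenFil p → a.1 n w ∈ lenFil (p + k - 2)
  symbol : ∀ p w, w ∈ lenFil p → a.1 (-1) w - A * w ∈ lenFil (p + k - 2)

lemma HasSymbol.mul_mem {a : QO} {A : Weil} {k p : ℤ} {w : Weil} (h : HasSymbol a A k)
    (hw : w ∈ lenFil p) : A * w ∈ lenFil (p + k) := by
  have := Submodule.sub_mem _ (h.homog (-1) p w hw) (lenFil_mono (by omega) (h.symbol p w hw))
  rwa [sub_sub_cancel] at this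

lemma hasSymbol_bosGen (s : Root ⊕ Root) : HasSymbol (bosGen s) (bosVar (s, 0)) 1 where
  even := isEven_bosGen s
  homog n p w hw := by simpa using homog_lenFil_bosGen s n p w hw
  lower n p w hn hw := by
    refine bosGen_mem s n (fun k hk => by omega) ?_ hw
    intros; omega
  symbol p w hw := by
    rw [show (-1 : ℤ) = Int.negSucc 0 from rfl, bosGen_negSucc, LinearMap.mulLeft_apply, sub_self]
    exact Submodule.zero_mem _

lemma hasSymbol_oneQO : HasSymbol oneQO 1 0 where
  even n w := by
    by_cases h : n = -1 <;> simp [oneQO, h]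
  homog n p w hw := by
    by_cases h : n = -1
    · simpa [oneQO, h] using hw
    · simp [oneQO, h]
  lower n p w hn hw := by
    have h : n ≠ -1 := by omega
    simp [oneQO, h]
  symbol p w hw := by simp [oneQO]

lemma HasSymbol.add {a b : QO} {A B : Weil} {k : ℤ} (ha : HasSymbol a A k)
    (hb : HasSymbol b B k) : HasSymbol (a + b) (A + B) k where
  even := ha.even.add hb.even
  homog n p w hw := Submodule.add_mem _ (ha.homog n p w hw) (hb.homog n p w hw)
  lower n p w hn hw := Submodule.add_mem _ (ha.lower n p w hn hw) (hb.lower n p w hn hw)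
  symbol p w hw := by
    have := Submodule.add_mem _ (ha.symbol p w hw) (hb.symbol p w hw)
    rwa [sub_add_sub_comm, ← add_mul] at this

lemma HasSymbol.smul {a : QO} {A : Weil} {k : ℤ} (ha : HasSymbol a A k) (r : ℂ) :
    HasSymbol (r • a) (r • A) k where
  even := ha.even.smul r
  homog n p w hw := Submodule.smul_mem _ _ (ha.homog n p w hw)
  lower n p w hn hw := Submodule.smul_mem _ _ (ha.lower n p w hn hw)
  symbol p w hw := by
    have := Submodule.smul_mem _ r (ha.symbol p w hw)
    rwa [smul_sub, ← smul_mul_assoc] at this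

lemma exists_wick_eq_sum (a b : QO) (m : ℤ) (w : Weil) :
    ∃ N : ℕ, (wick a b).1 m w
      = ∑ j ∈ Finset.range N, wickTerm a b m (j + 1) w + wickTerm a b m 0 w := by
  obtain ⟨N, hN⟩ := (wickTerm_support_finite a b m w).bddAbove
  refine ⟨N, ?_⟩
  rw [← Finset.sum_range_succ' (fun j => wickTerm a b m j w), wick_apply]
  refine finsum_eq_sum_of_support_subset _ fun j hj => ?_
  have := hN hj
  simp only [Finset.coe_range, Set.mem_Iio]
  omega

/-- Every term of the product except `a(-1)b(-1)` in mode `-1` contains a nonnegative mode of one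
factor, and such a mode costs two in length. The exceptional term multiplies the symbols. -/
lemma HasSymbol.wick {a b : QO} {A B : Weil} {k l : ℤ} (ha : HasSymbol a A k)
    (hb : HasSymbol b B l) : HasSymbol (wick a b) (A * B) (k + l) where
  even := ha.even.wick hb.even
  homog n p w hw := by
    have := Homog.wick (G := lenFil) (e := 0) (ha.even.swaps b)
      (fun n p w hw => by simpa using ha.homog n p w hw)
      (fun n p w hw => by simpa using hb.homog n p w hw) n p w hw
    simpa using this
  lower n p w hn hw := by
    rw [wick_apply]
    refine finsum_induction (· ∈ lenFil (p + (k + l) - 2)) (Submodule.zero_mem _)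
      (fun _ _ => Submodule.add_mem _) fun j => ?_
    rw [(ha.even.swaps b).wickTerm_apply, one_smul]
    refine Submodule.add_mem _ ?_ ?_
    · exact lenFil_mono (by omega) (ha.homog (-1 - j) _ _ (hb.lower (n + j) p w (by omega) hw))
    · exact lenFil_mono (by omega) (hb.homog (n - 1 - j) _ _ (ha.lower j p w (by omega) hw))
  symbol p w hw := by
    obtain ⟨N, hN⟩ := exists_wick_eq_sum a b (-1) w
    rw [hN, add_sub_assoc (Finset.sum _ _)]
    refine Submodule.add_mem _ (Submodule.sum_mem _ fun j _ => ?_) ?_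
    · rw [(ha.even.swaps b).wickTerm_apply, one_smul]
      refine Submodule.add_mem _ ?_ ?_
      · exact lenFil_mono (by omega) (ha.homog _ _ _ (hb.lower _ p w (by push_cast; omega) hw))
      · exact lenFil_mono (by omega) (hb.homog _ _ _ (ha.lower _ p w (by omega) hw))
    · rw [(ha.even.swaps b).wickTerm_apply, one_smul, mul_assoc]
      refine (congrArg (· ∈ lenFil _) (add_sub_right_comm _ _ _)).mpr
        (Submodule.add_mem _ ?_ ?_)
      · have h₁ := ha.symbol _ _ (hb.homog (-1) p w hw)
        have h₂ := ha.mul_mem (hb.symbol p w hw)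
        rw [mul_sub] at h₂
        have := Submodule.add_mem _ (lenFil_mono (by omega) h₁)
          (lenFil_mono (show _ ≤ p + (k + l) - 2 by omega) h₂)
        simpa using this
      · exact lenFil_mono (by omega) (hb.homog _ _ _ (ha.lower _ p w (by omega) hw))

lemma hasSymbol_nop {a u : QO} {A U : Weil} {k l : ℤ} (ha : HasSymbol a A k)
    (hu : HasSymbol u U l) (n : ℕ) :
    HasSymbol (nop (List.replicate n a) u) (A ^ n * U) (n * k + l) := by
  induction n with
  | zero =>
    rw [pow_zero, one_mul, Nat.cast_zero, zero_mul, zero_add]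
    exact hu
  | succ n ih =>
    have := ha.wick ih
    rw [← mul_assoc, ← pow_succ', show k + (n * k + l) = ((n + 1 : ℕ) : ℤ) * k + l by
      push_cast; ring] at this
    exact this

/-! ## The symbols of `v^x`, `v^y`, `v^h` -/

/-- The even polynomial variables `β^i` and their divided derivatives. -/
abbrev Bv (i : Root) (k : ℕ) : Bos := MvPolynomial.X (.inl i, k)

/-- The even polynomial variables `γ^{i'}` and their divided derivatives. -/
abbrev Gv (i : Root) (k : ℕ) : Bos := MvPolynomial.X (.inr i, k)

/-- The constant `1 / 2`. -/
def hf : Bos := MvPolynomial.C (1 / 2)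

/-- For `ring` the constant `hf` is an atom; later identities involving one half feed this relation
to `linear_combination`. -/
lemma two_mul_hf : 2 * hf = 1 := by
  rw [hf, ← map_ofNat (MvPolynomial.C (σ := Var) (R := ℂ)) 2, ← map_mul]
  norm_num

lemma half_smul (p : Bos) : (1 / 2 : ℂ) • p = hf * p := MvPolynomial.smul_eq_C_mul p _

lemma neg_half_smul (p : Bos) : (-1 / 2 : ℂ) • p = -(hf * p) := by
  rw [← half_smul, ← neg_smul]
  norm_num

lemma four_smul (p : Bos) : (4 : ℂ) • p = 4 * p := by
  rw [MvPolynomial.smul_eq_C_mul, map_ofNat]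

/-- The symbol of `v^x`. -/
def Vx : Bos := hf * (Gv .h 0 * Gv .h 0 + Gv .x 0 * Gv .y 0)

/-- The symbol of `v^y`. -/
def Vy : Bos := -(hf * (Bv .h 0 * Bv .h 0)) - 2 * (Bv .x 0 * Bv .y 0)

/-- The symbol of `v^h`. -/
def Vh : Bos := Bv .h 0 * Gv .h 0 + Bv .x 0 * Gv .x 0 + Bv .y 0 * Gv .y 0

lemma hasSymbol_β (i : Root) : HasSymbol (β i) (tm (Bv i 0) 1) 1 := hasSymbol_bosGen (.inl i)

lemma hasSymbol_γ (i : Root) : HasSymbol (γ i) (tm (Gv i 0) 1) 1 := hasSymbol_bosGen (.inr i)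

lemma tm_one_mul_tm_one (p q : Bos) : tm p 1 * tm q 1 = tm (p * q) 1 := by
  rw [tm_mul_tm, one_mul]

lemma tm_one_pow (p : Bos) (n : ℕ) : tm p 1 ^ n = tm (p ^ n) 1 := by
  induction n with
  | zero => rw [pow_zero, pow_zero]; rfl
  | succ n ih => rw [pow_succ, ih, tm_one_mul_tm_one, pow_succ]

lemma hasSymbol_vx : HasSymbol vx (tm Vx 1) 2 := by
  have h := (((hasSymbol_γ .h).wick (hasSymbol_γ .h)).add
    ((hasSymbol_γ .x).wick (hasSymbol_γ .y))).smul (1 / 2)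
  simp only [tm_one_mul_tm_one, ← tm_add_left, ← tm_smul_left, half_smul] at h
  exact h

lemma hasSymbol_vy : HasSymbol vy (tm Vy 1) 2 := by
  have h := (((hasSymbol_β .h).wick (hasSymbol_β .h)).add
    (((hasSymbol_β .x).wick (hasSymbol_β .y)).smul 4)).smul (-1 / 2)
  simp only [tm_one_mul_tm_one, ← tm_add_left, ← tm_smul_left, neg_half_smul, four_smul] at h
  rwa [show Vy = -(hf * (Bv .h 0 * Bv .h 0 + 4 * (Bv .x 0 * Bv .y 0))) by
    rw [Vy]; linear_combination (2 * (Bv .x 0 * Bv .y 0)) * two_mul_hf]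

lemma hasSymbol_vh : HasSymbol vh (tm Vh 1) 2 := by
  have h := (((hasSymbol_β .h).wick (hasSymbol_γ .h)).add
    ((hasSymbol_β .x).wick (hasSymbol_γ .x))).add ((hasSymbol_β .y).wick (hasSymbol_γ .y))
  simp only [tm_one_mul_tm_one, ← tm_add_left] at h
  exact h

lemma nop_append (l l' : List QO) (u : QO) : nop (l ++ l') u = nop l (nop l' u) :=
  List.foldr_append

lemma hasSymbol_vMono (r s t : ℕ) :
    HasSymbol (vMono r s t) (tm (Vx ^ r * Vy ^ s * Vh ^ t) 1) (2 * (r + s + t)) := by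
  have h := hasSymbol_nop hasSymbol_vx (hasSymbol_nop hasSymbol_vy
    (hasSymbol_nop hasSymbol_vh hasSymbol_oneQO t) s) r
  simp only [tm_one_pow, mul_one, tm_one_mul_tm_one, ← nop_append] at h
  rw [show (r : ℤ) * 2 + (s * 2 + (t * 2 + 0)) = 2 * (r + s + t) by ring, ← mul_assoc,
    ← List.append_assoc] at h
  exact h

/-! ## Operators commuting with the `v`'s -/

lemma K_apply (k : ℤ) (w : Weil) : K.1 k w = ∑ i : Root, (wick (γ i) (b i)).1 k w :=
  coe_sum_apply _ _ _ _

lemma K_γ (l : Root) (k n : ℤ) (w : Weil) : K.1 k ((γ l).1 n w) = (γ l).1 n (K.1 k w) := by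
  have h : ∀ i : Root, (wick (γ i) (b i)).1 k ((γ l).1 n w) = _ :=
    fun i => wick_bos_fer_bos (.inr i) (.inl i) (.inr l) k n w
  simp only [K_apply, h, map_sum]
  simp [bosPair, bosGen, ferGen]

/-- `K` contains no `β`, hence has no contraction with `γ`. The modes of `v^x` therefore preserve
cocycles, which makes them the tool for producing new ones. -/
lemma K0_vx (m : ℤ) (w : Weil) : K0 (vx.1 m w) = vx.1 m (K0 w) := by
  have h : ∀ p q : Root, (wick (γ p) (γ q)).1 m (K0 w) = K0 ((wick (γ p) (γ q)).1 m w) := by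
    intro p q
    have := wick_comm_of_comm ((isEven_γ p).swaps (γ q)) K0 1 1
      (fun n w => by rw [one_smul]; exact (K_γ p 0 n w).symm)
      (fun n w => by rw [one_smul]; exact (K_γ q 0 n w).symm) m w
    simpa using this
  rw [vx_apply, vx_apply, h, h, map_smul, map_add]

lemma F_apply (k : ℤ) (w : Weil) : F.1 k w = -∑ i : Root, (wick (b i) (c i)).1 k w := by
  rw [F, coe_neg_apply, coe_sum_apply]

lemma F_bosGen (s : Root ⊕ Root) (k n : ℤ) (w : Weil) :
    F.1 k ((bosGen s).1 n w) = (bosGen s).1 n (F.1 k w) := by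
  have h : ∀ i : Root, (wick (b i) (c i)).1 k ((bosGen s).1 n w) = _ :=
    fun i => wick_fer_fer_bos (.inl i) (.inr i) s k n w
  simp only [F_apply, h, map_sum, map_neg]
  rfl

lemma F_b (l : Root) (k n : ℤ) (w : Weil) :
    F.1 k ((b l).1 n w) = (b l).1 n (F.1 k w) - (b l).1 (n + k) w := by
  have h : ∀ i : Root, (wick (b i) (c i)).1 k ((b l).1 n w) = _ :=
    fun i => wick_fer_fer_fer (.inl i) (.inr i) (.inl l) k n w
  simp only [F_apply, h, map_sum, map_neg]
  cases l <;> simp [sum_root, ferPair, ferGen] <;> abel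

/-! ## Explicit polynomials -/

lemma β_tm_neg (i : Root) (k : ℕ) {n : ℤ} (hn : n = -1 - k) (p : Bos) (q : Fer) :
    (β i).1 n (tm p q) = tm (Bv i k * p) q := by
  rw [show n = Int.negSucc k by omega]
  exact (congrArg (fun f => f (tm p q)) (bosGen_negSucc (.inl i) k)).trans (bosVar_mul_tm _ p q)

lemma γ_tm_neg (i : Root) (k : ℕ) {n : ℤ} (hn : n = -1 - k) (p : Bos) (q : Fer) :
    (γ i).1 n (tm p q) = tm (Gv i k * p) q := by
  rw [show n = Int.negSucc k by omega]
  exact (congrArg (fun f => f (tm p q)) (bosGen_negSucc (.inr i) k)).trans (bosVar_mul_tm _ p q)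

lemma b_tm_neg (i : Root) (k : ℕ) {n : ℤ} (hn : n = -1 - k) (p : Bos) (q : Fer) :
    (b i).1 n (tm p q) = tm p (fgen (.inl i, k) * q) := by
  rw [show n = Int.negSucc k by omega]
  exact (congrArg (fun f => f (tm p q)) (ferGen_negSucc (.inl i) k)).trans (ferVar_mul_tm _ p q)

lemma β_tm_nonneg (i : Root) (k : ℕ) {n : ℤ} (hn : n = k) (p : Bos) (q : Fer) :
    (β i).1 n (tm p q) = tm (pderiv (.inr i, k) p) q := by
  subst hn; rfl

lemma γ_tm_nonneg (i : Root) (k : ℕ) {n : ℤ} (hn : n = k) (p : Bos) (q : Fer) :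
    (γ i).1 n (tm p q) = tm (-pderiv (.inl i, k) p) q := by
  subst hn; rw [tm_neg_left]; rfl

lemma b_tm_nonneg (i : Root) (k : ℕ) {n : ℤ} (hn : n = k) (p : Bos) (q : Fer) :
    (b i).1 n (tm p q) = tm p (contr (.inr i, k) q) := by
  subst hn; rfl

/-- Since `p` contains no derivative of a `γ`, the only annihilation modes that act are the `β(0)`;
they occur in the second half at `j = 0` and in the first half at `j = 1`, each time next to a
`β(-2)`. -/
lemma wick_β_β_tm {p : Bos} (hp : ∀ i k, 1 ≤ k → pderiv (.inr i, k) p = 0) (i j : Root)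
    (q : Fer) :
    (wick (β i) (β j)).1 (-1) (tm p q)
      = tm (Bv i 0 * (Bv j 0 * p) + Bv j 1 * pderiv (.inr i, 0) p
          + Bv i 1 * pderiv (.inr j, 0) p) q := by
  rw [wick_apply_eq_sum ((isEven_β i).swaps (β j)) (-1) _ 2]
  · rw [Finset.sum_range_succ, Finset.sum_range_one,
      β_tm_neg j 0 (by norm_num), β_tm_neg i 0 (by norm_num), β_tm_nonneg i 0 (by norm_num),
      β_tm_neg j 1 (by norm_num), β_tm_nonneg j 0 (by norm_num), β_tm_neg i 1 (by norm_num),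
      β_tm_nonneg i 1 (by norm_num), hp i 1 le_rfl, tm_zero_left, map_zero]
    simp only [one_smul, tm_add_left, smul_zero]
    abel
  · intro k hk
    rw [β_tm_nonneg j (k - 1) (by omega), hp j _ (by omega), tm_zero_left, map_zero]
  · intro k hk
    rw [β_tm_nonneg i k rfl, hp i _ (by omega), tm_zero_left, map_zero]

lemma wick_β_β_neg_two_tm {p : Bos} (hp : ∀ i k, pderiv (.inr i, k) p = 0) (i j : Root)
    (q : Fer) :
    (wick (β i) (β j)).1 (-2) (tm p q)
      = tm (Bv i 0 * (Bv j 1 * p) + Bv i 1 * (Bv j 0 * p)) q := by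
  rw [wick_apply_eq_sum ((isEven_β i).swaps (β j)) (-2) _ 2]
  · rw [Finset.sum_range_succ, Finset.sum_range_one,
      β_tm_neg j 1 (by norm_num), β_tm_neg i 0 (by norm_num), β_tm_nonneg i 0 rfl, hp,
      β_tm_nonneg i 1 rfl, hp, tm_zero_left, map_zero, map_zero, β_tm_neg j 0 (by norm_num),
      β_tm_neg i 1 (by norm_num)]
    simp only [tm_add_left, smul_zero, add_zero]
  · intro k hk
    rw [β_tm_nonneg j (k - 2) (by omega), hp, tm_zero_left, map_zero]
  · intro k hk
    rw [β_tm_nonneg i k rfl, hp, tm_zero_left, map_zero]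

lemma wick_β_γ_tm {p : Bos} (hp : ∀ i k, pderiv (.inr i, k) p = 0)
    (hp' : ∀ i k, 1 ≤ k → pderiv (.inl i, k) p = 0) (i j : Root) (q : Fer) :
    (wick (β i) (γ j)).1 (-1) (tm p q)
      = tm (Bv i 0 * (Gv j 0 * p) - Bv i 1 * pderiv (.inl j, 0) p) q := by
  rw [wick_apply_eq_sum ((isEven_β i).swaps (γ j)) (-1) _ 2]
  · rw [Finset.sum_range_succ, Finset.sum_range_one,
      γ_tm_neg j 0 (by norm_num), β_tm_neg i 0 (by norm_num), β_tm_nonneg i 0 rfl, hp,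
      β_tm_nonneg i 1 rfl, hp, tm_zero_left, map_zero, map_zero, γ_tm_nonneg j 0 (by norm_num),
      β_tm_neg i 1 (by norm_num)]
    simp only [tm_sub_left, smul_zero, mul_neg, tm_neg_left]
    abel
  · intro k hk
    rw [γ_tm_nonneg j (k - 1) (by omega), hp' j _ (by omega), neg_zero, tm_zero_left, map_zero]
  · intro k hk
    rw [β_tm_nonneg i k rfl, hp, tm_zero_left, map_zero]

lemma wick_γ_γ_zero_tm {p : Bos} (hp : ∀ i k, 1 ≤ k → pderiv (.inl i, k) p = 0) (i j : Root)
    (q : Fer) :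
    (wick (γ i) (γ j)).1 0 (tm p q)
      = -tm (Gv i 0 * pderiv (.inl j, 0) p + Gv j 0 * pderiv (.inl i, 0) p) q := by
  rw [wick_apply_eq_sum ((isEven_γ i).swaps (γ j)) 0 _ 1]
  · rw [Finset.sum_range_one,
      γ_tm_nonneg j 0 (by norm_num), γ_tm_neg i 0 (by norm_num), γ_tm_nonneg i 0 (by norm_num),
      γ_tm_neg j 0 (by norm_num)]
    simp only [one_smul, tm_add_left, mul_neg, tm_neg_left]
    abel
  · intro k hk
    rw [γ_tm_nonneg j k (by omega), hp j _ (by omega), neg_zero, tm_zero_left, map_zero]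
  · intro k hk
    rw [γ_tm_nonneg i k rfl, hp i _ (by omega), neg_zero, tm_zero_left, map_zero]

/-- The part of `v^y(-1)` that is of first order in the annihilation operators. -/
def vyShift (p : Bos) : Bos :=
  -(Bv .h 1 * pderiv (.inr .h, 0) p) - 2 * (Bv .x 1 * pderiv (.inr .y, 0) p)
    - 2 * (Bv .y 1 * pderiv (.inr .x, 0) p)

/-- The symbol of `∂v^y`. -/
def dVy : Bos := -(Bv .h 0 * Bv .h 1) - 2 * (Bv .x 0 * Bv .y 1)
    - 2 * (Bv .y 0 * Bv .x 1)

lemma vy_tm {p : Bos} (hp : ∀ i k, 1 ≤ k → pderiv (.inr i, k) p = 0) (q : Fer) :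
    vy.1 (-1) (tm p q) = tm (Vy * p + vyShift p) q := by
  rw [vy_apply, wick_β_β_tm hp, wick_β_β_tm hp, ← tm_smul_left, ← tm_add_left, ← tm_smul_left]
  congr 1
  rw [Vy, vyShift, neg_half_smul, four_smul]
  linear_combination (-(Bv .h 1 * pderiv (.inr .h, 0) p) - 2 * (Bv .x 0 * Bv .y 0 * p)
    - 2 * (Bv .x 1 * pderiv (.inr .y, 0) p) - 2 * (Bv .y 1 * pderiv (.inr .x, 0) p)) * two_mul_hf

lemma vy_neg_two_tm {p : Bos} (hp : ∀ i k, pderiv (.inr i, k) p = 0) (q : Fer) :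
    vy.1 (-2) (tm p q) = tm (dVy * p) q := by
  rw [vy_apply, wick_β_β_neg_two_tm hp, wick_β_β_neg_two_tm hp, ← tm_smul_left, ← tm_add_left,
    ← tm_smul_left]
  congr 1
  rw [dVy, neg_half_smul, four_smul]
  linear_combination (-p * (Bv .h 0 * Bv .h 1) - 2 * p * (Bv .x 0 * Bv .y 1)
    - 2 * p * (Bv .y 0 * Bv .x 1)) * two_mul_hf

lemma vh_tm {p : Bos} (hp : ∀ i k, pderiv (.inr i, k) p = 0)
    (hp' : ∀ i k, 1 ≤ k → pderiv (.inl i, k) p = 0) (q : Fer) :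
    vh.1 (-1) (tm p q) = tm (Vh * p - (Bv .h 1 * pderiv (.inl .h, 0) p
      + Bv .x 1 * pderiv (.inl .x, 0) p + Bv .y 1 * pderiv (.inl .y, 0) p)) q := by
  rw [vh_apply, wick_β_γ_tm hp hp', wick_β_γ_tm hp hp', wick_β_γ_tm hp hp', ← tm_add_left,
    ← tm_add_left]
  congr 1
  rw [Vh]
  ring

/-- The derivation `β ↦ γ` given by `v^x(0)` on polynomials without derivatives. -/
def lowerDer : Derivation ℂ Bos Bos :=
  -(Gv .h 0 • pderiv (.inl .h, 0)) - (hf * Gv .x 0) • pderiv (.inl .y, 0)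
    - (hf * Gv .y 0) • pderiv (.inl .x, 0)

lemma vx_zero_tm {p : Bos} (hp : ∀ i k, 1 ≤ k → pderiv (.inl i, k) p = 0) (q : Fer) :
    vx.1 0 (tm p q) = tm (lowerDer p) q := by
  rw [vx_apply, wick_γ_γ_zero_tm hp, wick_γ_γ_zero_tm hp, ← tm_neg_left, ← tm_neg_left,
    ← tm_add_left, ← tm_smul_left]
  congr 1
  simp only [lowerDer, Derivation.sub_apply, Derivation.neg_apply, Derivation.smul_apply,
    smul_eq_mul, half_smul]
  linear_combination (-(Gv .h 0 * pderiv (.inl .h, 0) p)) * two_mul_hf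

/-- In the absence of `c`, `K(0)` is minus the Koszul differential that replaces one variable `∂^k
β^i / k!` by `∂^k b^i / k!`. The bound on derivatives leaves `k = 0` and `k = 1`; the sign comes
from `γ(k) = -∂/∂β`. -/
lemma K0_tm {p : Bos} {q : Fer} (hp : ∀ i k, 2 ≤ k → pderiv (.inl i, k) p = 0)
    (hq : ∀ i k, contr (.inr i, k) q = 0) :
    K0 (tm p q) = -∑ i : Root, (tm (pderiv (.inl i, 0) p) (fgen (.inl i, 0) * q)
      + tm (pderiv (.inl i, 1) p) (fgen (.inl i, 1) * q)) := by
  rw [K0, K_apply, ← Finset.sum_neg_distrib]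
  refine Finset.sum_congr rfl fun i _ => ?_
  rw [wick_apply_eq_sum ((isEven_γ i).swaps (b i)) 0 _ 2]
  · rw [Finset.sum_range_succ, Finset.sum_range_one,
      b_tm_nonneg i 0 (by norm_num), b_tm_nonneg i 1 (by norm_num), hq, hq, tm_zero_right,
      map_zero, map_zero, γ_tm_nonneg i 0 (by norm_num), γ_tm_nonneg i 1 (by norm_num),
      b_tm_neg i 0 (by norm_num), b_tm_neg i 1 (by norm_num)]
    simp only [one_smul, tm_neg_left]
    abel
  · intro k hk
    rw [b_tm_nonneg i k (by omega), hq, tm_zero_right, map_zero]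
  · intro k hk
    rw [γ_tm_nonneg i k rfl, hp i k hk, neg_zero, tm_zero_left, map_zero]

/-! ### Powers of `v^y(-1)` on explicit polynomials -/

lemma pderiv_mul_eq_zero {v : Var} {p p' : Bos} (h : pderiv v p = 0) (h' : pderiv v p' = 0) :
    pderiv v (p * p') = 0 := by
  rw [Derivation.leibniz, h, h', smul_zero, smul_zero, add_zero]

lemma pderiv_pow_eq_zero {v : Var} {p : Bos} (h : pderiv v p = 0) (n : ℕ) :
    pderiv v (p ^ n) = 0 := by
  rw [Derivation.leibniz_pow, h, smul_zero, smul_zero]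

lemma pderiv_ofNat (v : Var) (n : ℕ) [n.AtLeastTwo] : pderiv v (ofNat(n) : Bos) = 0 :=
  Derivation.map_natCast _ n

lemma pderiv_hf (v : Var) : pderiv v hf = 0 := MvPolynomial.pderiv_C

lemma pderiv_Vy_inr (i : Root) (k : ℕ) : pderiv (.inr i, k) Vy = 0 := by
  simp [Vy, pderiv_hf, pderiv_ofNat]

lemma vyShift_Vy_mul (n : ℕ) (p : Bos) : vyShift (Vy ^ n * p) = Vy ^ n * vyShift p := by
  simp only [vyShift, Derivation.leibniz, Derivation.leibniz_pow, pderiv_Vy_inr, smul_zero,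
    add_zero, smul_eq_mul, mul_zero]
  ring

lemma vyShift_eq_zero {p : Bos} (hp : ∀ i k, pderiv (.inr i, k) p = 0) : vyShift p = 0 := by
  simp [vyShift, hp]

lemma vyShift_add (p p' : Bos) : vyShift (p + p') = vyShift p + vyShift p' := by
  simp only [vyShift, map_add]
  ring

/-- On these polynomials `v^y(-1)` is `Vy + S` with `S = vyShift`. Multiplication by `Vy` commutes
with `S`, because `Vy` contains no `γ`, and `S` kills `S p`, which contains no `γ` either; only two
terms of the binomial formula remain. For `n = 0` the truncated exponent is harmless because of the
factor `n`. -/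
lemma vy_pow_tm {p : Bos} (hp : ∀ i k, 1 ≤ k → pderiv (.inr i, k) p = 0)
    (hp' : ∀ i k, pderiv (.inr i, k) (vyShift p) = 0) (n : ℕ) (q : Fer) :
    (vy.1 (-1) ^ n) (tm p q) = tm (Vy ^ n * p + n * (Vy ^ (n - 1) * vyShift p)) q := by
  induction n with
  | zero => simp
  | succ n ih =>
    have hfree : ∀ i k, pderiv (.inr i, k)
        ((n : Bos) * (Vy ^ (n - 1) * vyShift p)) = 0 := fun i k =>
      pderiv_mul_eq_zero (Derivation.map_natCast _ n)
        (pderiv_mul_eq_zero (pderiv_pow_eq_zero (pderiv_Vy_inr i k) _) (hp' i k))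
    rw [pow_succ', Module.End.mul_apply, ih, vy_tm]
    · congr 1
      rw [vyShift_add, vyShift_Vy_mul, vyShift_eq_zero (p := (n : Bos) * _)]
      · rcases n with _ | n
        · simp
        · simp only [Nat.add_sub_cancel]
          push_cast
          ring
      · exact hfree
    · intro i k hk
      rw [map_add, hfree, pderiv_mul_eq_zero (pderiv_pow_eq_zero (pderiv_Vy_inr i k) _) (hp i k hk),
        add_zero]

lemma vy_pow_tm_of_free {p : Bos} (hp : ∀ i k, pderiv (.inr i, k) p = 0) (n : ℕ) (q : Fer) :
    (vy.1 (-1) ^ n) (tm p q) = tm (Vy ^ n * p) q := by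
  have h := vyShift_eq_zero hp
  rw [vy_pow_tm (fun i k _ => hp i k) (by simp [h]), h, mul_zero, mul_zero, add_zero]

/-- The odd variable `∂^k b^i / k!`. -/
abbrev bv (i : Root) (k : ℕ) : Fer := fgen (.inl i, k)

/-- Vectors of `b`-number two without derivatives of `b`. -/
def bb (p₁ p₂ p₃ : Bos) : Weil :=
  tm p₁ (bv .x 0 * bv .y 0) + tm p₂ (bv .y 0 * bv .h 0) + tm p₃ (bv .x 0 * bv .h 0)

/-- Vectors of `b`-number two with one derivative of `b`. -/
def dbb (p₁ p₂ p₃ : Bos) : Weil :=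
  tm p₁ (bv .x 0 * bv .y 1 + bv .x 1 * bv .y 0) + tm p₂ (bv .y 0 * bv .h 1 + bv .y 1 * bv .h 0)
    + tm p₃ (bv .x 0 * bv .h 1 + bv .x 1 * bv .h 0)

/-- The product of an even polynomial with `C^{γbb}`. -/
def mulCγ (p : Bos) : Weil :=
  bb (p * -Gv .h 0) (p * -(hf * Gv .y 0)) (p * (hf * Gv .x 0))

/-- The product of an even polynomial with `C^{βbb}`. -/
def mulCβ (p : Bos) : Weil := bb (p * Bv .h 0) (p * Bv .x 0) (p * -Bv .y 0)

/-- The product of an even polynomial with `C^{βbb}` in which `β` is differentiated. -/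
def mulCdβ (p : Bos) : Weil := bb (p * Bv .h 1) (p * Bv .x 1) (p * -Bv .y 1)

/-- The product of an even polynomial with `C^{βbb}` in which `bb` is differentiated. -/
def mulCβd (p : Bos) : Weil := dbb (p * Bv .h 0) (p * Bv .x 0) (p * -Bv .y 0)

/-! ### The summands of the explicit vector as polynomials -/

lemma st_Cγbb_eq : st Cγbb = mulCγ 1 := by
  rw [st_Cγbb]
  simp only [one_eq_tm, b_tm_neg _ 0 (show (-1 : ℤ) = -1 - (0 : ℕ) by norm_num),
    γ_tm_neg _ 0 (show (-1 : ℤ) = -1 - (0 : ℕ) by norm_num), mulCγ, bb, one_mul, mul_one,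
    ← half_smul, tm_smul_left, tm_neg_left]
  module

lemma st_Cβbb_eq : st Cβbb = mulCβ 1 := by
  rw [st_Cβbb]
  simp only [one_eq_tm, b_tm_neg _ 0 (show (-1 : ℤ) = -1 - (0 : ℕ) by norm_num),
    β_tm_neg _ 0 (show (-1 : ℤ) = -1 - (0 : ℕ) by norm_num), mulCβ, bb, one_mul, mul_one,
    tm_neg_left]
  module

lemma st_der_Cβbb_eq : st (der Cβbb) = mulCdβ 1 + mulCβd 1 := by
  rw [st_der_Cβbb, nop_β_neg_two, nop_β_neg_two, nop_β_neg_two]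
  simp only [one_eq_tm,
    b_tm_neg _ 0 (show (-1 : ℤ) = -1 - (0 : ℕ) by norm_num),
    b_tm_neg _ 1 (show (-2 : ℤ) = -1 - (1 : ℕ) by norm_num),
    β_tm_neg _ 0 (show (-1 : ℤ) = -1 - (0 : ℕ) by norm_num),
    β_tm_neg _ 1 (show (-2 : ℤ) = -1 - (1 : ℕ) by norm_num), mulCdβ, mulCβd, bb, dbb, one_mul,
    mul_one, tm_add_right, tm_neg_left]
  module

/-- Applied to the coefficients of `C^{γbb}`, `vyShift` yields exactly those of `C^{βbb}` with `β`
differentiated; this is the contraction of one factor `v^y` with the `γ` in `C^{γbb}`. -/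
lemma vy_pow_Cγbb (n : ℕ) :
    (vy.1 (-1) ^ n) (st Cγbb) = mulCγ (Vy ^ n) + mulCdβ (n * Vy ^ (n - 1)) := by
  have e₁ : vyShift (-Gv .h 0) = Bv .h 1 := by
    simp [vyShift, MvPolynomial.pderiv_X]
  have e₂ : vyShift (-(hf * Gv .y 0)) = Bv .x 1 := by
    simp [vyShift, MvPolynomial.pderiv_X, pderiv_hf]
    linear_combination Bv .x 1 * two_mul_hf
  have e₃ : vyShift (hf * Gv .x 0) = -Bv .y 1 := by
    simp [vyShift, MvPolynomial.pderiv_X, pderiv_hf]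
    linear_combination Bv .y 1 * two_mul_hf
  have h : ∀ (i j : Root) (k : ℕ), 1 ≤ k → pderiv (.inr i, k) (Gv j 0) = 0 := fun i j k hk =>
    MvPolynomial.pderiv_X_of_ne (by simp; omega)
  rw [st_Cγbb_eq, mulCγ, bb, one_mul, one_mul, one_mul, map_add, map_add, vy_pow_tm, vy_pow_tm,
    vy_pow_tm]
  · simp only [mulCγ, mulCdβ, bb, e₁, e₂, e₃, tm_add_left, ← mul_assoc]
    abel
  · intro i k hk; exact pderiv_mul_eq_zero (pderiv_hf _) (h _ _ _ hk)
  · intro i k; rw [e₃]; simp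
  · intro i k hk; rw [map_neg, pderiv_mul_eq_zero (pderiv_hf _) (h _ _ _ hk), neg_zero]
  · intro i k; rw [e₂]; simp
  · intro i k hk; rw [map_neg, h _ _ _ hk, neg_zero]
  · intro i k; rw [e₁]; simp

lemma pderiv_inr_Bv (i j : Root) (k l : ℕ) : pderiv (.inr i, k) (Bv j l) = 0 := by simp

lemma vh_Cβbb : vh.1 (-1) (st Cβbb) = mulCβ Vh - mulCdβ 1 := by
  have h : ∀ (i j : Root) (k : ℕ), 1 ≤ k → pderiv (.inl i, k) (Bv j 0) = 0 := fun i j k hk =>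
    MvPolynomial.pderiv_X_of_ne (by simp; omega)
  rw [st_Cβbb_eq, mulCβ, bb, one_mul, one_mul, one_mul, map_add, map_add, vh_tm, vh_tm, vh_tm]
  · simp [mulCβ, mulCdβ, bb, MvPolynomial.pderiv_X, tm_sub_left, tm_neg_left, tm_add_left]
    abel
  all_goals intro i k
  · rw [map_neg, pderiv_inr_Bv, neg_zero]
  · intro hk; rw [map_neg, h _ _ _ hk, neg_zero]
  · exact pderiv_inr_Bv _ _ _ _
  · exact h _ _ _
  · exact pderiv_inr_Bv _ _ _ _
  · exact h _ _ _

lemma vy_pow_mulCdβ (n : ℕ) : (vy.1 (-1) ^ n) (mulCdβ 1) = mulCdβ (Vy ^ n) := by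
  simp only [mulCdβ, bb, one_mul, map_add]
  rw [vy_pow_tm_of_free (pderiv_inr_Bv · _ · _), vy_pow_tm_of_free (pderiv_inr_Bv · _ · _),
    vy_pow_tm_of_free fun i k => by rw [map_neg, pderiv_inr_Bv, neg_zero]]

lemma vy_pow_mulCβd (n : ℕ) : (vy.1 (-1) ^ n) (mulCβd 1) = mulCβd (Vy ^ n) := by
  simp only [mulCβd, dbb, one_mul, map_add]
  rw [vy_pow_tm_of_free (pderiv_inr_Bv · _ · _), vy_pow_tm_of_free (pderiv_inr_Bv · _ · _),
    vy_pow_tm_of_free fun i k => by rw [map_neg, pderiv_inr_Bv, neg_zero]]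

lemma vy_pow_Cβbb (n : ℕ) : (vy.1 (-1) ^ n) (st Cβbb) = mulCβ (Vy ^ n) := by
  simp only [st_Cβbb_eq, mulCβ, bb, one_mul, map_add]
  rw [vy_pow_tm_of_free (pderiv_inr_Bv · _ · _), vy_pow_tm_of_free (pderiv_inr_Bv · _ · _),
    vy_pow_tm_of_free fun i k => by rw [map_neg, pderiv_inr_Bv, neg_zero]]

lemma vy_neg_two_mulCβ (n : ℕ) : vy.1 (-2) (mulCβ (Vy ^ n)) = mulCβ (dVy * Vy ^ n) := by
  have h : ∀ (j i : Root) (k : ℕ), pderiv (.inr i, k) (Vy ^ n * Bv j 0) = 0 := fun j i k =>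
    pderiv_mul_eq_zero (pderiv_pow_eq_zero (pderiv_Vy_inr i k) _) (pderiv_inr_Bv _ _ _ _)
  simp only [mulCβ, bb, map_add, mul_neg, tm_neg_left, map_neg]
  rw [vy_neg_two_tm (h _), vy_neg_two_tm (h _), vy_neg_two_tm (h _)]
  simp only [mul_assoc]

/-- The single contraction of a `v^y` with the `γ` in `v^h` produces the symbol of `∂v^y`. -/
lemma vy_pow_mulCβ_Vh (n : ℕ) : (vy.1 (-1) ^ n) (mulCβ Vh)
    = mulCβ (Vy ^ n * Vh) + mulCβ (n * (dVy * Vy ^ (n - 1))) := by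
  have e : ∀ j : Root, vyShift (Vh * Bv j 0) = dVy * Bv j 0 := by
    intro j
    simp [vyShift, dVy, Vh, MvPolynomial.pderiv_X]
    ring
  have h : ∀ (j i : Root) (k : ℕ), 1 ≤ k → pderiv (.inr i, k) (Vh * Bv j 0) = 0 := by
    intro j i k hk
    have hg : ∀ l : Root, pderiv (.inr i, k) (Gv l 0) = 0 := fun l =>
      MvPolynomial.pderiv_X_of_ne (by simp; omega)
    refine pderiv_mul_eq_zero ?_ (pderiv_inr_Bv _ _ _ _)
    rw [Vh, map_add, map_add, pderiv_mul_eq_zero (pderiv_inr_Bv _ _ _ _) (hg _),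
      pderiv_mul_eq_zero (pderiv_inr_Bv _ _ _ _) (hg _),
      pderiv_mul_eq_zero (pderiv_inr_Bv _ _ _ _) (hg _), add_zero, add_zero]
  have h' : ∀ (j i : Root) (k : ℕ), pderiv (.inr i, k) (vyShift (Vh * Bv j 0)) = 0 := by
    intro j i k
    rw [e]
    simp [dVy, pderiv_ofNat]
  simp only [mulCβ, bb, map_add, mul_neg, tm_neg_left, map_neg]
  rw [vy_pow_tm (h _) (h' _), vy_pow_tm (h _) (h' _), vy_pow_tm (h _) (h' _), e, e, e]
  simp only [tm_add_left, mul_assoc, mul_left_comm dVy]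
  abel

lemma mulCγ_smul (r : ℂ) (p : Bos) : mulCγ (r • p) = r • mulCγ p := by
  simp only [mulCγ, bb, smul_mul_assoc, tm_smul_left, smul_add]

lemma mulCβ_smul (r : ℂ) (p : Bos) : mulCβ (r • p) = r • mulCβ p := by
  simp only [mulCβ, bb, smul_mul_assoc, tm_smul_left, smul_add]

lemma mulCdβ_smul (r : ℂ) (p : Bos) : mulCdβ (r • p) = r • mulCdβ p := by
  simp only [mulCdβ, bb, smul_mul_assoc, tm_smul_left, smul_add]

lemma natCast_mul_eq_smul (n : ℕ) (p : Bos) : (n : Bos) * p = (n : ℂ) • p := by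
  rw [Nat.cast_smul_eq_nsmul, nsmul_eq_mul]

/-- The constants in the definition are such that, once all contractions are carried out, the
correction to the classical part is one multiple of a combination that is closed by itself. -/
lemma st_hField_eq {n : ℕ} (hn : 1 ≤ n) :
    st (hField n) = (mulCγ (Vy ^ n) - ((n : ℂ) / (2 * n + 2)) • mulCβ (Vy ^ (n - 1) * Vh))
      + ((2 * (n : ℂ) ^ 2 + 3 * n) / (4 * n ^ 2 + 6 * n + 2)) •
        ((2 * n : ℂ) • mulCdβ (Vy ^ (n - 1)) - mulCβd (Vy ^ (n - 1))
          - ((n : ℂ) - 1) • mulCβ (dVy * Vy ^ (n - 2))) := by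
  rw [st_hField, vy_pow_Cγbb, vh_Cβbb, map_sub, vy_pow_mulCβ_Vh, vy_pow_mulCdβ, vy_pow_Cβbb,
    vy_neg_two_mulCβ, st_der_Cβbb_eq, map_add, vy_pow_mulCdβ, vy_pow_mulCβd,
    natCast_mul_eq_smul, natCast_mul_eq_smul, mulCβ_smul, mulCdβ_smul, Nat.sub_sub,
    Nat.cast_sub hn, Nat.cast_one]
  have e₁ : ((n : ℂ) + 1) ≠ 0 := by exact_mod_cast n.succ_ne_zero
  have e₂ : ((n : ℂ) * 2 + 1) ≠ 0 := by exact_mod_cast (n * 2).succ_ne_zero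
  rw [show 2 * (n : ℂ) + 2 = 2 * (n + 1) by ring,
    show 2 * (n : ℂ) ^ 2 + 3 * n + 1 = (2 * n + 1) * (n + 1) by ring,
    show 4 * (n : ℂ) ^ 2 + 6 * n + 2 = 2 * ((2 * n + 1) * (n + 1)) by ring]
  -- `k₁` balances the coefficients of `mulCdβ (Vy ^ (n - 1))`, collected from all summands but the
  -- third, and `k₂` those of `mulCβ (dVy * Vy ^ (n - 2))`.
  have k₁ : (n : ℂ) + n / (2 * (n + 1))
      - (2 * n ^ 2 + 3 * n) / (2 * ((2 * n + 1) * (n + 1)))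
      = (2 * n ^ 2 + 3 * n) / (2 * ((2 * n + 1) * (n + 1))) * (2 * n) := by
    field_simp
    ring
  have k₂ : (n : ℂ) / (2 * (n + 1)) * (n - 1) + (n ^ 2 - n) / ((2 * n + 1) * (n + 1))
      = (2 * n ^ 2 + 3 * n) / (2 * ((2 * n + 1) * (n + 1))) * (n - 1) := by
    field_simp
    ring
  match_scalars
  all_goals first | ring1 | linear_combination k₁ | linear_combination -k₂

/-! ## The differential on explicit polynomials -/

lemma contr_bv_mul (i j : Root) (k l : ℕ) :
    ∀ (t : Root) (m : ℕ), contr (.inr t, m) (bv i k * bv j l) = 0 := fun t m => by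
  rw [contr_fgen_mul, ← mul_one (bv j l), contr_fgen_mul, contr_one]
  simp

lemma bv_mul (i j : Root) (k l : ℕ) : bv i k * bv j l = -(bv j l * bv i k) := fgen_mul_fgen _ _

lemma bv_mul_mul (i j : Root) (k l : ℕ) (q : Fer) :
    bv i k * (bv j l * q) = -(bv j l * (bv i k * q)) := fgen_mul_fgen_mul _ _ _

/-- Vectors of `b`-number three without derivatives of `b`. -/
def bbb (p : Bos) : Weil := tm p (bv .x 0 * (bv .y 0 * bv .h 0))

/-- Each pair of `b`s lacks one of `x, y, h`, so the three coefficients form a vector field in the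
`β`, and `K(0)` is minus its divergence. The sign at `y` comes from reordering the odd variables. -/
lemma K0_bb {p₁ p₂ p₃ : Bos} (h₁ : ∀ i k, 1 ≤ k → pderiv (.inl i, k) p₁ = 0)
    (h₂ : ∀ i k, 1 ≤ k → pderiv (.inl i, k) p₂ = 0)
    (h₃ : ∀ i k, 1 ≤ k → pderiv (.inl i, k) p₃ = 0) :
    K0 (bb p₁ p₂ p₃) = -bbb (pderiv (.inl .h, 0) p₁ + pderiv (.inl .x, 0) p₂
      - pderiv (.inl .y, 0) p₃) := by
  rw [bb, map_add, map_add, K0_tm (fun i k hk => h₁ i k (by omega)) (contr_bv_mul _ _ _ _),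
    K0_tm (fun i k hk => h₂ i k (by omega)) (contr_bv_mul _ _ _ _),
    K0_tm (fun i k hk => h₃ i k (by omega)) (contr_bv_mul _ _ _ _)]
  have e₁ : bv .h 0 * (bv .x 0 * bv .y 0) = bv .x 0 * (bv .y 0 * bv .h 0) := by
    rw [fgen_mul_fgen_mul, fgen_mul_fgen (.inl .h, 0), mul_neg, neg_neg]
  have e₂ : bv .y 0 * (bv .x 0 * bv .h 0) = -(bv .x 0 * (bv .y 0 * bv .h 0)) :=
    fgen_mul_fgen_mul _ _ _
  have e₃ : ∀ i j, bv i 0 * (bv j 0 * bv i 0) = 0 := fun i j => by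
    rw [fgen_mul_fgen_mul, fgen_mul_self, mul_zero, neg_zero]
  simp only [sum_root, h₁ _ 1 le_rfl, h₂ _ 1 le_rfl, h₃ _ 1 le_rfl, tm_zero_left, add_zero,
    fgen_mul_self_mul, e₁, e₂, e₃, tm_zero_right, zero_add, bbb, tm_add_left, tm_sub_left,
    tm_neg_right]
  abel

lemma pderiv_inl_Bv_zero (i j : Root) (k : ℕ) (hk : 1 ≤ k) : pderiv (.inl i, k) (Bv j 0) = 0 :=
  MvPolynomial.pderiv_X_of_ne (by simp; omega)

lemma pderiv_inl_Gv (i j : Root) (k l : ℕ) : pderiv (.inl i, k) (Gv j l) = 0 := by simp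

lemma pderiv_inl_Vy (i : Root) (k : ℕ) (hk : 1 ≤ k) : pderiv (.inl i, k) Vy = 0 := by
  have := fun j => pderiv_inl_Bv_zero i j k hk
  simp [Vy, pderiv_hf, pderiv_ofNat, -MvPolynomial.pderiv_X, this]

lemma pderiv_inl_Vh (i : Root) (k : ℕ) (hk : 1 ≤ k) : pderiv (.inl i, k) Vh = 0 := by
  have := fun j => pderiv_inl_Bv_zero i j k hk
  simp [Vh, -MvPolynomial.pderiv_X, this]

lemma pderiv_inl_Vx (i : Root) (k : ℕ) : pderiv (.inl i, k) Vx = 0 := by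
  simp [Vx, pderiv_hf]

lemma pderiv_h_Vy : pderiv (.inl .h, 0) Vy = -Bv .h 0 := by
  simp [Vy, pderiv_hf, pderiv_ofNat, MvPolynomial.pderiv_X]
  linear_combination Bv .h 0 * two_mul_hf

lemma pderiv_x_Vy : pderiv (.inl .x, 0) Vy = -(2 * Bv .y 0) := by
  simp [Vy, pderiv_hf, pderiv_ofNat, MvPolynomial.pderiv_X]

lemma pderiv_y_Vy : pderiv (.inl .y, 0) Vy = -(2 * Bv .x 0) := by
  simp [Vy, pderiv_hf, pderiv_ofNat, MvPolynomial.pderiv_X]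

lemma pderiv_Vh (i : Root) : pderiv (.inl i, 0) Vh = Gv i 0 := by
  cases i <;> simp [Vh, MvPolynomial.pderiv_X]

/-- The vector field attached to `C^{γbb}` is `lowerDer`; its coefficients contain no `β`, so the
divergence of `p` times this field is the derivative of `p` along it. -/
lemma K0_mulCγ {p : Bos} (h : ∀ i k, 1 ≤ k → pderiv (.inl i, k) p = 0) :
    K0 (mulCγ p) = -bbb (lowerDer p) := by
  have hg : ∀ (i j : Root) (k : ℕ), 1 ≤ k → pderiv (.inl i, k) (p * Gv j 0) = 0 :=
    fun i j k hk => pderiv_mul_eq_zero (h i k hk) (pderiv_inl_Gv _ _ _ _)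
  have hg' : ∀ (i j : Root) (k : ℕ), 1 ≤ k → pderiv (.inl i, k) (p * (hf * Gv j 0)) = 0 :=
    fun i j k hk => pderiv_mul_eq_zero (h i k hk)
      (pderiv_mul_eq_zero (pderiv_hf _) (pderiv_inl_Gv _ _ _ _))
  rw [mulCγ, K0_bb]
  · congr 2
    simp [lowerDer, pderiv_hf]
    ring
  · intro i k hk; rw [mul_neg, map_neg, hg _ _ _ hk, neg_zero]
  · intro i k hk; rw [mul_neg, map_neg, hg' _ _ _ hk, neg_zero]
  · intro i k hk; rw [hg' _ _ _ hk]

/-- The vector field attached to `C^{βbb}` is the Euler field in three variables, which has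
divergence `3`. -/
lemma K0_mulCβ {p : Bos} (h : ∀ i k, 1 ≤ k → pderiv (.inl i, k) p = 0) :
    K0 (mulCβ p) = -bbb (3 * p + (Bv .h 0 * pderiv (.inl .h, 0) p
      + Bv .x 0 * pderiv (.inl .x, 0) p + Bv .y 0 * pderiv (.inl .y, 0) p)) := by
  have hg : ∀ (i j : Root) (k : ℕ), 1 ≤ k → pderiv (.inl i, k) (p * Bv j 0) = 0 :=
    fun i j k hk => pderiv_mul_eq_zero (h i k hk) (pderiv_inl_Bv_zero _ _ _ hk)
  rw [mulCβ, K0_bb]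
  · congr 2
    simp [MvPolynomial.pderiv_X]
    ring
  · intro i k hk; rw [hg _ _ _ hk]
  · intro i k hk; rw [hg _ _ _ hk]
  · intro i k hk; rw [mul_neg, map_neg, hg _ _ _ hk, neg_zero]

lemma lowerDer_Vy : lowerDer Vy = Vh := by
  simp only [lowerDer, Derivation.sub_apply, Derivation.neg_apply, Derivation.smul_apply,
    smul_eq_mul, pderiv_h_Vy, pderiv_x_Vy, pderiv_y_Vy, Vh]
  linear_combination (Bv .x 0 * Gv .x 0 + Bv .y 0 * Gv .y 0) * two_mul_hf

lemma lowerDer_Vh : lowerDer Vh = -(2 * Vx) := by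
  simp only [lowerDer, Derivation.sub_apply, Derivation.neg_apply, Derivation.smul_apply,
    smul_eq_mul, pderiv_Vh, Vx]
  linear_combination (Gv .h 0 * Gv .h 0) * two_mul_hf

lemma lowerDer_Vx : lowerDer Vx = 0 := by
  simp [lowerDer, pderiv_inl_Vx]

/-- `lowerDer` sends `Vy^n` to `n Vy^(n-1) Vh`, of `β`-degree `2n - 1`, on which three plus the
Euler operator acts as `2n + 2`. The two divergences therefore cancel. -/
lemma K0_classical {n : ℕ} (hn : 1 ≤ n) :
    K0 (mulCγ (Vy ^ n) - ((n : ℂ) / (2 * n + 2)) • mulCβ (Vy ^ (n - 1) * Vh)) = 0 := by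
  have hV : ∀ m i k, 1 ≤ k → pderiv (.inl i, k) (Vy ^ m) = 0 := fun m i k hk =>
    pderiv_pow_eq_zero (pderiv_inl_Vy _ _ hk) _
  rw [map_sub, map_smul, K0_mulCγ (hV n),
    K0_mulCβ fun i k hk => pderiv_mul_eq_zero (hV _ i k hk) (pderiv_inl_Vh _ _ hk)]
  obtain ⟨m, rfl⟩ : ∃ m, n = m + 1 := ⟨n - 1, by omega⟩
  have e₁ : lowerDer (Vy ^ (m + 1)) = (m + 1 : ℕ) * (Vy ^ m * Vh) := by
    rw [Derivation.leibniz_pow, lowerDer_Vy, nsmul_eq_mul, smul_eq_mul, Nat.add_sub_cancel]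
  have e₂ : 3 * (Vy ^ m * Vh) + (Bv .h 0 * pderiv (.inl .h, 0) (Vy ^ m * Vh)
      + Bv .x 0 * pderiv (.inl .x, 0) (Vy ^ m * Vh)
      + Bv .y 0 * pderiv (.inl .y, 0) (Vy ^ m * Vh)) = (2 * m + 4 : ℕ) * (Vy ^ m * Vh) := by
    simp only [Derivation.leibniz, Derivation.leibniz_pow, pderiv_Vh, pderiv_h_Vy, pderiv_x_Vy,
      pderiv_y_Vy, smul_eq_mul, nsmul_eq_mul]
    rcases m with _ | m
    · simp only [Vh]; push_cast; ring
    · rw [Nat.add_sub_cancel]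
      simp only [pow_succ, Vh, Vy]
      generalize (-(hf * (Bv .h 0 * Bv .h 0)) - 2 * (Bv .x 0 * Bv .y 0)) ^ m = W
      push_cast
      linear_combination ((m : Bos) + 1) * W * (Bv .h 0 * Gv .h 0 + Bv .x 0 * Gv .x 0
        + Bv .y 0 * Gv .y 0) * (Bv .h 0 * Bv .h 0) * two_mul_hf
  rw [Nat.add_sub_cancel, e₁, e₂, natCast_mul_eq_smul, natCast_mul_eq_smul, bbb, bbb,
    tm_smul_left, tm_smul_left]
  have : ((m : ℂ) + 2) ≠ 0 := by exact_mod_cast (by omega : m + 2 ≠ 0)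
  push_cast
  rw [show 2 * ((m : ℂ) + 1) + 2 = 2 * (m + 2) by ring]
  match_scalars
  field_simp
  ring

instance : Module Bos Weil := inferInstanceAs (Module Bos (Bos ⊗[ℂ] Fer))

/-- With the even polynomials as scalars, `match_scalars` reduces an identity of vectors to
polynomial identities, one for each odd monomial. -/
lemma tm_eq_smul (p : Bos) (q : Fer) : tm p q = p • tm 1 q := by
  have := TensorProduct.smul_tmul' (R := ℂ) p (1 : Bos) q
  rw [smul_eq_mul, mul_one] at this
  exact this.symm

lemma K0_quantum (m : ℕ) :
    K0 (mulCdβ (2 * (m + 1) * Vy ^ m) - mulCβd (Vy ^ m) - mulCβ (m * (dVy * Vy ^ (m - 1)))) = 0 := by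
  have hV : ∀ m i k, 1 ≤ k → pderiv (.inl i, k) (Vy ^ m) = 0 := fun m i k hk =>
    pderiv_pow_eq_zero (pderiv_inl_Vy _ _ hk) _
  have hB : ∀ (i j : Root) (k l : ℕ), 2 ≤ k → l ≤ 1 → pderiv (.inl i, k) (Bv j l) = 0 :=
    fun i j k l hk hl => MvPolynomial.pderiv_X_of_ne (by simp; omega)
  have hd : ∀ i k, 2 ≤ k → pderiv (.inl i, k) dVy = 0 := fun i k hk => by
    simp [dVy, pderiv_ofNat, -MvPolynomial.pderiv_X, hB i _ k _ hk]
  simp only [mulCdβ, mulCβd, mulCβ, bb, dbb, tm_add_right, map_sub, map_add]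
  have h₁ : ∀ j i k, 2 ≤ k → pderiv (.inl i, k) (2 * ((m : Bos) + 1) * Vy ^ m * Bv j 1) = 0 :=
    fun j i k hk => pderiv_mul_eq_zero (pderiv_mul_eq_zero (by simp [pderiv_ofNat])
      (hV _ _ _ (by omega))) (hB _ _ _ _ hk le_rfl)
  have h₂ : ∀ j i k, 2 ≤ k → pderiv (.inl i, k) (Vy ^ m * Bv j 0) = 0 := fun j i k hk =>
    pderiv_mul_eq_zero (hV _ _ _ (by omega)) (hB _ _ _ _ hk zero_le_one)
  have h₃ : ∀ j i k, 2 ≤ k →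
      pderiv (.inl i, k) ((m : Bos) * (dVy * Vy ^ (m - 1)) * Bv j 0) = 0 :=
    fun j i k hk => pderiv_mul_eq_zero (pderiv_mul_eq_zero (Derivation.map_natCast _ _)
      (pderiv_mul_eq_zero (hd _ _ hk) (hV _ _ _ (by omega)))) (hB _ _ _ _ hk zero_le_one)
  have d₀ : pderiv (.inl .h, 0) dVy = -Bv .h 1 := by
    simp [dVy, pderiv_ofNat, MvPolynomial.pderiv_X]
  have d₁ : pderiv (.inl .x, 0) dVy = -(2 * Bv .y 1) := by
    simp [dVy, pderiv_ofNat, MvPolynomial.pderiv_X]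
  have d₂ : pderiv (.inl .y, 0) dVy = -(2 * Bv .x 1) := by
    simp [dVy, pderiv_ofNat, MvPolynomial.pderiv_X]
  have d₃ : pderiv (.inl .h, 1) dVy = -Bv .h 0 := by
    simp [dVy, pderiv_ofNat, MvPolynomial.pderiv_X]
  have d₄ : pderiv (.inl .x, 1) dVy = -(2 * Bv .y 0) := by
    simp [dVy, pderiv_ofNat, MvPolynomial.pderiv_X]
  have d₅ : pderiv (.inl .y, 1) dVy = -(2 * Bv .x 0) := by
    simp [dVy, pderiv_ofNat, MvPolynomial.pderiv_X]
  have hX : ∀ (i j : Root) (k l : ℕ),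
      pderiv (.inl i, k) (Bv j l) = if i = j ∧ k = l then 1 else 0 := fun i j k l => by
    rw [MvPolynomial.pderiv_X, Pi.single_apply]
    simp [eq_comm]
  have hn : ∀ v : Var, pderiv v (m : Bos) = 0 := fun v => Derivation.map_natCast _ _
  have hn' : ∀ v : Var, pderiv v (2 * ((m : Bos) + 1)) = 0 := fun v => by simp [pderiv_ofNat]
  simp only [mul_neg, tm_neg_left, map_neg]
  simp only [K0_tm (h₁ _) (contr_bv_mul _ _ _ _), K0_tm (h₂ _) (contr_bv_mul _ _ _ _),
    K0_tm (h₃ _) (contr_bv_mul _ _ _ _)]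
  have hVp : ∀ m i, pderiv (.inl i, 1) (Vy ^ m) = 0 := fun m i => hV m i 1 le_rfl
  simp only [sum_root, Derivation.leibniz _ _ (Bv _ _), Derivation.leibniz _ (m : Bos),
    Derivation.leibniz _ (2 * ((m : Bos) + 1)), Derivation.leibniz _ dVy, hX, hn, hn', hVp, d₀, d₁,
    d₂, d₃, d₄, d₅, reduceCtorEq, and_true, and_false, if_true, if_false,
    zero_ne_one, one_ne_zero, smul_eq_mul, mul_zero, mul_one, add_zero, zero_add,
    tm_zero_left, Derivation.leibniz_pow, pderiv_h_Vy, pderiv_x_Vy, pderiv_y_Vy, nsmul_eq_mul]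
  -- The odd words are brought to the order `x, y, h`, with undifferentiated letters before
  -- differentiated ones, and words with a repeated letter are dropped.
  simp only [fgen_mul_self_mul, fgen_mul_self, bv_mul_mul .y .x, bv_mul_mul .h .x,
    bv_mul_mul .h .y, bv_mul .h .y, bv_mul .y .y 1 0,
    bv_mul .h .h 1 0, bv_mul_mul .x .x 1 0, bv_mul_mul .y .y 1 0,
    tm_zero_right, mul_neg, neg_neg, tm_neg_right, mul_zero, neg_zero, add_zero, zero_add]
  -- Writing `β^h` as `2b'` turns `Vy` into a polynomial with integral coefficients, so that `hf`
  -- disappears and `ring1` suffices.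
  obtain ⟨b', hb⟩ : ∃ b', Bv .h 0 = 2 * b' := ⟨hf * Bv .h 0, by
    linear_combination (-Bv .h 0) * two_mul_hf⟩
  have hVy : Vy = -(2 * (b' * b')) - 2 * (Bv .x 0 * Bv .y 0) := by
    rw [Vy, hb]
    linear_combination (-(2 * b' * b')) * two_mul_hf
  rw [dVy, hb]
  -- Differentiating `dVy * Vy ^ (m - 1)` produces the exponent `m - 2`; the cases with truncated
  -- subtraction are separated from the generic one.
  rcases m with _ | _ | j
  · simp only [tm_eq_smul (_ * _), tm_eq_smul (-_), tm_eq_smul (_ + _)]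
    match_scalars
    all_goals (push_cast; ring1)
  · simp only [tm_eq_smul (_ * _), tm_eq_smul (-_), tm_eq_smul (_ + _), hVy]
    match_scalars
    all_goals (push_cast; ring1)
  · have e : ∀ j : ℕ, j + 1 + 1 - 1 = j + 1 := fun j => rfl
    simp only [e, Nat.add_sub_cancel, pow_succ]
    generalize Vy ^ j = W
    simp only [tm_eq_smul (_ * _), tm_eq_smul (-_), tm_eq_smul (_ + _), hVy]
    match_scalars
    all_goals ring1

lemma K0_st_hField {n : ℕ} (hn : 1 ≤ n) : K0 (st (hField n)) = 0 := by
  obtain ⟨m, rfl⟩ : ∃ m, n = m + 1 := ⟨n - 1, by omega⟩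
  have h := K0_quantum m
  have e : (2 * ((m : Bos) + 1) * Vy ^ m) = (2 * (m + 1) : ℂ) • Vy ^ m := by
    rw [show (2 * (m + 1) : ℂ) = (2 * (m + 1) : ℕ) by push_cast; ring, ← natCast_mul_eq_smul]
    push_cast
    ring
  rw [e, mulCdβ_smul, natCast_mul_eq_smul, mulCβ_smul] at h
  rw [st_hField_eq hn, map_add, K0_classical hn, zero_add, map_smul]
  simp only [Nat.cast_add, Nat.cast_one, add_sub_cancel_right, Nat.add_sub_cancel,
    show m + 1 - 2 = m - 1 from rfl]
  rw [h, smul_zero]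

/-! ## Gradings of the explicit vectors -/

lemma Homog.apply_mem {G : ℤ → Submodule ℂ Weil} {e D : ℤ} {a : QO} (ha : Homog G e D a)
    {n p q : ℤ} {w : Weil} (hw : w ∈ G p) (h : q = p + D - e * (n + 1)) : a.1 n w ∈ G q :=
  h ▸ ha n p w hw

lemma Homog.pow_mem {G : ℤ → Submodule ℂ Weil} {e D : ℤ} {a : QO} (ha : Homog G e D a)
    {p : ℤ} {w : Weil} (hw : w ∈ G p) (m : ℕ) : (a.1 (-1) ^ m) w ∈ G (p + m * D) := by
  induction m with
  | zero => simpa using hw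
  | succ m ih =>
    rw [pow_succ', Module.End.mul_apply]
    exact ha.apply_mem ih (by push_cast; ring)

/-- Weight, cohomological degree and `b`-number are treated at once, with `d₁, d₂, d₃` the degrees
of `β, γ, b`. A derivative counts `d₁ + d₂`, the degree of a contracted pair `βγ`; this is what
gives all four summands the same degree. -/
lemma st_hField_mem {G : ℤ → Submodule ℂ Weil} {d₁ d₂ d₃ : ℤ}
    (hβ : ∀ i, Homog G (d₁ + d₂) d₁ (β i)) (hγ : ∀ i, Homog G (d₁ + d₂) d₂ (γ i))
    (hb : ∀ i, Homog G (d₁ + d₂) d₃ (b i)) (h₁ : 1 ∈ G 0) {n : ℕ} (hn : 1 ≤ n) :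
    st (hField n) ∈ G (2 * n * d₁ + d₂ + 2 * d₃) := by
  have hvy : Homog G (d₁ + d₂) (2 * d₁) vy := by
    rw [two_mul]
    exact ((Homog.wick ((isEven_β _).swaps _) (hβ _) (hβ _)).add
      ((Homog.wick ((isEven_β _).swaps _) (hβ _) (hβ _)).smul _)).smul _
  have hvh : Homog G (d₁ + d₂) (d₁ + d₂) vh :=
    ((Homog.wick ((isEven_β _).swaps _) (hβ _) (hγ _)).add
      (Homog.wick ((isEven_β _).swaps _) (hβ _) (hγ _))).add
      (Homog.wick ((isEven_β _).swaps _) (hβ _) (hγ _))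
  have hbb : ∀ i j, (b i).1 (-1) ((b j).1 (-1) 1) ∈ G (2 * d₃) := fun i j =>
    (hb i).apply_mem ((hb j).apply_mem h₁ rfl) (by ring)
  have hγbb : ∀ l i j, (γ l).1 (-1) ((b i).1 (-1) ((b j).1 (-1) 1)) ∈ G (d₂ + 2 * d₃) :=
    fun l i j => (hγ l).apply_mem (hbb i j) (by ring)
  have hβbb : ∀ l i j, (β l).1 (-1) ((b i).1 (-1) ((b j).1 (-1) 1)) ∈ G (d₁ + 2 * d₃) :=
    fun l i j => (hβ l).apply_mem (hbb i j) (by ring)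
  have hdβ : ∀ l i j, (nop [β l, b i] (b j)).1 (-2) 1 ∈ G (2 * d₁ + d₂ + 2 * d₃) := by
    intro l i j
    rw [nop_β_neg_two]
    refine Submodule.add_mem _ (Submodule.add_mem _ ?_ ?_) ?_
    · exact (hβ l).apply_mem ((hb i).apply_mem ((hb j).apply_mem h₁ rfl) rfl) (by ring)
    · exact (hβ l).apply_mem ((hb i).apply_mem ((hb j).apply_mem h₁ rfl) rfl) (by ring)
    · exact (hβ l).apply_mem (hbb i j) (by ring)
  have hCγ : st Cγbb ∈ G (d₂ + 2 * d₃) := by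
    rw [st_Cγbb]
    exact Submodule.sub_mem _ (Submodule.add_mem _ (Submodule.neg_mem _ (hγbb _ _ _))
      (Submodule.smul_mem _ _ (hγbb _ _ _))) (Submodule.smul_mem _ _ (hγbb _ _ _))
  have hCβ : st Cβbb ∈ G (d₁ + 2 * d₃) := by
    rw [st_Cβbb]
    exact Submodule.sub_mem _ (Submodule.add_mem _ (hβbb _ _ _) (hβbb _ _ _)) (hβbb _ _ _)
  have hdC : st (der Cβbb) ∈ G (2 * d₁ + d₂ + 2 * d₃) := by
    rw [st_der_Cβbb]
    exact Submodule.sub_mem _ (Submodule.add_mem _ (hdβ _ _ _) (hdβ _ _ _)) (hdβ _ _ _)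
  obtain ⟨m, rfl⟩ : ∃ m, n = m + 1 := ⟨n - 1, by omega⟩
  rw [st_hField, Nat.add_sub_cancel]
  refine Submodule.sub_mem _ (Submodule.sub_mem _ (Submodule.sub_mem _ ?_
    (Submodule.smul_mem _ _ ?_)) ?_) (Submodule.smul_mem _ _ ?_)
  · convert hvy.pow_mem hCγ (m + 1) using 2
    push_cast
    ring
  · convert hvy.pow_mem (hvh.apply_mem (n := -1) hCβ rfl) m using 2
    push_cast
    ring
  -- For `n = 1` the exponent `n - 2` is truncated, but the coefficient `n² - n` vanishes.
  · rcases m with _ | m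
    · norm_num
    · refine Submodule.smul_mem _ _ (hvy.apply_mem (hvy.pow_mem hCβ _) ?_)
      rw [show m + 1 + 1 - 2 = m by omega]
      push_cast
      ring
  · convert hvy.pow_mem hdC m using 2
    push_cast
    ring

lemma one_mem_gsub {g : Letter → ℤ} {P : ℤ → Prop} (h : P 0) : (1 : Weil) ∈ gsub g P :=
  mono_mem_gsub (l := []) (by simpa using h)

lemma st_hField_mem_degGr {n : ℕ} (hn : 1 ≤ n) : st (hField n) ∈ degGr (-4 * n) := by
  have := st_hField_mem (G := degGr) (d₁ := -2) (d₂ := 2) (d₃ := -1)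
    (fun i => homog_degGr_bosGen (.inl i)) (fun i => homog_degGr_bosGen (.inr i))
    (fun i => homog_degGr_ferGen (.inl i)) (one_mem_gsub rfl) hn
  rwa [show 2 * (n : ℤ) * -2 + 2 + 2 * -1 = -4 * n by ring] at this

lemma st_hField_mem_wtGr {n : ℕ} (hn : 1 ≤ n) : st (hField n) ∈ wtGr (2 * n + 2) := by
  have := st_hField_mem (G := wtGr) (d₁ := 1) (d₂ := 0) (d₃ := 1)
    (fun i => homog_wtGr_bosGen (.inl i)) (fun i => homog_wtGr_bosGen (.inr i))
    (fun i => homog_wtGr_ferGen (.inl i)) (one_mem_gsub rfl) hn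
  rwa [show 2 * (n : ℤ) * 1 + 0 + 2 * 1 = 2 * n + 2 by ring] at this

/-- The grading by `b`-number. -/
abbrev numGr (p : ℤ) : Submodule ℂ Weil := Module.End.eigenspace (-(F.1 0)) (p : ℂ)

lemma mem_numGr {p : ℤ} {w : Weil} : w ∈ numGr p ↔ F.1 0 w = -(p : ℂ) • w := by
  rw [Module.End.mem_eigenspace_iff, LinearMap.neg_apply, neg_eq_iff_eq_neg, neg_smul]

lemma homog_numGr_bosGen (s : Root ⊕ Root) : Homog numGr 0 0 (bosGen s) := by
  intro n p w hw
  rw [mem_numGr] at hw ⊢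
  rw [F_bosGen, hw, map_smul, add_zero, zero_mul, sub_zero]

lemma homog_numGr_b (i : Root) : Homog numGr 0 1 (b i) := by
  intro n p w hw
  rw [mem_numGr] at hw ⊢
  rw [F_b, hw, map_smul, zero_mul, sub_zero, add_zero]
  push_cast
  module

lemma creative_F : Creative F :=
  (Creative.sum fun i _ => (creative_b i).wick (creative_ferGen (.inr i))).neg

lemma st_hField_mem_numGr {n : ℕ} (hn : 1 ≤ n) : st (hField n) ∈ numGr 2 := by
  have := st_hField_mem (G := numGr) (d₁ := 0) (d₂ := 0) (d₃ := 1)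
    (fun i => homog_numGr_bosGen (.inl i)) (fun i => homog_numGr_bosGen (.inr i))
    homog_numGr_b (by rw [mem_numGr, creative_F 0 le_rfl]; simp) hn
  simpa using this

lemma homog_vx {G : ℤ → Submodule ℂ Weil} {e d : ℤ} (hγ : ∀ i, Homog G e d (γ i)) :
    Homog G e (2 * d) vx := by
  rw [two_mul]
  exact ((Homog.wick ((isEven_γ _).swaps _) (hγ _) (hγ _)).add
    (Homog.wick ((isEven_γ _).swaps _) (hγ _) (hγ _))).smul _

lemma homog_degGr_vx : Homog degGr 0 4 vx :=
  homog_vx (d := 2) fun i => homog_degGr_bosGen (.inr i)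

lemma homog_wtGr_vx : Homog wtGr 1 0 vx :=
  homog_vx (d := 0) fun i => homog_wtGr_bosGen (.inr i)

lemma homog_numGr_vx : Homog numGr 0 0 vx :=
  homog_vx (d := 0) fun i => homog_numGr_bosGen (.inr i)

/-! ## Lengths of explicit vectors -/

/-- Multiplication by `p` raises the length by at most `k`. -/
def LenLE (p : Bos) (k : ℤ) : Prop := ∀ l w, w ∈ lenFil l → tm p 1 * w ∈ lenFil (l + k)

lemma LenLE.add {p p' : Bos} {k : ℤ} (h : LenLE p k) (h' : LenLE p' k) : LenLE (p + p') k :=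
  fun l w hw => by
    rw [tm_add_left, add_mul]
    exact Submodule.add_mem _ (h l w hw) (h' l w hw)

lemma LenLE.neg {p : Bos} {k : ℤ} (h : LenLE p k) : LenLE (-p) k := fun l w hw => by
  rw [tm_neg_left, neg_mul]
  exact Submodule.neg_mem _ (h l w hw)

lemma LenLE.sub {p p' : Bos} {k : ℤ} (h : LenLE p k) (h' : LenLE p' k) : LenLE (p - p') k := by
  rw [sub_eq_add_neg]
  exact h.add h'.neg

lemma LenLE.mul {p p' : Bos} {k k' : ℤ} (h : LenLE p k) (h' : LenLE p' k') :
    LenLE (p * p') (k + k') := fun l w hw => by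
  rw [← tm_one_mul_tm_one, mul_assoc, show l + (k + k') = l + k' + k by ring]
  exact h _ _ (h' l w hw)

lemma LenLE.smul {p : Bos} {k : ℤ} (h : LenLE p k) (r : ℂ) : LenLE (r • p) k := fun l w hw => by
  rw [tm_smul_left, smul_mul_assoc]
  exact Submodule.smul_mem _ _ (h l w hw)

lemma lenLE_X (v : Var) : LenLE (MvPolynomial.X v) 1 := fun _ _ hw =>
  letterVec_mul_mem (.inl v) (fun z hz => by omega) hw

lemma lenLE_one : LenLE 1 0 := fun l w hw => by
  rw [show tm 1 1 = (1 : Weil) from rfl, one_mul, add_zero]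
  exact hw

lemma LenLE.pow {p : Bos} {k : ℤ} (h : LenLE p k) (n : ℕ) : LenLE (p ^ n) (n * k) := by
  induction n with
  | zero => simpa using lenLE_one
  | succ n ih =>
    have := ih.mul h
    rwa [← pow_succ, show (n : ℤ) * k + k = (n + 1 : ℕ) * k by push_cast; ring] at this

lemma LenLE.two_mul {p : Bos} {k : ℤ} (h : LenLE p k) : LenLE (2 * p) k := by
  rw [_root_.two_mul]
  exact h.add h

lemma LenLE.hf_mul {p : Bos} {k : ℤ} (h : LenLE p k) : LenLE (hf * p) k := by
  rw [← half_smul]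
  exact h.smul _

lemma LenLE.tm_mem {p : Bos} {k l : ℤ} (h : LenLE p k) {q : Fer} (hq : tm 1 q ∈ lenFil l) :
    tm p q ∈ lenFil (l + k) := by
  have := h l _ hq
  rwa [tm_mul_tm, mul_one, one_mul] at this

lemma lenLE_Vx : LenLE Vx 2 :=
  (((lenLE_X _).mul (lenLE_X _)).add ((lenLE_X _).mul (lenLE_X _))).hf_mul

lemma lenLE_Vy : LenLE Vy 2 :=
  ((lenLE_X _).mul (lenLE_X _)).hf_mul.neg.sub ((lenLE_X _).mul (lenLE_X _)).two_mul

lemma lenLE_Vh : LenLE Vh 2 :=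
  (((lenLE_X _).mul (lenLE_X _)).add ((lenLE_X _).mul (lenLE_X _))).add
    ((lenLE_X _).mul (lenLE_X _))

lemma lenLE_dVy : LenLE dVy 2 :=
  (((lenLE_X _).mul (lenLE_X _)).neg.sub ((lenLE_X _).mul (lenLE_X _)).two_mul).sub
    ((lenLE_X _).mul (lenLE_X _)).two_mul

lemma bv_bv_mem (i j : Root) (k l : ℕ) : tm 1 (bv i k * bv j l) ∈ lenFil 2 := by
  have := mono_mem_gsub (g := fun _ => 1) (P := (· ≤ 2)) (l := [.inr (.inl i, k), .inr (.inl j, l)])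
    (by simp)
  convert this using 1
  rw [mono_cons, mono_cons, mono_nil, one_eq_tm, letterVec, letterVec, ferVar_mul_tm,
    ferVar_mul_tm, mul_one]

lemma bb_mem {p₁ p₂ p₃ : Bos} {k : ℤ} (h₁ : LenLE p₁ k) (h₂ : LenLE p₂ k) (h₃ : LenLE p₃ k) :
    bb p₁ p₂ p₃ ∈ lenFil (2 + k) :=
  Submodule.add_mem _ (Submodule.add_mem _ (h₁.tm_mem (bv_bv_mem _ _ _ _))
    (h₂.tm_mem (bv_bv_mem _ _ _ _))) (h₃.tm_mem (bv_bv_mem _ _ _ _))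

lemma dbb_mem {p₁ p₂ p₃ : Bos} {k : ℤ} (h₁ : LenLE p₁ k) (h₂ : LenLE p₂ k) (h₃ : LenLE p₃ k) :
    dbb p₁ p₂ p₃ ∈ lenFil (2 + k) := by
  have h : ∀ i j k l i' j' k' l',
      tm 1 (bv i k * bv j l + bv i' k' * bv j' l') ∈ lenFil 2 := fun i j k l i' j' k' l' => by
    rw [tm_add_right]
    exact Submodule.add_mem _ (bv_bv_mem _ _ _ _) (bv_bv_mem _ _ _ _)
  exact Submodule.add_mem _ (Submodule.add_mem _ (h₁.tm_mem (h _ _ _ _ _ _ _ _))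
    (h₂.tm_mem (h _ _ _ _ _ _ _ _))) (h₃.tm_mem (h _ _ _ _ _ _ _ _))

lemma LenLE.mulCγ_mem {p : Bos} {k l : ℤ} (h : LenLE p k) (hl : k + 3 = l) :
    mulCγ p ∈ lenFil l :=
  lenFil_mono (by omega) (bb_mem (h.mul (lenLE_X _).neg) (h.mul (lenLE_X _).hf_mul.neg)
    (h.mul (lenLE_X _).hf_mul))

lemma LenLE.mulCβ_mem {p : Bos} {k l : ℤ} (h : LenLE p k) (hl : k + 3 = l) :
    mulCβ p ∈ lenFil l :=
  lenFil_mono (by omega) (bb_mem (h.mul (lenLE_X _)) (h.mul (lenLE_X _)) (h.mul (lenLE_X _).neg))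

lemma LenLE.mulCdβ_mem {p : Bos} {k l : ℤ} (h : LenLE p k) (hl : k + 3 = l) :
    mulCdβ p ∈ lenFil l :=
  lenFil_mono (by omega) (bb_mem (h.mul (lenLE_X _)) (h.mul (lenLE_X _)) (h.mul (lenLE_X _).neg))

lemma LenLE.mulCβd_mem {p : Bos} {k l : ℤ} (h : LenLE p k) (hl : k + 3 = l) :
    mulCβd p ∈ lenFil l :=
  lenFil_mono (by omega) (dbb_mem (h.mul (lenLE_X _)) (h.mul (lenLE_X _)) (h.mul (lenLE_X _).neg))

lemma st_hField_symbol {n : ℕ} (hn : 1 ≤ n) :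
    st (hField n) - (mulCγ (Vy ^ n) - ((n : ℂ) / (2 * n + 2)) • mulCβ (Vy ^ (n - 1) * Vh))
      ∈ lenFil (2 * n + 1) := by
  rw [st_hField_eq hn, add_sub_cancel_left]
  obtain ⟨m, rfl⟩ : ∃ m, n = m + 1 := ⟨n - 1, by omega⟩
  refine Submodule.smul_mem _ _ (Submodule.sub_mem _ (Submodule.sub_mem _
    (Submodule.smul_mem _ _ ?_) ?_) ?_)
  · exact (lenLE_Vy.pow _).mulCdβ_mem (by push_cast [Nat.add_sub_cancel]; ring)
  · exact (lenLE_Vy.pow _).mulCβd_mem (by push_cast [Nat.add_sub_cancel]; ring)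
  · rcases m with _ | m
    · norm_num
    · exact Submodule.smul_mem _ _ ((lenLE_dVy.mul (lenLE_Vy.pow _)).mulCβ_mem (by
        rw [show m + 1 + 1 - 2 = m by omega]; push_cast; ring))

/-! ## Cocycles with prescribed leading term -/

lemma mulCγ_sub (p p' : Bos) : mulCγ (p - p') = mulCγ p - mulCγ p' := by
  simp only [mulCγ, bb, sub_mul, tm_sub_left]
  abel

lemma mulCβ_sub (p p' : Bos) : mulCβ (p - p') = mulCβ p - mulCβ p' := by
  simp only [mulCβ, bb, sub_mul, tm_sub_left]
  abel

lemma mul_mulCγ (p p' : Bos) : tm p 1 * mulCγ p' = mulCγ (p * p') := by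
  simp only [mulCγ, bb, mul_add, tm_mul_tm, one_mul, mul_assoc]

lemma mul_mulCβ (p p' : Bos) : tm p 1 * mulCβ p' = mulCβ (p * p') := by
  simp only [mulCβ, bb, mul_add, tm_mul_tm, one_mul, mul_assoc]

lemma lowerDer_Gv (i : Root) (k : ℕ) : lowerDer (Gv i k) = 0 := by
  simp [lowerDer]

lemma lowerDer_hf : lowerDer hf = 0 := by
  simp [lowerDer, pderiv_hf]

lemma lowerDer_Bv_h : lowerDer (Bv .h 0) = -Gv .h 0 := by
  simp [lowerDer, MvPolynomial.pderiv_X]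

lemma lowerDer_Bv_x : lowerDer (Bv .x 0) = -(hf * Gv .y 0) := by
  simp [lowerDer, MvPolynomial.pderiv_X]

lemma lowerDer_Bv_y : lowerDer (Bv .y 0) = -(hf * Gv .x 0) := by
  simp [lowerDer, MvPolynomial.pderiv_X]

lemma vx_zero_mulCγ {p : Bos} (hp : ∀ i k, 1 ≤ k → pderiv (.inl i, k) p = 0) :
    vx.1 0 (mulCγ p) = mulCγ (lowerDer p) := by
  have h : ∀ j i k, 1 ≤ k → pderiv (.inl i, k) (p * Gv j 0) = 0 := fun j i k hk =>
    pderiv_mul_eq_zero (hp i k hk) (pderiv_inl_Gv _ _ _ _)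
  have h' : ∀ j i k, 1 ≤ k → pderiv (.inl i, k) (p * (hf * Gv j 0)) = 0 := fun j i k hk =>
    pderiv_mul_eq_zero (hp i k hk) (pderiv_mul_eq_zero (pderiv_hf _) (pderiv_inl_Gv _ _ _ _))
  simp only [mulCγ, bb, mul_neg, tm_neg_left, map_add, map_neg]
  rw [vx_zero_tm (h _), vx_zero_tm (h' _), vx_zero_tm (h' _)]
  simp only [Derivation.leibniz, lowerDer_Gv, lowerDer_hf, mul_zero, zero_add, add_zero,
    smul_eq_mul, mul_comm (lowerDer p)]

/-- By the Leibniz rule `v^x(0)` hits either `p` or the `β` in `C^{βbb}`, which becomes `C^{γbb}`.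
-/
lemma vx_zero_mulCβ {p : Bos} (hp : ∀ i k, 1 ≤ k → pderiv (.inl i, k) p = 0) :
    vx.1 0 (mulCβ p) = mulCβ (lowerDer p) + mulCγ p := by
  have h : ∀ j i k, 1 ≤ k → pderiv (.inl i, k) (p * Bv j 0) = 0 := fun j i k hk =>
    pderiv_mul_eq_zero (hp i k hk) (pderiv_inl_Bv_zero _ _ _ hk)
  simp only [mulCγ, mulCβ, bb, mul_neg, tm_neg_left, map_add, map_neg]
  rw [vx_zero_tm (h _), vx_zero_tm (h _), vx_zero_tm (h _)]
  simp only [Derivation.leibniz, lowerDer_Bv_h, lowerDer_Bv_x, lowerDer_Bv_y, smul_eq_mul,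
    mul_comm (lowerDer p), tm_add_left, mul_neg, tm_neg_left]
  abel

/-- The leading term of the cocycle with leading coefficient `(v^y)^m (v^h)^d`. -/
def leadTerm (m d : ℕ) : Weil :=
  mulCγ (Vy ^ m * Vh ^ d) - (1 / (2 * m + d + 2) : ℂ) • mulCβ (lowerDer (Vy ^ m * Vh ^ d))

/-- `ω` is a basic cocycle of `b`-number two, homogeneous for weight and degree, with leading
term `leadTerm m d`. -/
structure LiftsLead (m d : ℕ) (ω : Weil) : Prop where
  basic : ω ∈ Wbas
  closed : K0 ω = 0
  num : ω ∈ numGr 2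
  wt : ω ∈ wtGr (2 * m + d + 2)
  deg : ω ∈ degGr (-4 * m)
  lead : ω - leadTerm m d ∈ lenFil (2 * (m + d) + 1)

lemma lowerDer_Vy_pow_mul_Vh_pow (m d : ℕ) : lowerDer (Vy ^ m * Vh ^ d)
    = (m : ℂ) • (Vy ^ (m - 1) * Vh ^ (d + 1)) - (2 * d : ℂ) • (Vx * (Vy ^ m * Vh ^ (d - 1))) := by
  rw [show (2 * d : ℂ) = ((2 * d : ℕ) : ℂ) by push_cast; ring, ← natCast_mul_eq_smul,
    ← natCast_mul_eq_smul, Derivation.leibniz, Derivation.leibniz_pow, Derivation.leibniz_pow,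
    lowerDer_Vy, lowerDer_Vh]
  simp only [smul_eq_mul, nsmul_eq_mul, Nat.cast_mul, Nat.cast_ofNat]
  ring

lemma leadTerm_mem (m d : ℕ) : leadTerm m d ∈ lenFil (2 * (m + d) + 3) := by
  refine Submodule.sub_mem _ (((lenLE_Vy.pow m).mul (lenLE_Vh.pow d)).mulCγ_mem (by ring))
    (Submodule.smul_mem _ _ ?_)
  rw [lowerDer_Vy_pow_mul_Vh_pow, mulCβ_sub, mulCβ_smul, mulCβ_smul]
  refine Submodule.sub_mem _ ?_ ?_
  · rcases m with _ | m
    · simp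
    · exact Submodule.smul_mem _ _ (((lenLE_Vy.pow _).mul (lenLE_Vh.pow _)).mulCβ_mem (by
        push_cast [Nat.add_sub_cancel]; ring))
  · rcases d with _ | d
    · simp
    · exact Submodule.smul_mem _ _ ((lenLE_Vx.mul
        ((lenLE_Vy.pow _).mul (lenLE_Vh.pow _))).mulCβ_mem (by
          push_cast [Nat.add_sub_cancel]; ring))

lemma pderiv_inl_Vy_pow_mul_Vh_pow (m d : ℕ) (i : Root) (k : ℕ) (hk : 1 ≤ k) :
    pderiv (.inl i, k) (Vy ^ m * Vh ^ d) = 0 :=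
  pderiv_mul_eq_zero (pderiv_pow_eq_zero (pderiv_inl_Vy i k hk) _)
    (pderiv_pow_eq_zero (pderiv_inl_Vh i k hk) _)

lemma vx_zero_leadTerm (m d : ℕ) : vx.1 0 (leadTerm m d)
    = ((2 * m + d + 1) / (2 * m + d + 2) : ℂ) • mulCγ (lowerDer (Vy ^ m * Vh ^ d))
      - (1 / (2 * m + d + 2) : ℂ) • mulCβ (lowerDer (lowerDer (Vy ^ m * Vh ^ d))) := by
  have h := pderiv_inl_Vy_pow_mul_Vh_pow
  have h' : ∀ i k, 1 ≤ k → pderiv (.inl i, k) (lowerDer (Vy ^ m * Vh ^ d)) = 0 := fun i k hk => by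
    rw [lowerDer_Vy_pow_mul_Vh_pow, map_sub, Derivation.map_smul, Derivation.map_smul, h _ _ i k hk,
      pderiv_mul_eq_zero (pderiv_inl_Vx i k) (h _ _ i k hk), smul_zero, smul_zero, sub_zero]
  have hne : (2 * m + d + 2 : ℂ) ≠ 0 := by exact_mod_cast (by omega : 2 * m + d + 2 ≠ 0)
  rw [leadTerm, map_sub, map_smul, vx_zero_mulCγ (h _ _), vx_zero_mulCβ h']
  match_scalars
  · field_simp
    ring
  · ring

lemma mul_leadTerm (m d : ℕ) : tm Vx 1 * leadTerm m d = mulCγ (Vx * (Vy ^ m * Vh ^ d))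
    - (1 / (2 * m + d + 2) : ℂ) • mulCβ (Vx * lowerDer (Vy ^ m * Vh ^ d)) := by
  rw [leadTerm, mul_sub, mul_mulCγ, mul_smul_comm, mul_mulCβ]

lemma vx_zero_leadTerm_succ_zero (m : ℕ) : vx.1 0 (leadTerm (m + 1) 0)
    = ((2 * m + 3) * (m + 1) / (2 * m + 4) : ℂ) • leadTerm m 1 := by
  have h₁ : (2 * m + 4 : ℂ) ≠ 0 := by exact_mod_cast (by omega : 2 * m + 4 ≠ 0)
  have h₂ : (2 * m + 3 : ℂ) ≠ 0 := by exact_mod_cast (by omega : 2 * m + 3 ≠ 0)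
  have e : lowerDer (Vy ^ (m + 1) * Vh ^ 0) = (m + 1 : ℂ) • (Vy ^ m * Vh ^ 1) := by
    rw [lowerDer_Vy_pow_mul_Vh_pow]
    simp
  rw [vx_zero_leadTerm, e, Derivation.map_smul, mulCγ_smul, mulCβ_smul, leadTerm]
  push_cast
  rw [show (2 * (m + 1) + 0 + 2 : ℂ) = 2 * m + 4 by ring,
    show (2 * m + 1 + 2 : ℂ) = 2 * m + 3 by ring]
  match_scalars
  · field_simp
    ring
  · field_simp

/-- `lowerDer` either trades a `Vy` for a `Vh` or a `Vh` for `-2 Vx`. In both results the `β`-degree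
drops by one, so the denominator `2m + d + 4` is the same, and `Vx` factors out because `lowerDer`
kills it. -/
lemma vx_zero_leadTerm_succ_succ (m d : ℕ) : vx.1 0 (leadTerm (m + 1) (d + 1))
    = ((2 * m + d + 4) * (m + 1) / (2 * m + d + 5) : ℂ) • leadTerm m (d + 2)
      - (2 * (d + 1) * (2 * m + d + 4) / (2 * m + d + 5) : ℂ) •
        (tm Vx 1 * leadTerm (m + 1) d) := by
  have h₁ : (2 * m + d + 5 : ℂ) ≠ 0 := by exact_mod_cast (by omega : 2 * m + d + 5 ≠ 0)
  have h₂ : (2 * m + d + 4 : ℂ) ≠ 0 := by exact_mod_cast (by omega : 2 * m + d + 4 ≠ 0)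
  have e : lowerDer (Vy ^ (m + 1) * Vh ^ (d + 1)) = (m + 1 : ℂ) • (Vy ^ m * Vh ^ (d + 2))
      - (2 * (d + 1) : ℂ) • (Vx * (Vy ^ (m + 1) * Vh ^ d)) := by
    rw [lowerDer_Vy_pow_mul_Vh_pow]
    simp
  rw [vx_zero_leadTerm, mul_leadTerm, e, map_sub, Derivation.map_smul, Derivation.map_smul,
    Derivation.leibniz lowerDer Vx, lowerDer_Vx, smul_zero, add_zero, smul_eq_mul, mulCγ_sub,
    mulCβ_sub, mulCγ_smul, mulCβ_smul, mulCγ_smul, mulCβ_smul, leadTerm]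
  push_cast
  rw [show (2 * (m + 1) + (d + 1) + 2 : ℂ) = 2 * m + d + 5 by ring,
    show (2 * (m + 1) + (d + 1) + 1 : ℂ) = 2 * m + d + 4 by ring,
    show (2 * m + (d + 2) + 2 : ℂ) = 2 * m + d + 4 by ring,
    show (2 * (m + 1) + d + 2 : ℂ) = 2 * m + d + 4 by ring]
  match_scalars <;> field_simp

lemma liftsLead_hField {n : ℕ} (hn : 1 ≤ n) : LiftsLead n 0 (st (hField n)) where
  basic := hField_mem_Wbas n
  closed := K0_st_hField hn
  num := st_hField_mem_numGr hn
  wt := by simpa using st_hField_mem_wtGr hn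
  deg := st_hField_mem_degGr hn
  lead := by
    have e : leadTerm n 0
        = mulCγ (Vy ^ n) - ((n : ℂ) / (2 * n + 2)) • mulCβ (Vy ^ (n - 1) * Vh) := by
      rw [leadTerm, lowerDer_Vy_pow_mul_Vh_pow, mulCβ_sub, mulCβ_smul, mulCβ_smul]
      simp only [pow_zero, mul_one, Nat.cast_zero, mul_zero, zero_smul, sub_zero, add_zero,
        zero_add, pow_one, smul_smul]
      rw [one_div_mul_eq_div]
    rw [e, Nat.cast_zero, add_zero]
    exact st_hField_symbol hn

/-- A nonnegative mode of `v^x` does not raise length, so the error term stays in the required step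
of the filtration; the scalar only normalises the leading term. -/
lemma LiftsLead.vx_zero {m : ℕ} {ω : Weil} (h : LiftsLead (m + 1) 0 ω) :
    LiftsLead m 1 (((2 * m + 3) * (m + 1) / (2 * m + 4) : ℂ)⁻¹ • vx.1 0 ω) where
  basic := Submodule.smul_mem _ _ (vx_mem_Wbas h.basic 0)
  closed := by rw [map_smul, K0_vx, h.closed, map_zero, smul_zero]
  num := Submodule.smul_mem _ _ (homog_numGr_vx.apply_mem h.num (by ring))
  wt := Submodule.smul_mem _ _ (homog_wtGr_vx.apply_mem h.wt (by push_cast; ring))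
  deg := Submodule.smul_mem _ _ (homog_degGr_vx.apply_mem h.deg (by push_cast; ring))
  lead := by
    have hA : ((2 * m + 3) * (m + 1) / (2 * m + 4) : ℂ) ≠ 0 := by
      refine div_ne_zero (mul_ne_zero ?_ ?_) ?_ <;> norm_cast
    have := hasSymbol_vx.lower 0 _ _ le_rfl h.lead
    rw [map_sub, vx_zero_leadTerm_succ_zero] at this
    rw [← inv_smul_smul₀ hA (leadTerm m 1), ← smul_sub]
    exact Submodule.smul_mem _ _ (lenFil_mono (by push_cast; omega) this)

/-- The second summand cancels the unwanted `Vx * leadTerm (m + 1) d`. The cocycle `ω'` is shorter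
by two, and `v^x(-1)` restores this length while acting as multiplication by `Vx` to top order. -/
lemma LiftsLead.vx_zero_add {m d : ℕ} {ω ω' : Weil} (h : LiftsLead (m + 1) (d + 1) ω)
    (h' : LiftsLead (m + 1) d ω') :
    LiftsLead m (d + 2) (((2 * m + d + 4) * (m + 1) / (2 * m + d + 5) : ℂ)⁻¹ • (vx.1 0 ω
      + (2 * (d + 1) * (2 * m + d + 4) / (2 * m + d + 5) : ℂ) • vx.1 (-1) ω')) where
  basic := Submodule.smul_mem _ _ (Submodule.add_mem _ (vx_mem_Wbas h.basic 0)
    (Submodule.smul_mem _ _ (vx_mem_Wbas h'.basic _)))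
  closed := by
    rw [map_smul, map_add, map_smul, K0_vx, K0_vx, h.closed, h'.closed, map_zero, map_zero,
      smul_zero, add_zero, smul_zero]
  num := Submodule.smul_mem _ _ (Submodule.add_mem _ (homog_numGr_vx.apply_mem h.num (by ring))
    (Submodule.smul_mem _ _ (homog_numGr_vx.apply_mem h'.num (by ring))))
  wt := Submodule.smul_mem _ _ (Submodule.add_mem _
    (homog_wtGr_vx.apply_mem h.wt (by push_cast; ring))
    (Submodule.smul_mem _ _ (homog_wtGr_vx.apply_mem h'.wt (by push_cast; ring))))
  deg := Submodule.smul_mem _ _ (Submodule.add_mem _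
    (homog_degGr_vx.apply_mem h.deg (by push_cast; ring))
    (Submodule.smul_mem _ _ (homog_degGr_vx.apply_mem h'.deg (by push_cast; ring))))
  lead := by
    have hA : ((2 * m + d + 4) * (m + 1) / (2 * m + d + 5) : ℂ) ≠ 0 := by
      refine div_ne_zero (mul_ne_zero ?_ ?_) ?_ <;> norm_cast
    set A := ((2 * m + d + 4) * (m + 1) / (2 * m + d + 5) : ℂ)
    set B := (2 * (d + 1) * (2 * m + d + 4) / (2 * m + d + 5) : ℂ)
    have h₁ := hasSymbol_vx.lower 0 _ _ le_rfl h.lead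
    have h₂ := hasSymbol_vx.homog (-1) _ _ h'.lead
    have h₃ := hasSymbol_vx.symbol _ _ (leadTerm_mem (m + 1) d)
    rw [map_sub, vx_zero_leadTerm_succ_succ] at h₁
    rw [map_sub] at h₂
    have h₄ := Submodule.add_mem _ (lenFil_mono (q := 2 * (m + d + 2) + 1) (by push_cast; omega) h₁)
      (Submodule.smul_mem _ B (Submodule.add_mem _ (lenFil_mono (by push_cast; omega) h₂)
        (lenFil_mono (by push_cast; omega) h₃)))
    rw [← inv_smul_smul₀ hA (leadTerm m (d + 2)), ← smul_sub]
    refine Submodule.smul_mem _ _ ?_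
    convert h₄ using 1
    · push_cast; ring_nf
    · module

/-- The step reaches `(m, d+2)` from `(m+1, d+1)` and `(m+1, d)`, so the induction runs over `d`
with `m` universally quantified. The bound on `m + d` is needed only to start at `d = 0`. -/
theorem exists_liftsLead (d : ℕ) : ∀ m : ℕ, 1 ≤ m + d → ∃ ω, LiftsLead m d ω := by
  induction d using Nat.twoStepInduction with
  | zero => exact fun m hm => ⟨_, liftsLead_hField (by omega)⟩
  | one =>
    intro m _
    exact ⟨_, (liftsLead_hField (n := m + 1) (by omega)).vx_zero⟩
  | more d ih ih' =>
    intro m _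
    obtain ⟨ω', h'⟩ := ih (m + 1) (by omega)
    obtain ⟨ω, h⟩ := ih' (m + 1) (by omega)
    exact ⟨_, h.vx_zero_add h'⟩

/-! ## Evaluation on the Cartan locus -/

/-- The images of the even variables on the Cartan locus `(β^h, γ^{h'})`. -/
def locusVar (v : Var) : MvPolynomial (Fin 2) ℂ :=
  if v = (.inl .h, 0) then MvPolynomial.X 0
  else if v = (.inr .h, 0) then MvPolynomial.X 1 else 0

/-- Evaluation of even polynomials on the Cartan locus. -/
def evLocus : Bos →ₐ[ℂ] MvPolynomial (Fin 2) ℂ := MvPolynomial.aeval locusVar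

/-- Evaluation on the Cartan locus of the part without odd variables. -/
def evWeil : Weil →ₗ[ℂ] MvPolynomial (Fin 2) ℂ :=
  TensorProduct.lift ((LinearMap.lsmul ℂ (MvPolynomial (Fin 2) ℂ)).compl₁₂
    (ExteriorAlgebra.algebraMapInv (R := ℂ) (M := Var →₀ ℂ)).toLinearMap
    evLocus.toLinearMap).flip ∘ₗ toWeil.symm.toLinearMap

lemma evWeil_tm (p : Bos) (q : Fer) :
    evWeil (tm p q) = ExteriorAlgebra.algebraMapInv q • evLocus p := rfl

lemma evLocus_X (v : Var) : evLocus (MvPolynomial.X v) = locusVar v := MvPolynomial.aeval_X _ _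

lemma evWeil_tm_one (p : Bos) : evWeil (tm p 1) = evLocus p := by
  rw [evWeil_tm, map_one, one_smul]

lemma evWeil_bosVar_mul (v : Var) (w : Weil) : evWeil (bosVar v * w) = locusVar v * evWeil w := by
  induction w using weil_induction with
  | h₀ => simp
  | h₁ p q =>
    rw [bosVar_mul_tm, evWeil_tm, evWeil_tm, map_mul, evLocus_X, mul_smul_comm]
  | h₂ v w hv hw => simp only [mul_add, map_add, hv, hw]

lemma evWeil_ferVar_mul (v : Var) (w : Weil) : evWeil (ferVar v * w) = 0 := by
  induction w using weil_induction with
  | h₀ => simp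
  | h₁ p q =>
    rw [ferVar_mul_tm, evWeil_tm, map_mul,
      show ExteriorAlgebra.algebraMapInv (fgen v) = (0 : ℂ) by
        simp [ExteriorAlgebra.algebraMapInv], zero_mul, zero_smul]
  | h₂ v w hv hw => simp only [mul_add, map_add, hv, hw, add_zero]

lemma evWeil_ferGen {n : ℤ} (hn : n < 0) (s : Root ⊕ Root) (w : Weil) :
    evWeil ((ferGen s).1 n w) = 0 := by
  obtain ⟨k, rfl⟩ := Int.eq_negSucc_of_lt_zero hn
  rw [ferGen_negSucc]
  exact evWeil_ferVar_mul _ _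

lemma evWeil_bosGen_of_lt {n : ℤ} (hn : n < -1) (s : Root ⊕ Root) (w : Weil) :
    evWeil ((bosGen s).1 n w) = 0 := by
  obtain ⟨k, rfl⟩ := Int.eq_negSucc_of_lt_zero (show n < 0 by omega)
  rw [bosGen_negSucc, LinearMap.mulLeft_apply, evWeil_bosVar_mul]
  have : k ≠ 0 := by omega
  simp [locusVar, this]

lemma evWeil_β_of_ne {n : ℤ} (hn : n < 0) {i : Root} (hi : i ≠ .h) (w : Weil) :
    evWeil ((bosGen (.inl i)).1 n w) = 0 := by
  obtain ⟨k, rfl⟩ := Int.eq_negSucc_of_lt_zero hn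
  rw [bosGen_negSucc, LinearMap.mulLeft_apply, evWeil_bosVar_mul]
  simp [locusVar, hi]

lemma evWeil_γ_of_ne {n : ℤ} (hn : n < 0) {i : Root} (hi : i ≠ .h) (w : Weil) :
    evWeil ((bosGen (.inr i)).1 n w) = 0 := by
  obtain ⟨k, rfl⟩ := Int.eq_negSucc_of_lt_zero hn
  rw [bosGen_negSucc, LinearMap.mulLeft_apply, evWeil_bosVar_mul]
  simp [locusVar, hi]

lemma evWeil_β_h (w : Weil) :
    evWeil ((bosGen (.inl .h)).1 (-1) w) = MvPolynomial.X 0 * evWeil w := by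
  rw [show (-1 : ℤ) = Int.negSucc 0 from rfl, bosGen_negSucc, LinearMap.mulLeft_apply,
    evWeil_bosVar_mul]
  simp [locusVar]

lemma evWeil_γ_h (w : Weil) :
    evWeil ((bosGen (.inr .h)).1 (-1) w) = MvPolynomial.X 1 * evWeil w := by
  rw [show (-1 : ℤ) = Int.negSucc 0 from rfl, bosGen_negSucc, LinearMap.mulLeft_apply,
    evWeil_bosVar_mul]
  simp [locusVar]

/-- `β^h` is a coordinate on the locus, so differentiation along it commutes with restriction. -/
lemma evLocus_pderiv_h (p : Bos) :
    evLocus (pderiv (.inl .h, 0) p) = pderiv (0 : Fin 2) (evLocus p) := by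
  induction p using MvPolynomial.induction_on with
  | C r => rw [evLocus, MvPolynomial.pderiv_C, MvPolynomial.aeval_C, map_zero,
      MvPolynomial.algebraMap_eq, MvPolynomial.pderiv_C]
  | add p q hp hq => simp only [map_add, hp, hq]
  | mul_X p v hp =>
    rw [Derivation.leibniz, map_add, smul_eq_mul, smul_eq_mul, map_mul, map_mul, map_mul, hp,
      Derivation.leibniz, smul_eq_mul, smul_eq_mul, evLocus_X]
    congr 2
    rw [MvPolynomial.pderiv_X, locusVar]
    by_cases h : v = (.inl .h, 0)
    · simp [h]
    · rw [Pi.single_eq_of_ne h, if_neg h, map_zero]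
      split_ifs <;> simp [MvPolynomial.pderiv_X]

lemma evWeil_γ_h_zero (w : Weil) :
    evWeil ((γ .h).1 0 w) = -pderiv (0 : Fin 2) (evWeil w) := by
  induction w using weil_induction with
  | h₀ => simp
  | h₁ p q =>
    rw [γ_tm_nonneg .h 0 (by norm_num), evWeil_tm, evWeil_tm, map_neg, evLocus_pderiv_h,
      Derivation.map_smul, smul_neg]
  | h₂ v w hv hw => simp only [map_add, hv, hw, neg_add]

/-- In the applications an outer creation mode with `j ≥ 1` multiplies by a variable that vanishes
on the locus, and only `j = 0` is left. -/
lemma evWeil_wick {a b : QO} {σ : ℂ} (hs : Swaps a b σ) (m : ℤ) (w : Weil)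
    (h : ∀ j : ℤ, 1 ≤ j → evWeil (a.1 (-1 - j) (b.1 (m + j) w)) = 0)
    (h' : ∀ j : ℤ, 1 ≤ j → evWeil (b.1 (m - 1 - j) (a.1 j w)) = 0) :
    evWeil ((wick a b).1 m w)
      = evWeil (a.1 (-1) (b.1 m w)) + σ • evWeil (b.1 (m - 1) (a.1 0 w)) := by
  obtain ⟨N, hN⟩ := exists_wick_eq_sum a b m w
  rw [hN, map_add, map_sum, Finset.sum_eq_zero, zero_add, hs.wickTerm_apply, map_add, map_smul]
  · simp
  · intro j _
    rw [hs.wickTerm_apply, map_add, map_smul, h _ (by omega), h' _ (by omega), smul_zero, add_zero]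

lemma evWeil_wick_β_γ_one {i : Root} (hi : i ≠ .h) (w : Weil) :
    evWeil ((wick (bosGen (.inl i)) (bosGen (.inr i))).1 1 w)
      = evWeil ((γ i).1 0 ((β i).1 0 w)) := by
  rw [evWeil_wick ((isEven_bosGen _).swaps _) 1 w
    (fun j hj => evWeil_β_of_ne (by omega) hi _) (fun j hj => evWeil_γ_of_ne (by omega) hi _),
    evWeil_β_of_ne (by norm_num) hi, zero_add, one_smul]
  rfl

lemma evWeil_wick_β_h_γ {i : Root} (hi : i ≠ .h) (w : Weil) :
    evWeil ((wick (bosGen (.inl .h)) (bosGen (.inr i))).1 0 w)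
      = MvPolynomial.X 0 * evWeil ((γ i).1 0 w) := by
  rw [evWeil_wick ((isEven_bosGen _).swaps _) 0 w
    (fun j hj => evWeil_bosGen_of_lt (by omega) _ _) (fun j hj => evWeil_γ_of_ne (by omega) hi _),
    evWeil_β_h, evWeil_γ_of_ne (n := 0 - 1) (by norm_num) hi, smul_zero, add_zero]
  rfl

lemma evWeil_wick_β_γ_h {i : Root} (hi : i ≠ .h) (w : Weil) :
    evWeil ((wick (bosGen (.inl i)) (bosGen (.inr .h))).1 0 w)
      = MvPolynomial.X 1 * evWeil ((β i).1 0 w) := by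
  rw [evWeil_wick ((isEven_bosGen _).swaps _) 0 w
    (fun j hj => evWeil_β_of_ne (by omega) hi _) (fun j hj => evWeil_bosGen_of_lt (by omega) _ _),
    evWeil_β_of_ne (by norm_num) hi, zero_add, one_smul, zero_sub, evWeil_γ_h]
  rfl

lemma evWeil_wick_fer_zero (s t : Root ⊕ Root) (w : Weil) :
    evWeil ((wick (ferGen s) (ferGen t)).1 0 w) = 0 := by
  rw [evWeil_wick ((isOdd_ferGen _).swaps (isOdd_ferGen _)) 0 w
    (fun j hj => evWeil_ferGen (by omega) _ _) (fun j hj => evWeil_ferGen (by omega) _ _),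
    evWeil_ferGen (by norm_num), evWeil_ferGen (by norm_num), smul_zero, add_zero]

lemma evWeil_wick_fer_one (s t : Root ⊕ Root) {w : Weil} (hw : (ferGen s).1 0 w = 0) :
    evWeil ((wick (ferGen s) (ferGen t)).1 1 w) = 0 := by
  rw [evWeil_wick ((isOdd_ferGen _).swaps (isOdd_ferGen _)) 1 w
    (fun j hj => evWeil_ferGen (by omega) _ _) (fun j hj => evWeil_ferGen (by omega) _ _),
    evWeil_ferGen (by norm_num), hw, map_zero, map_zero, smul_zero, add_zero]

/-- Each term of `K(0) w` begins with a creation mode of `b`, which evaluation kills, or with one of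
`γ`. Among the latter, only the undifferentiated `γ` can survive on the locus, and its partner is
`b(0)`. -/
lemma evWeil_K0 {w : Weil} (hw : ∀ i, (b i).1 0 w = 0) : evWeil (K0 w) = 0 := by
  rw [K0, K_apply, map_sum]
  refine Finset.sum_eq_zero fun i _ => ?_
  rw [evWeil_wick ((isEven_γ i).swaps (b i)) 0 w
    (fun j hj => evWeil_bosGen_of_lt (by omega) (.inr i) _)
    (fun j hj => evWeil_ferGen (by omega) (.inl i) _), hw, map_zero, map_zero, zero_add]
  exact (congrArg _ (evWeil_ferGen (by norm_num) (.inl i) _)).trans (smul_zero _)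

/-! ## Relations between the modes -/

lemma wick_bos_fer_fer (s t u : Root ⊕ Root) (k n : ℤ) (w : Weil) :
    (wick (bosGen s) (ferGen t)).1 k ((ferGen u).1 n w)
      = -(ferGen u).1 n ((wick (bosGen s) (ferGen t)).1 k w)
        + ferPair t u • (bosGen s).1 (n + k) w := by
  have := wick_comm ((isEven_bosGen s).swaps (ferGen t)) ((ferGen u).1 n) (-1 - n)
    (εa := 1) (εb := -1) (α := 0) (α' := ferPair t u)
    (fun m w => by
      rw [bosGen_ferGen s u, one_smul]
      simp)
    (fun m w => by
      rw [ferGen_anticomm t u, neg_one_smul]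
      congr 3
      exact propext (by omega)) (by simp) (by simp) k w
  rw [this, show k - 1 - (-1 - n) = n + k by ring]
  simp

lemma c_zero_K0 (i : Root) (w : Weil) :
    (c i).1 0 (K0 w) = (γ i).1 0 w - K0 ((c i).1 0 w) := by
  have h : ∀ l : Root, (wick (γ l) (b l)).1 0 ((c i).1 0 w) = _ :=
    fun l => wick_bos_fer_fer (.inr l) (.inl l) (.inr i) 0 0 w
  simp only [K0, K_apply, h, map_sum]
  cases i <;> simp [sum_root, ferPair, bosGen, ferGen] <;> abel

lemma β_zero_K0 (i : Root) (w : Weil) :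
    (β i).1 0 (K0 w) = K0 ((β i).1 0 w) + (b i).1 0 w := by
  have h : ∀ l : Root, (wick (γ l) (b l)).1 0 ((β i).1 0 w) = _ :=
    fun l => wick_bos_fer_bos (.inr l) (.inl l) (.inl i) 0 0 w
  simp only [K0, K_apply, h, map_sum]
  cases i <;> simp [sum_root, bosPair, bosGen, ferGen] <;> abel

lemma b_c_zero (i j : Root) (w : Weil) :
    (b i).1 0 ((c j).1 0 w) = -(c j).1 0 ((b i).1 0 w) := by
  have := ferGen_anticomm (.inl i) (.inr j) 0 0 w
  simpa [ferGen] using this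

lemma b_β_zero (i j : Root) (w : Weil) :
    (b i).1 0 ((β j).1 0 w) = (β j).1 0 ((b i).1 0 w) := (β_b j i 0 0 w).symm

lemma c_γ_zero (i j : Root) (w : Weil) :
    (c i).1 0 ((γ j).1 0 w) = (γ j).1 0 ((c i).1 0 w) := (bosGen_ferGen (.inr j) (.inr i) 0 0 w).symm

lemma γ_β_zero (i j : Root) (w : Weil) :
    (γ i).1 0 ((β j).1 0 w) = (β j).1 0 ((γ i).1 0 w) := by
  have := bosGen_comm (.inr i) (.inl j) 0 0 w
  simpa [bosGen] using this

section Basic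

variable {η : Weil}

/-- Apply `c^h(0)` to `Θ^h(1) η = 0` and evaluate. The odd part vanishes because `η` is horizontal;
in the even part `x` and `y` enter with opposite weights. It is here that invariance under a
positive mode is used. -/
lemma evWeil_Θ_h (hη : η ∈ Wbas) : evWeil ((γ .x).1 0 ((β .x).1 0 ((c .h).1 0 η)))
    = evWeil ((γ .y).1 0 ((β .y).1 0 ((c .h).1 0 η))) := by
  rw [mem_Wbas] at hη
  have hb : ∀ i, (ferGen (.inl i)).1 0 ((c .h).1 0 η) = 0 := fun i =>
    (b_c_zero i .h η).trans (by rw [show (b i).1 0 η = 0 from (hη i 0).1, map_zero, neg_zero])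
  have hf : ∀ i j, i ≠ .h →
      evWeil ((c .h).1 0 ((wick (ferGen (.inl i)) (ferGen (.inr j))).1 1 η)) = 0 := by
    intro i j hi
    have h := wick_fer_fer_fer (.inl i) (.inr j) (.inr .h) 1 0 η
    simp only [ferPair, if_neg hi, zero_smul, add_zero, sub_zero] at h
    rw [show (c .h).1 0 _ = _ from h.symm]
    exact evWeil_wick_fer_one _ _ (hb i)
  have hbo : ∀ i, i ≠ .h →
      evWeil ((c .h).1 0 ((wick (bosGen (.inl i)) (bosGen (.inr i))).1 1 η))
        = evWeil ((γ i).1 0 ((β i).1 0 ((c .h).1 0 η))) := by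
    intro i hi
    rw [← evWeil_wick_β_γ_one hi]
    exact congrArg _ (wick_bos_bos_fer _ _ (.inr .h) 1 0 η).symm
  have h := congrArg (fun w => evWeil ((c .h).1 0 w)) (hη .h 1).2
  simp only [Nat.cast_one, Θ_apply, sum_root, bracket] at h
  simp only [map_add, map_smul, map_sub, map_zero] at h
  rw [hf .x .x (by decide), hf .y .y (by decide), hbo .x (by decide), hbo .y (by decide)] at h
  simp only [zero_smul, add_zero, zero_add, zero_sub] at h
  have h₂ : (2 : ℂ) • (evWeil ((γ .x).1 0 ((β .x).1 0 ((c .h).1 0 η)))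
      - evWeil ((γ .y).1 0 ((β .y).1 0 ((c .h).1 0 η)))) = 0 := by
    rw [← neg_eq_zero, ← h]
    module
  exact sub_eq_zero.mp ((smul_eq_zero_iff_right two_ne_zero).mp h₂)

lemma evWeil_β_c_wick_fer (l j i : Root) :
    evWeil ((β i).1 0 ((c .h).1 0 ((wick (ferGen (.inl l)) (ferGen (.inr j))).1 0 η)))
      = (if l = .h then (1 : ℂ) else 0) • evWeil ((β i).1 0 ((c j).1 0 η)) := by
  have h : (wick (ferGen (.inl l)) (ferGen (.inr j))).1 0 ((c .h).1 0 η)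
      = (c .h).1 0 ((wick (ferGen (.inl l)) (ferGen (.inr j))).1 0 η)
        - (if l = .h then (1 : ℂ) else 0) • (c j).1 0 η := by
    have := wick_fer_fer_fer (.inl l) (.inr j) (.inr .h) 0 0 η
    simp only [ferPair, zero_smul, add_zero] at this
    exact this
  have h' : (wick (ferGen (.inl l)) (ferGen (.inr j))).1 0 ((β i).1 0 ((c .h).1 0 η))
      = (β i).1 0 ((wick (ferGen (.inl l)) (ferGen (.inr j))).1 0 ((c .h).1 0 η)) :=
    wick_fer_fer_bos (.inl l) (.inr j) (.inl i) 0 0 ((c .h).1 0 η)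
  rw [eq_add_of_sub_eq h.symm, map_add, map_add, map_smul, map_smul, ← h',
    evWeil_wick_fer_zero, zero_add]

lemma evWeil_β_c_wick_bos (l j i : Root) :
    evWeil ((β i).1 0 ((c .h).1 0 ((wick (bosGen (.inl l)) (bosGen (.inr j))).1 0 η)))
      = evWeil ((wick (bosGen (.inl l)) (bosGen (.inr j))).1 0 ((β i).1 0 ((c .h).1 0 η)))
        + (if j = i then (1 : ℂ) else 0) • evWeil ((β l).1 0 ((c .h).1 0 η)) := by
  have h := wick_bos_bos_fer (.inl l) (.inr j) (.inr .h) 0 0 η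
  have h' := wick_bos_bos_bos (.inl l) (.inr j) (.inl i) 0 0 ((c .h).1 0 η)
  rw [show (c .h).1 0 _ = _ from h.symm,
    show (wick (bosGen (.inl l)) (bosGen (.inr j))).1 0 ((β i).1 0 ((c .h).1 0 η)) = _ from h',
    map_add, map_add, map_smul, map_smul]
  simp only [bosPair, zero_smul, add_zero]
  split_ifs <;> simp [bosGen, ferGen]

/-- Obtained by applying `β^y(0) c^h(0)` to `Θ^x(0) η = 0` and evaluating: contracting `c^h` with
`b^h` leaves `c^y`, contracting `β^y` with `γ^{y'}` leaves `β^h`, and the other terms come from the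
uncontracted products. -/
lemma evWeil_Θ_x (hη : η ∈ Wbas) : evWeil ((β .y).1 0 ((c .y).1 0 η))
    = MvPolynomial.X 0 * evWeil ((γ .y).1 0 ((β .y).1 0 ((c .h).1 0 η)))
      + evWeil ((β .h).1 0 ((c .h).1 0 η))
      - (2 : ℂ) • (MvPolynomial.X 1 * evWeil ((β .x).1 0 ((β .y).1 0 ((c .h).1 0 η)))) := by
  rw [mem_Wbas] at hη
  have h := congrArg (fun w => evWeil ((β .y).1 0 ((c .h).1 0 w))) (hη .x 0).2
  simp only [Nat.cast_zero, Θ_apply, sum_root, bracket] at h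
  simp only [map_add, map_smul, map_sub, map_zero,
    evWeil_β_c_wick_fer, evWeil_β_c_wick_bos] at h
  simp only [zero_smul, add_zero, zero_add, reduceCtorEq, if_true, if_false, one_smul] at h
  rw [evWeil_wick_β_h_γ (by decide), evWeil_wick_β_γ_h (by decide)] at h
  rw [← sub_eq_zero, ← h]
  module

lemma evWeil_Θ_y (hη : η ∈ Wbas) : evWeil ((β .x).1 0 ((c .x).1 0 η))
    = MvPolynomial.X 0 * evWeil ((γ .x).1 0 ((β .x).1 0 ((c .h).1 0 η)))
      + evWeil ((β .h).1 0 ((c .h).1 0 η))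
      - (2 : ℂ) • (MvPolynomial.X 1 * evWeil ((β .x).1 0 ((β .y).1 0 ((c .h).1 0 η)))) := by
  rw [mem_Wbas] at hη
  have h := congrArg (fun w => evWeil ((β .x).1 0 ((c .h).1 0 w))) (hη .y 0).2
  simp only [Nat.cast_zero, Θ_apply, sum_root, bracket] at h
  simp only [map_add, map_smul, map_sub, map_zero,
    evWeil_β_c_wick_fer, evWeil_β_c_wick_bos] at h
  simp only [zero_smul, add_zero, zero_add, reduceCtorEq, if_true, if_false, one_smul] at h
  rw [evWeil_wick_β_h_γ (by decide), evWeil_wick_β_γ_h (by decide), bosGen_comm_inl .y .x] at h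
  rw [← sub_eq_zero, ← neg_eq_zero, ← h]
  module

/-- `K(0)` is moved to the left. Passing a `c` produces the matching `γ`, passing a `β` produces a
`b(0)`; the latter and the final `K(0)` contribute nothing because `η` is horizontal. The derivative
is the action of `γ^{h'}(0)` on the locus. -/
lemma evWeil_β_c_c_K0 (hη : η ∈ Wbas) (i : Root) :
    evWeil ((β i).1 0 ((c .h).1 0 ((c i).1 0 (K0 η))))
      = evWeil ((γ i).1 0 ((β i).1 0 ((c .h).1 0 η)))
        + pderiv (0 : Fin 2) (evWeil ((β i).1 0 ((c i).1 0 η))) := by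
  rw [mem_Wbas] at hη
  have hb : ∀ l, (b l).1 0 ((c .h).1 0 ((c i).1 0 η)) = 0 := fun l => by
    rw [b_c_zero, b_c_zero, show (b l).1 0 η = 0 from (hη l 0).1]
    simp
  have hK := evWeil_K0 (w := (β i).1 0 ((c .h).1 0 ((c i).1 0 η)))
    fun l => by rw [b_β_zero, hb, map_zero]
  rw [c_zero_K0, map_sub, c_zero_K0, map_sub, map_sub, map_sub, β_zero_K0, map_sub, map_add, hK,
    hb, map_zero, c_γ_zero, ← γ_β_zero, ← γ_β_zero, evWeil_γ_h_zero]
  abel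

/-- A functional on `𝒲` that vanishes on the coboundaries of the basic complex. -/
def detect : Weil →ₗ[ℂ] MvPolynomial (Fin 2) ℂ :=
  evWeil ∘ₗ ((β .x).1 0 * (c .h).1 0 * (c .x).1 0 - (β .y).1 0 * (c .h).1 0 * (c .y).1 0)

lemma detect_apply (w : Weil) : detect w = evWeil ((β .x).1 0 ((c .h).1 0 ((c .x).1 0 w)))
    - evWeil ((β .y).1 0 ((c .h).1 0 ((c .y).1 0 w))) := map_sub evWeil _ _

/-- The formulas for `i = x` and `i = y` differ only in the term `γ_i β_i c^h`, both directly and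
inside the derivative, and `evWeil_Θ_h` identifies the two. -/
theorem detect_K0 (hη : η ∈ Wbas) : detect (K0 η) = 0 := by
  rw [detect_apply, evWeil_β_c_c_K0 hη, evWeil_β_c_c_K0 hη, evWeil_Θ_x hη, evWeil_Θ_y hη,
    evWeil_Θ_h hη, sub_self]

end Basic

/-! ## Degrees of the evaluations -/

lemma totalDegree_locusVar_le (v : Var) : (locusVar v).totalDegree ≤ 1 := by
  rw [locusVar]
  split_ifs <;> simp

lemma totalDegree_evWeil_mono_le (l : List Letter) :
    (evWeil (mono l)).totalDegree ≤ l.length := by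
  induction l with
  | nil => rw [mono_nil, one_eq_tm, evWeil_tm_one, map_one]; simp
  | cons L l ih =>
    rw [mono_cons, List.length_cons, add_comm]
    rcases L with v | v
    · rw [letterVec, evWeil_bosVar_mul]
      exact (MvPolynomial.totalDegree_mul _ _).trans (add_le_add (totalDegree_locusVar_le v) ih)
    · rw [letterVec, evWeil_ferVar_mul]
      simp

lemma coeff_evWeil_eq_zero {p : ℤ} {w : Weil} (hw : w ∈ lenFil p) {e : Fin 2 →₀ ℕ}
    (he : p < e 0 + e 1) : (evWeil w).coeff e = 0 := by
  have : lenFil p ≤ LinearMap.ker (MvPolynomial.lcoeff ℂ e ∘ₗ evWeil) := by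
    refine Submodule.span_le.mpr ?_
    rintro _ ⟨l, hl, rfl⟩
    simp only [List.map_const', List.sum_replicate, mul_one, nsmul_eq_mul] at hl
    have h := totalDegree_evWeil_mono_le l
    refine MvPolynomial.coeff_eq_zero_of_totalDegree_lt (lt_of_le_of_lt h ?_)
    rw [Finset.sum_subset (Finset.subset_univ _) fun i _ hi => Finsupp.notMem_support_iff.mp hi,
      Fin.sum_univ_two]
    omega
  exact this hw

/-- Each of the three annihilation modes in `detect` shortens words by one, and evaluation does not
raise the degree above the length. -/
lemma coeff_detect_eq_zero {p : ℤ} {w : Weil} (hw : w ∈ lenFil p) {e : Fin 2 →₀ ℕ}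
    (he : p - 3 < e 0 + e 1) : (detect w).coeff e = 0 := by
  have hβ : ∀ {q : ℤ} {v : Weil} (i : Root), v ∈ lenFil q → (β i).1 0 v ∈ lenFil (q - 1) :=
    fun i hv => bosGen_mem (.inl i) 0 (fun k hk => by omega) (fun k _ z hz => by omega) hv
  have hc : ∀ {q : ℤ} {v : Weil} (i : Root), v ∈ lenFil q → (c i).1 0 v ∈ lenFil (q - 1) :=
    fun i hv => ferGen_mem (.inr i) 0 (fun k hk => by omega) (fun k _ z hz => by omega) hv
  rw [detect_apply, MvPolynomial.coeff_sub,
    coeff_evWeil_eq_zero (hβ .x (hc .h (hc .x hw))) (by omega),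
    coeff_evWeil_eq_zero (hβ .y (hc .h (hc .y hw))) (by omega), sub_zero]

lemma c_tm_zero (i : Root) (p : Bos) (q : Fer) :
    (c i).1 0 (tm p q) = tm p (contr (.inl i, 0) q) := rfl

lemma contr_fgen (u v : Var) : contr u (fgen v) = (if u = v then (1 : ℂ) else 0) • (1 : Fer) := by
  have := contr_fgen_mul u v 1
  rwa [mul_one, contr_one, mul_zero, sub_zero] at this

lemma detect_bb (p₁ p₂ p₃ : Bos) : detect (bb p₁ p₂ p₃)
    = evLocus (pderiv (.inr .x, 0) p₃) - evLocus (pderiv (.inr .y, 0) p₂) := by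
  rw [detect_apply]
  simp only [bb, map_add, c_tm_zero, contr_fgen_mul, contr_fgen,
    β_tm_nonneg _ 0 (show (0 : ℤ) = (0 : ℕ) by norm_num), map_sub, map_smul, contr_one]
  simp [evWeil_tm, sub_eq_add_neg]

lemma evLocus_hf : evLocus hf = MvPolynomial.C (1 / 2) := by
  rw [hf, evLocus, MvPolynomial.aeval_C, MvPolynomial.algebraMap_eq]

lemma evLocus_Bv_of_ne {i : Root} (hi : i ≠ .h) (k : ℕ) : evLocus (Bv i k) = 0 := by
  simp [evLocus_X, locusVar, hi]

lemma evLocus_Gv_of_ne {i : Root} (hi : i ≠ .h) (k : ℕ) : evLocus (Gv i k) = 0 := by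
  simp [evLocus_X, locusVar, hi]

lemma evLocus_Bv_h : evLocus (Bv .h 0) = MvPolynomial.X 0 := by
  simp [evLocus_X, locusVar]

lemma evLocus_Gv_h : evLocus (Gv .h 0) = MvPolynomial.X 1 := by
  simp [evLocus_X, locusVar]

lemma evLocus_Vx : evLocus Vx = MvPolynomial.C (1 / 2) * MvPolynomial.X 1 ^ 2 := by
  simp only [Vx, map_mul, map_add, evLocus_hf, evLocus_Gv_h, evLocus_Gv_of_ne (i := .x) (by decide)]
  ring

lemma evLocus_Vy : evLocus Vy = -MvPolynomial.C (1 / 2) * MvPolynomial.X 0 ^ 2 := by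
  simp only [Vy, map_mul, map_sub, map_neg, evLocus_hf, evLocus_Bv_h,
    evLocus_Bv_of_ne (i := .x) (by decide)]
  ring

lemma evLocus_Vh : evLocus Vh = MvPolynomial.X 0 * MvPolynomial.X 1 := by
  simp only [Vh, map_mul, map_add, evLocus_Gv_h, evLocus_Bv_h,
    evLocus_Bv_of_ne (i := .x) (by decide), evLocus_Bv_of_ne (i := .y) (by decide)]
  ring

/-- The coefficients `1/2` of `γ^{x'} b^x b^h` and `-1/2` of `γ^{y'} b^y b^h` add up to one in the
difference; derivatives of `p` are multiplied by `γ^{x'}` or `γ^{y'}`, which vanish on the locus. -/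
lemma detect_mulCγ (p : Bos) : detect (mulCγ p) = evLocus p := by
  rw [mulCγ, detect_bb]
  simp only [map_neg, mul_neg, Derivation.leibniz, pderiv_hf, MvPolynomial.pderiv_X_self, map_add,
    smul_eq_mul, map_mul, evLocus_Gv_of_ne (i := .x) (by decide),
    evLocus_Gv_of_ne (i := .y) (by decide), mul_zero, mul_one, evLocus_hf, zero_mul, add_zero]
  rw [sub_neg_eq_add, ← mul_add, ← map_add]
  norm_num

lemma detect_mulCβ (p : Bos) : detect (mulCβ p) = 0 := by
  rw [mulCβ, detect_bb]
  simp only [map_neg, mul_neg, Derivation.leibniz, pderiv_inr_Bv, map_add,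
    smul_eq_mul, map_mul, evLocus_Bv_of_ne (i := .x) (by decide),
    evLocus_Bv_of_ne (i := .y) (by decide), mul_zero, zero_mul, add_zero, map_zero, neg_zero,
    sub_zero]

/-- The exponent of `s ^ a * t ^ b`. -/
def locusExp (a b : ℕ) : Fin 2 →₀ ℕ := Finsupp.single 0 a + Finsupp.single 1 b

lemma locusExp_zero (a b : ℕ) : locusExp a b 0 = a := by simp [locusExp]

lemma locusExp_one (a b : ℕ) : locusExp a b 1 = b := by simp [locusExp]

lemma coeff_locusExp (r : ℂ) (a b : ℕ) :
    (MvPolynomial.C r * (MvPolynomial.X 0 ^ a * MvPolynomial.X 1 ^ b) :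
      MvPolynomial (Fin 2) ℂ).coeff (locusExp a b) = r := by
  rw [MvPolynomial.X_pow_eq_monomial, MvPolynomial.X_pow_eq_monomial, MvPolynomial.monomial_mul,
    MvPolynomial.coeff_C_mul, ← locusExp, MvPolynomial.coeff_monomial, if_pos rfl, mul_one, mul_one]

lemma coeff_detect_leadTerm (m d : ℕ) :
    (detect (leadTerm m d)).coeff (locusExp (2 * m + d) d) = (-(1 / 2)) ^ m := by
  rw [leadTerm, map_sub, map_smul, detect_mulCγ, detect_mulCβ, smul_zero, sub_zero, map_mul,
    map_pow, map_pow, evLocus_Vy, evLocus_Vh, ← coeff_locusExp ((-(1 / 2)) ^ m) (2 * m + d) d]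
  congr 1
  rw [map_pow, map_neg]
  ring

/-- The error term has length at most `2(m+d) + 1`, so `detect` sends it to degree at most `2(m+d) -
2`, below the degree `2(m+d)` of the monomial considered. -/
lemma LiftsLead.coeff_detect {m d : ℕ} {ω : Weil} (h : LiftsLead m d ω) :
    (detect ω).coeff (locusExp (2 * m + d) d) = (-(1 / 2)) ^ m := by
  have := coeff_detect_eq_zero h.lead (e := locusExp (2 * m + d) d)
    (by rw [locusExp_zero, locusExp_one]; push_cast; omega)
  rwa [map_sub, MvPolynomial.coeff_sub, coeff_detect_leadTerm, sub_eq_zero] at this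

lemma LiftsLead.coeff_detect_ne_zero {m d : ℕ} {ω : Weil} (h : LiftsLead m d ω) :
    (detect ω).coeff (locusExp (2 * m + d) d) ≠ 0 := by
  rw [h.coeff_detect]
  exact pow_ne_zero _ (by norm_num)

lemma LiftsLead.hasPolyDegree {m d : ℕ} {ω : Weil} (h : LiftsLead m d ω) :
    HasPolyDegree ω (2 * (m + d) + 3) := by
  refine ⟨?_, fun j hj hω => h.coeff_detect_ne_zero ?_⟩
  · rw [filt_eq, ← sub_add_cancel ω (leadTerm m d)]
    exact Submodule.add_mem _ (lenFil_mono (by push_cast; omega) h.lead)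
      (lenFil_mono (by push_cast; omega) (leadTerm_mem m d))
  · rw [filt_eq] at hω
    exact coeff_detect_eq_zero hω (by rw [locusExp_zero, locusExp_one]; push_cast; omega)

theorem LiftsLead.notMem_coboundaries {m d : ℕ} {ω : Weil} (h : LiftsLead m d ω) (p : ℤ) :
    ω ∉ coboundaries p := by
  rintro ⟨η, hη, rfl⟩
  exact h.coeff_detect_ne_zero (by rw [detect_K0 hη.1, MvPolynomial.coeff_zero])

/-! ## The coefficient of `C^{βbb}` -/

/-- The coefficient of `C^{βbb}` in the cocycle with leading coefficient `(v^y)^m (v^h)^d`. -/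
def lowerField (m d : ℕ) : QO :=
  (-(1 / (2 * m + d + 2)) : ℂ) •
    ((m : ℂ) • vMono 0 (m - 1) (d + 1) + (-(2 * d) : ℂ) • vMono 1 m (d - 1))

lemma lowerField_mem_vPoly (m d : ℕ) : lowerField m d ∈ vPoly (m + d) := by
  refine Submodule.smul_mem _ _ (Submodule.add_mem _ ?_ ?_)
  · rcases m with _ | m
    · simp
    · exact Submodule.smul_mem _ _ (Submodule.subset_span ⟨_, _, _, by omega, rfl⟩)
  · rcases d with _ | d
    · simp
    · exact Submodule.smul_mem _ _ (Submodule.subset_span ⟨_, _, _, by omega, rfl⟩)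

lemma hasSymbol_zero (k : ℤ) : HasSymbol 0 0 k where
  even _ _ := map_zero parity
  homog _ _ _ _ := Submodule.zero_mem _
  lower _ _ _ _ _ := Submodule.zero_mem _
  symbol p w _ := by
    rw [zero_mul, sub_zero]
    exact Submodule.zero_mem _

lemma hasSymbol_lowerField (m d : ℕ) : HasSymbol (lowerField m d)
    (tm ((-(1 / (2 * m + d + 2)) : ℂ) • lowerDer (Vy ^ m * Vh ^ d)) 1) (2 * (m + d)) := by
  have h₁ : HasSymbol ((m : ℂ) • vMono 0 (m - 1) (d + 1))
      ((m : ℂ) • tm (Vy ^ (m - 1) * Vh ^ (d + 1)) 1) (2 * (m + d)) := by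
    rcases m with _ | m
    · simpa using hasSymbol_zero _
    · have := (hasSymbol_vMono 0 m (d + 1)).smul ((m + 1 : ℕ) : ℂ)
      rw [pow_zero, one_mul] at this
      rwa [show (2 : ℤ) * ((0 : ℕ) + m + (d + 1 : ℕ)) = 2 * ((m + 1 : ℕ) + d) by
        push_cast; ring] at this
  have h₂ : HasSymbol ((-(2 * d) : ℂ) • vMono 1 m (d - 1))
      ((-(2 * d) : ℂ) • tm (Vx * (Vy ^ m * Vh ^ (d - 1))) 1) (2 * (m + d)) := by
    rcases d with _ | d
    · simpa using hasSymbol_zero _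
    · have := (hasSymbol_vMono 1 m d).smul (-(2 * (d + 1 : ℕ)) : ℂ)
      rw [pow_one, mul_assoc] at this
      rwa [show (2 : ℤ) * ((1 : ℕ) + m + d) = 2 * (m + (d + 1 : ℕ)) by
        push_cast; ring] at this
  have := (h₁.add h₂).smul (-(1 / (2 * m + d + 2)) : ℂ)
  rwa [neg_smul (2 * d : ℂ) (tm _ _), ← sub_eq_add_neg, ← tm_smul_left, ← tm_smul_left,
    ← tm_sub_left, ← lowerDer_Vy_pow_mul_Vh_pow, ← tm_smul_left] at this

lemma creative_vMono (r s t : ℕ) : Creative (vMono r s t) := by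
  refine Creative.nop (fun a ha => ?_) creative_oneQO
  simp only [List.mem_append, List.mem_replicate] at ha
  rcases ha with (⟨-, rfl⟩ | ⟨-, rfl⟩) | ⟨-, rfl⟩
  exacts [creative_vx, creative_vy, creative_vh]

lemma creative_lowerField (m d : ℕ) : Creative (lowerField m d) :=
  (((creative_vMono _ _ _).smul _).add ((creative_vMono _ _ _).smul _)).smul _

/-- On the locus both terms of `lowerDer` are multiples of the same monomial. They do not cancel:
after a common power of `-1/2` is taken out, the coefficients `m` and `d/2` add. -/
lemma evLocus_lowerDer {m d : ℕ} (h : 1 ≤ m + d) : ∃ r : ℂ, r ≠ 0 ∧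
    evLocus (lowerDer (Vy ^ m * Vh ^ d))
      = MvPolynomial.C r * (MvPolynomial.X 0 ^ (2 * m + d - 1) * MvPolynomial.X 1 ^ (d + 1)) := by
  rw [lowerDer_Vy_pow_mul_Vh_pow]
  have h₂ : 2 * (MvPolynomial.C (1 / 2) : MvPolynomial (Fin 2) ℂ) = 1 := by
    rw [← map_ofNat (MvPolynomial.C (σ := Fin 2) (R := ℂ)) 2, ← map_mul]
    norm_num
  simp only [map_sub, map_mul, map_pow, evLocus_Vx, evLocus_Vy, evLocus_Vh,
    MvPolynomial.smul_eq_C_mul, map_natCast, map_ofNat]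
  rcases m with _ | m <;> rcases d with _ | d
  · omega
  · refine ⟨-(d + 1), neg_ne_zero.mpr (by exact_mod_cast d.succ_ne_zero), ?_⟩
    simp only [map_neg, map_add, map_natCast, map_one, mul_zero, zero_add, Nat.add_sub_cancel]
    push_cast
    linear_combination (-((d : MvPolynomial (Fin 2) ℂ) + 1)
      * (MvPolynomial.X 0 ^ d * MvPolynomial.X 1 ^ (d + 2))) * h₂
  · refine ⟨(-(1 / 2)) ^ m * (m + 1), mul_ne_zero (pow_ne_zero _ (by norm_num))
      (by exact_mod_cast m.succ_ne_zero), ?_⟩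
    simp only [map_neg, map_add, map_natCast, map_one, map_mul, map_pow, Nat.add_sub_cancel,
      show 2 * (m + 1) + 0 - 1 = 2 * m + 1 by omega]
    push_cast
    ring
  · have e : (m + 1 + (d + 1) * (1 / 2) : ℂ) = ((2 * m + d + 3 : ℕ) : ℂ) / 2 := by
      push_cast
      ring
    have e' : (m + 1 + (d + 1) * (1 / 2) : ℂ) ≠ 0 := by
      rw [e]
      exact div_ne_zero (Nat.cast_ne_zero.mpr (by omega)) two_ne_zero
    refine ⟨(-(1 / 2)) ^ m * (m + 1 + (d + 1) * (1 / 2)),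
      mul_ne_zero (pow_ne_zero _ (by norm_num)) e', ?_⟩
    simp only [map_neg, map_add, map_natCast, map_one, map_mul, map_pow, Nat.add_sub_cancel,
      show 2 * (m + 1) + (d + 1) - 1 = 2 * m + d + 2 by omega]
    generalize (MvPolynomial.C (1 / 2) : MvPolynomial (Fin 2) ℂ) = H at *
    push_cast
    linear_combination (((d : MvPolynomial (Fin 2) ℂ) + 1) * H * (-H) ^ m
      * (MvPolynomial.X 0 ^ (2 * m + d + 2) * MvPolynomial.X 1 ^ (d + 2))) * h₂

lemma hasPolyDegree_lowerField {m d : ℕ} (h : 1 ≤ m + d) :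
    HasPolyDegree (st (lowerField m d)) (2 * (m + d)) := by
  have h₁ : (1 : Weil) ∈ lenFil 0 := one_mem_gsub le_rfl
  have hs := (hasSymbol_lowerField m d).symbol 0 1 h₁
  obtain ⟨r, hr, he⟩ := evLocus_lowerDer h
  have hN : (-(1 / (2 * m + d + 2)) : ℂ) ≠ 0 := neg_ne_zero.mpr (one_div_ne_zero
    (by exact_mod_cast (by omega : 2 * m + d + 2 ≠ 0)))
  have hc : (evWeil (st (lowerField m d))).coeff (locusExp (2 * m + d - 1) (d + 1)) ≠ 0 := by
    have := coeff_evWeil_eq_zero hs (e := locusExp (2 * m + d - 1) (d + 1))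
      (by rw [locusExp_zero, locusExp_one]; omega)
    rw [mul_one, map_sub, MvPolynomial.coeff_sub, sub_eq_zero, evWeil_tm_one, map_smul, he,
      MvPolynomial.coeff_smul, coeff_locusExp] at this
    rw [st_apply, this]
    exact smul_ne_zero hN hr
  refine ⟨?_, fun j hj hw => hc ?_⟩
  · rw [filt_eq]
    exact lenFil_mono (by push_cast; omega) ((hasSymbol_lowerField m d).homog (-1) 0 1 h₁)
  · rw [filt_eq] at hw
    exact coeff_evWeil_eq_zero hw (by rw [locusExp_zero, locusExp_one]; omega)

/-- `lowerField m d` was chosen so that its symbol is the factor of `C^{βbb}` in `leadTerm m d`; to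
top order the two Wick products therefore give back the leading term. -/
lemma LiftsLead.sub_mem {m d : ℕ} {ω : Weil} (h : LiftsLead m d ω) :
    ω - st (wick (vMono 0 m d) Cγbb) - st (wick (lowerField m d) Cβbb)
      ∈ filt (2 * (m + d) + 1) := by
  have h₁ := (hasSymbol_vMono 0 m d).symbol 3 (st Cγbb)
    (by rw [st_Cγbb_eq]; exact lenLE_one.mulCγ_mem rfl)
  have h₂ := (hasSymbol_lowerField m d).symbol 3 (st Cβbb)
    (by rw [st_Cβbb_eq]; exact lenLE_one.mulCβ_mem rfl)
  rw [← (creative_vMono 0 m d).st_wick creative_Cγbb, pow_zero, one_mul, st_Cγbb_eq, mul_mulCγ,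
    mul_one] at h₁
  rw [← (creative_lowerField m d).st_wick creative_Cβbb, st_Cβbb_eq, mul_mulCβ, mul_one,
    mulCβ_smul] at h₂
  rw [filt_eq]
  have := Submodule.sub_mem _ (Submodule.sub_mem _ (lenFil_mono
    (q := (2 * (m + d) + 1 : ℕ)) (by push_cast; omega) h.lead)
    (lenFil_mono (by push_cast; omega) h₁)) (lenFil_mono (by push_cast; omega) h₂)
  convert this using 1
  rw [leadTerm]
  module

end ChiralSL2

end

/-! ### The theorem -/

open ChiralSL2 in
theorem lemma8p5 (n d : ℕ) (hn : 1 ≤ n) (hd : d ≤ n) :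
    ∃ ω : cocycles (-4 * ((n : ℤ) - d)),
      (ω : Weil) ∈ WbasNum 2 ∧
      (ω : Weil) ∈ wtSub (2 * n - d + 2) ∧
      HasPolyDegree (ω : Weil) (2 * n + 3) ∧
      (∃ f ∈ vPoly n, HasPolyDegree (st f) (2 * n) ∧
        ∃ r ∈ filt (2 * n + 1),
          (ω : Weil) = st (wick (vMono 0 (n - d) d) Cγbb) + st (wick f Cβbb) + r) ∧
      cohClass (-4 * ((n : ℤ) - d)) ω ≠ 0 ∧
      (d = 0 → (ω : Weil) = st (hField n)) := by
  -- `m` is the exponent of `v^y` in the leading coefficient, and the cohomological degree becomes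
  -- `-4m`.
  obtain ⟨m, rfl⟩ : ∃ m, n = m + d := ⟨n - d, by omega⟩
  -- For `d = 0` the cocycle has to be the explicit one, so the bare existence statement is used
  -- only for positive `d`.
  obtain ⟨ω, hω, h₀⟩ : ∃ ω, LiftsLead m d ω ∧ (d = 0 → ω = st (hField (m + d))) := by
    rcases d with _ | d
    · exact ⟨_, liftsLead_hField (by omega), fun _ => rfl⟩
    · obtain ⟨ω, hω⟩ := exists_liftsLead (d + 1) m (by omega)
      exact ⟨ω, hω, fun h => absurd h (by omega)⟩
  have hdeg : ω ∈ degSub (-4 * (((m + d : ℕ) : ℤ) - d)) := by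
    rw [degSub_eq, Nat.cast_add, add_sub_cancel_right]
    exact hω.deg
  refine ⟨⟨ω, ⟨hω.basic, hdeg⟩, hω.closed⟩, ⟨hω.basic, by simpa using hω.num⟩, ?_,
    hω.hasPolyDegree, ⟨lowerField m d, lowerField_mem_vPoly m d, hasPolyDegree_lowerField hn, _,
      hω.sub_mem, ?_⟩, ?_, h₀⟩
  · rw [wtSub_eq, show 2 * (m + d) - d + 2 = 2 * m + d + 2 by omega]
    exact_mod_cast hω.wt
  · rw [Nat.add_sub_cancel]
    abel
  · intro h
    exact hω.notMem_coboundaries _ ((Submodule.Quotient.mk_eq_zero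
      ((coboundaries _).submoduleOf (cocycles _))).mp h)
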